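/- Let $n\ge 2$, let $\mathbb{S}^{n-1}\subset\mathbb{R}^n$ carry the rotation invariant probability measure $d\theta$, and for every $k\ge 0$ let $Y_{k,\ell}$ ($1\le\ell\le d_k$) be a real basis of the space of harmonic homogeneous polynomials of degree $k$ on $\mathbb{R}^n$ ($d_k$ is its dimension), such that all the $Y_{k,\ell}$ together are orthonormal in $L^2(\mathbb{S}^{n-1},d\theta)$. For a signed measure $\mu$ on $\mathbb{R}^n$ of finite total variation let $\mu_{k,\ell}$ be its component measures on $[0,\infty)$, $\int F(r)\,d\mu_{k,\ell}(r)=\int_{\mathbb{R}^n}F(|x|)\,Y_{k,\ell}(x/|x|)\,d\mu(x)$ (at $x=0$ the weight $Y_{k,\ell}(x/|x|)$ is read as $Y_{k,\ell}(0)$). The measure $\mu$ is pseudo-positive if $\mu_{k,\ell}\ge 0$ for all $(k,\ell)$. Its multidimensional Stieltjes–Markov transform is $$\widehat\mu(\zeta,\theta)=\sum_{k,\ell}\zeta^{1-k}\,Y_{k,\ell}(\theta)\int_0^\infty\frac{r^k\,d\mu_{k,\ell}(r)}{\zeta^2-r^2},\qquad \zeta\in\mathbb{C},\ \theta\in\mathbb{S}^{n-1};$$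 it is called absolutely convergent at $(\zeta,\theta)$ if all these integrals converge absolutely and the series converges even with absolute values taken inside the integrals. The Klein–Dirac quadric $\mathrm{KDQ}$ is the quotient of $\mathbb{C}\times\mathbb{S}^{n-1}$ by $(\zeta,\theta)\sim(-\zeta,-\theta)$; the class of $(\zeta,\theta)$ is written $\zeta\theta$, and $B_R=\{\zeta\theta:|\zeta|<R\}$. For $\Omega\subset\mathrm{KDQ}$, the pseudo-positive Nevanlinna class on $\Omega$ consists of the functions $F(\zeta\theta)=\sum_{k,\ell}c_{k,\ell}(\zeta^2)\,\zeta^{-k}\,Y_{k,\ell}(\theta)$ ($\zeta\theta\in\Omega$), where the series converges absolutely and uniformly on compact subsets of $\Omega$ and each $c_{k,\ell}$ is analytic on $\{\zeta^2:\zeta\theta\in\Omega\}$ and on the upper half-plane, with $\operatorname{Im}c_{k,\ell}(z)\ge 0$ for $\operatorname{Im}z>0$. **Theorem.** Let $N\ge 0$. Let $\mu$ be pseudo-positive with absolutely convergent moments $$s_{k,\ell;j}=\int_{\mathbb{R}^n}|x|^{2j}\,Y_{k,\ell}(x)\,d\mu(x)\qquad\text{for all }(k,\ell)\text{ and }0\le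 j\le 2N,$$ and suppose that $|s_{k,\ell;0}|\le C D^k$ for all $(k,\ell)$, with constants $C,D>0$ independent of $(k,\ell)$. Then: 1. For every $R>0$ let $\mu_R$ be the restriction of $\mu$ to the closed ball of radius $R$. For $|\zeta|>R$ and $\theta\in\mathbb{S}^{n-1}$ the transform $\widehat{\mu_R}(\zeta,\theta)$ is absolutely convergent and equals the absolutely convergent integral $$\int\frac{\zeta^{n-1}}{r(\zeta\theta-x)^n}\,d\mu_R(x),\qquad r(\zeta\theta-x)=\zeta\sqrt{1-\tfrac{2\langle\theta,x\rangle}{\zeta}+\tfrac{|x|^2}{\zeta^2}}\quad\text{(principal root)},$$ and $-\zeta^{-1}\widehat{\mu_R}(\zeta,\theta)$ is a function of $\zeta\theta$ that belongs to the pseudo-positive Nevanlinna class on $\mathrm{KDQ}\setminus\overline{B_R}$. 2. For $|\zeta|>D$ with $\zeta^2\notin[0,\infty)$ and every $\theta\in\mathbb{S}^{n-1}$, the transform $\widehat\mu(\zeta,\theta)$ is absolutely convergent, and $\widehat\mu(\zeta,\theta)=\lim_{R\to\infty}\widehat{\mu_R}(\zeta,\theta)$. 3. The function $-\zeta^{-1}\widehat\mu(\zeta,\theta)$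 is a function of $\zeta\theta$ and belongs to the pseudo-positive Nevanlinna class on $\{\zeta\theta\in\mathrm{KDQ}\setminus\overline{B_D}:\zeta^2\notin[0,\infty)\}$. 4. For every $(k,\ell)$ the function $\theta\mapsto\widehat\mu(\zeta,\theta)Y_{k,\ell}(\theta)$ is integrable for the $\zeta$ of part 2, and for every $0\le M\le 2N$ and $0<\delta<\pi/2$ $$\lim_{\zeta\to\infty}\zeta^{k+2M+1}\Bigl\{\int_{\mathbb{S}^{n-1}}\widehat\mu(\zeta,\theta)\,Y_{k,\ell}(\theta)\,d\theta-\sum_{j=0}^{M-1}\frac{s_{k,\ell;j}}{\zeta^{k+2j+1}}\Bigr\}=s_{k,\ell;M}$$ uniformly for $\delta\le\arg\zeta^2\le\pi-\delta$. In general the limit in part 4 is not uniform in $(k,\ell)$: for all $n\ge 2$, $Y$ and $N\ge 0$ there is a pseudo-positive $\mu$ satisfying the hypotheses (with some $C,D>0$) for which, with $M=2N$ and for every $\delta\in(0,\pi/2)$, the convergence is not uniform in $(k,\ell)$ and $\zeta$ jointly. -/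

import Mathlib

open MeasureTheory Filter Topology

noncomputable section

namespace KleinDirac

/-- Euclidean `n`-space. -/
abbrev Space (n : ℕ) : Type := EuclideanSpace ℝ (Fin n)

/-- The unit sphere of `n`-space. -/
abbrev Sphere (n : ℕ) : Type := Metric.sphere (0 : Space n) 1

/-- The rotation invariant probability measure on the unit sphere. -/
def sphereMeasure (n : ℕ) : Measure (Sphere n) :=
  ((volume : Measure (Space n)).toSphere Set.univ)⁻¹ • (volume : Measure (Space n)).toSphere

/-- The Laplace operator on real polynomials in `n` variables. -/
def polyLaplacian (n : ℕ) : MvPolynomial (Fin n) ℝ →ₗ[ℝ] MvPolynomial (Fin n) ℝ :=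
  ∑ i : Fin n, (MvPolynomial.pderiv i).toLinearMap ∘ₗ (MvPolynomial.pderiv i).toLinearMap

/-- The space of harmonic polynomials which are homogeneous of degree `k`; restricted to the
sphere these are the spherical harmonics of degree `k`. -/
def solidHarmonics (n k : ℕ) : Submodule ℝ (MvPolynomial (Fin n) ℝ) :=
  MvPolynomial.homogeneousSubmodule (Fin n) ℝ k ⊓ LinearMap.ker (polyLaplacian n)

/-- The dimension `d_k` of the space of spherical harmonics of degree `k`. -/
def harmonicDim (n k : ℕ) : ℕ := Module.finrank ℝ (solidHarmonics n k)

/-- The set of all pairs `(k, ℓ)` with `k ≥ 0` and `ℓ` running through `d_k` values. -/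
abbrev HIndex (n : ℕ) : Type := Σ k : ℕ, Fin (harmonicDim n k)

/-- A real basis `Y_{k,ℓ}` of the spherical harmonics, orthonormal for the normalized surface
measure of the sphere. -/
structure HarmonicBasis (n : ℕ) where
  basis : ∀ k : ℕ, Module.Basis (Fin (harmonicDim n k)) ℝ (solidHarmonics n k)
  orthonormal : ∀ i j : HIndex n,
    ∫ θ : Sphere n,
      MvPolynomial.eval (fun m => (θ : Space n) m) (basis i.1 i.2 : MvPolynomial (Fin n) ℝ) *
      MvPolynomial.eval (fun m => (θ : Space n) m) (basis j.1 j.2 : MvPolynomial (Fin n) ℝ)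
      ∂(sphereMeasure n) = if i = j then 1 else 0

variable {n : ℕ}

/-- The solid harmonic `Y_{k,ℓ}(x)`, where `x` is any point of `n`-space. -/
def HarmonicBasis.val (Y : HarmonicBasis n) (i : HIndex n) (x : Space n) : ℝ :=
  MvPolynomial.eval (fun m => x m) (Y.basis i.1 i.2 : MvPolynomial (Fin n) ℝ)

/-- The component measure `μ_{k,ℓ}` on the half-line `r ≥ 0`: the image under `x ↦ |x|` of the
signed measure `Y_{k,ℓ}(x / |x|) dμ(x)`. At `x = 0` the weight is the value of the solid harmonic
at the origin, that is, `0` for `k ≥ 1` and the constant `Y_{0,1}` for `k = 0`. -/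
def component (Y : HarmonicBasis n) (μ : SignedMeasure (Space n)) (i : HIndex n) :
    SignedMeasure ℝ :=
  (μ.withDensity (fun x => Y.val i (‖x‖⁻¹ • x)) (ContinuousLinearMap.lsmul ℝ ℝ).flip).map
    (fun x => ‖x‖)

/-- Pseudo-positivity (on the whole space): all component measures are nonnegative. -/
def IsPseudoPositive (Y : HarmonicBasis n) (μ : SignedMeasure (Space n)) : Prop :=
  ∀ i, 0 ≤ component Y μ i

/-- The measure `μ` solves the moment problem with data `s_{k,ℓ;j}` for all `(k,ℓ)` and `j ≤ J`,
the moment integrals being absolutely convergent. -/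
def SolvesMomentProblem (Y : HarmonicBasis n) (μ : SignedMeasure (Space n))
    (s : HIndex n → ℕ → ℝ) (J : ℕ) : Prop :=
  ∀ i, ∀ j ≤ J, μ.Integrable (fun x : Space n => ‖x‖ ^ (2 * j) * Y.val i x) ∧
    s i j = ∫ᵛ x, ‖x‖ ^ (2 * j) * Y.val i x ∂<•μ

/-- The growth condition `|s_{k,ℓ;0}| ≤ C D^k`. -/
def GrowthBound (s : HIndex n → ℕ → ℝ) (C D : ℝ) : Prop :=
  ∀ i, |s i 0| ≤ C * D ^ i.1

/-- A square root of `ζ² - 2 ζ ⟨θ, x⟩ + |x|²`, in the form `ζ √(1 - 2 ⟨θ, x⟩ / ζ + |x|² / ζ²)`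
with the principal root, which is holomorphic in `ζ` for `|ζ| > |x|`, asymptotic to `ζ`. -/
def distRoot (ζ : ℂ) (θ : Sphere n) (x : Space n) : ℂ :=
  ζ * (1 - 2 * (inner ℝ (θ : Space n) x : ℝ) / ζ + (‖x‖ : ℂ) ^ 2 / ζ ^ 2) ^ (1 / 2 : ℂ)

theorem distRoot_sq {ζ : ℂ} (hζ : ζ ≠ 0) (θ : Sphere n) (x : Space n) :
    distRoot ζ θ x ^ 2 =
      ζ ^ 2 - 2 * ζ * (inner ℝ (θ : Space n) x : ℝ) + (‖x‖ : ℂ) ^ 2 := by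
  have h : ∀ w : ℂ, (w ^ (1 / 2 : ℂ)) ^ 2 = w := fun w => by
    have := Complex.cpow_nat_inv_pow w (n := 2) two_ne_zero
    simpa only [Nat.cast_ofNat, one_div] using this
  rw [distRoot, mul_pow, h]
  field_simp

/-- The Hua–Aronszajn kernel `ζ^{n-1} / r(ζθ - x)^n`. -/
def kernel (ζ : ℂ) (θ : Sphere n) (x : Space n) : ℂ :=
  ζ ^ (n - 1) / distRoot ζ θ x ^ n

/-- The one-dimensional Stieltjes transform `∫ r^k dμ_{k,ℓ}(r) / (z - r²)`. -/
def componentTransform (Y : HarmonicBasis n) (μ : SignedMeasure (Space n)) (i : HIndex n)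
    (z : ℂ) : ℂ :=
  ∫ᵛ r, (r : ℂ) ^ i.1 / (z - (r : ℂ) ^ 2) ∂<•(component Y μ i)

/-- The multidimensional Stieltjes–Markov transform, as the series
`∑ ζ^{1-k} Y_{k,ℓ}(θ) ∫ r^k dμ_{k,ℓ}(r) / (ζ² - r²)`. -/
def transform (Y : HarmonicBasis n) (μ : SignedMeasure (Space n)) (ζ : ℂ) (θ : Sphere n) : ℂ :=
  ∑' i : HIndex n, ζ ^ (1 - (i.1 : ℤ)) * (Y.val i θ : ℂ) * componentTransform Y μ i (ζ ^ 2)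

/-- Absolute convergence of the Stieltjes–Markov transform at `(ζ, θ)`: of the integrals, and of
the series, with absolute values taken inside the integrals. -/
def TransformConverges (Y : HarmonicBasis n) (μ : SignedMeasure (Space n)) (ζ : ℂ)
    (θ : Sphere n) : Prop :=
  (∀ i : HIndex n,
    (component Y μ i).Integrable (fun r : ℝ => (r : ℂ) ^ i.1 / (ζ ^ 2 - (r : ℂ) ^ 2))) ∧
  Summable (fun i : HIndex n => ‖ζ ^ (1 - (i.1 : ℤ))‖ * |Y.val i θ| *
    ∫ r, ‖(r : ℂ) ^ i.1 / (ζ ^ 2 - (r : ℂ) ^ 2)‖ ∂(component Y μ i).variation)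

/-- The antipodal identification of `(ζ, θ)` and `(-ζ, -θ)`. -/
def antipodal (n : ℕ) : Setoid (ℂ × Sphere n) where
  r p q := q = p ∨ q = (-p.1, -p.2)
  iseqv :=
    { refl := fun _ => Or.inl rfl
      symm := by
        rintro p q (rfl | rfl)
        · exact Or.inl rfl
        · exact Or.inr (by simp)
      trans := by
        rintro p q r (rfl | rfl) (rfl | rfl)
        · exact Or.inl rfl
        · exact Or.inr rfl
        · exact Or.inr rfl
        · exact Or.inl (by simp) }

/-- The Klein–Dirac quadric, with the quotient topology. -/
def KDQ (n : ℕ) : Type := Quotient (antipodal n)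

instance : TopologicalSpace (KDQ n) := inferInstanceAs (TopologicalSpace (Quotient (antipodal n)))

/-- The point `ζθ` of the Klein–Dirac quadric. -/
def KDQ.mk (ζ : ℂ) (θ : Sphere n) : KDQ n := Quotient.mk (antipodal n) (ζ, θ)

/-- The ball `B_R` of the Klein–Dirac quadric. -/
def KDQ.ball (n : ℕ) (R : ℝ) : Set (KDQ n) :=
  {q | ∃ (ζ : ℂ) (θ : Sphere n), ‖ζ‖ < R ∧ q = KDQ.mk ζ θ}

/-- The complement of the closed ball of radius `R` in the Klein–Dirac quadric. -/
def KDQ.exterior (n : ℕ) (R : ℝ) : Set (KDQ n) := (closure (KDQ.ball n R))ᶜ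

/-- The points `ζθ` for which `ζ² ∉ [0, ∞)`. -/
def KDQ.slit (n : ℕ) : Set (KDQ n) :=
  {q | ∃ (ζ : ℂ) (θ : Sphere n), (∀ t : ℝ, 0 ≤ t → ζ ^ 2 ≠ (t : ℂ)) ∧ q = KDQ.mk ζ θ}

/-- `F` is holomorphic on the subset `Ω` of the exterior of a ball of the Klein–Dirac quadric, with
components `c_{k,ℓ}`: it is represented by `∑ c_{k,ℓ}(ζ²) ζ^{-k} Y_{k,ℓ}(θ)`, where the `c_{k,ℓ}`
are analytic functions of `ζ²` for `ζθ ∈ Ω`, and the series converges absolutely and uniformly on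
the compact subsets of `Ω`. -/
structure HasHolomorphicExpansion (Y : HarmonicBasis n) (Ω : Set (KDQ n)) (F : KDQ n → ℂ)
    (c : HIndex n → ℂ → ℂ) : Prop where
  analytic : ∀ i, AnalyticOnNhd ℂ (c i) {z | ∃ (ζ : ℂ) (θ : Sphere n), KDQ.mk ζ θ ∈ Ω ∧ z = ζ ^ 2}
  hasSum : ∀ (ζ : ℂ) (θ : Sphere n), KDQ.mk ζ θ ∈ Ω →
    HasSum (fun i : HIndex n => c i (ζ ^ 2) * (1 / ζ ^ i.1) * (Y.val i θ : ℂ)) (F (KDQ.mk ζ θ))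
  absolute : ∀ K : Set (KDQ n), IsCompact K → K ⊆ Ω →
    SummableUniformlyOn
      (fun (i : HIndex n) (p : ℂ × Sphere n) =>
        ‖c i (p.1 ^ 2) * (1 / p.1 ^ i.1) * (Y.val i p.2 : ℂ)‖)
      {p | KDQ.mk p.1 p.2 ∈ K}

/-- The Nevanlinna class: analytic in the open upper half-plane with nonnegative imaginary part. -/
def nevanlinnaClass : Set (ℂ → ℂ) :=
  {f | AnalyticOnNhd ℂ f {z | 0 < z.im} ∧ ∀ z : ℂ, 0 < z.im → 0 ≤ (f z).im}

/-- The pseudo-positive Nevanlinna class on `Ω`: holomorphic functions all of whose components are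
in the Nevanlinna class. -/
def pseudoPositiveNevanlinna (Y : HarmonicBasis n) (Ω : Set (KDQ n)) : Set (KDQ n → ℂ) :=
  {F | ∃ c : HIndex n → ℂ → ℂ, HasHolomorphicExpansion Y Ω F c ∧ ∀ i, c i ∈ nevanlinnaClass}

/-- `-ζ⁻¹ μ̂(ζ, θ)` is on `Ω` a well defined function of the point `ζθ`, and belongs to the
pseudo-positive Nevanlinna class there. -/
def TransformIsNevanlinna (Y : HarmonicBasis n) (μ : SignedMeasure (Space n))
    (Ω : Set (KDQ n)) : Prop :=
  ∃ F ∈ pseudoPositiveNevanlinna Y Ω, ∀ (ζ : ℂ) (θ : Sphere n), KDQ.mk ζ θ ∈ Ω →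
    F (KDQ.mk ζ θ) = -(ζ⁻¹ * transform Y μ ζ θ)

/-- The restriction of `μ` to the closed ball of radius `R`. -/
def truncation (μ : SignedMeasure (Space n)) (R : ℝ) : SignedMeasure (Space n) :=
  μ.restrict (Metric.closedBall 0 R)

/-- The component `∫ μ̂(ζ, θ) Y_{k,ℓ}(θ) dθ` of the transform. -/
def harmonicCoefficient (Y : HarmonicBasis n) (μ : SignedMeasure (Space n)) (i : HIndex n)
    (ζ : ℂ) : ℂ :=
  ∫ θ : Sphere n, transform Y μ ζ θ * (Y.val i θ : ℂ) ∂(sphereMeasure n)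

/-- The scaled remainder
`ζ^{k+2M+1} (∫ μ̂(ζ, θ) Y_{k,ℓ}(θ) dθ - ∑_{j<M} s_{k,ℓ;j} / ζ^{k+2j+1})`. -/
def scaledRemainder (Y : HarmonicBasis n) (μ : SignedMeasure (Space n)) (s : HIndex n → ℕ → ℝ)
    (M : ℕ) (i : HIndex n) (ζ : ℂ) : ℂ :=
  ζ ^ (i.1 + 2 * M + 1) * (harmonicCoefficient Y μ i ζ -
    ∑ j ∈ Finset.range M, (s i j : ℂ) / ζ ^ (i.1 + 2 * j + 1))

/-- The sector `δ ≤ arg ζ² ≤ π - δ`. -/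
def sector (δ : ℝ) : Set ℂ := {ζ | δ ≤ (ζ ^ 2).arg ∧ (ζ ^ 2).arg ≤ Real.pi - δ}

end KleinDirac

end

open MeasureTheory Filter Topology

noncomputable section

namespace KleinDirac

/-! ### Zonal harmonic polynomials: the algebra -/

section Algebra

open MvPolynomial

variable {n : ℕ}

/-! The starting point is the expansion of the kernel in spherical harmonics. With `r = |x|`, `w =
r/ζ` and `t = ⟨θ, x/r⟩`, the kernel is `ζ⁻¹ (1 - 2tw + w²)^(-n/2)`, that is, `ζ/(ζ² - r²)` times the
Poisson kernel `(1 - w²)(1 - 2tw + w²)^(-n/2)`. The coefficient of `wᵏ` in the Poisson kernel is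
`∑_ℓ Y_{k,ℓ}(θ) Y_{k,ℓ}(x/r)`, and integration term by term against a truncated measure turns the
integral of the kernel into the transform (`hasSum_kernel`, `transform_truncation_eq`).

The coefficients are identified as follows. Explicit zonal polynomials reproduce harmonics under the
Gaussian weight, by integration by parts; polar coordinates carry this over to the sphere and yield
the addition theorem `sum_val_mul_val`. Their three-term recurrence is that of differences of
Gegenbauer polynomials, whose generating function is found from its differential equation.

For the convergence statements pseudo-positivity is essential: the components are positive measures,
so the bound on `s_{k,ℓ;0} = ∫ rᵏ dμ_{k,ℓ}` controls integrals of absolute values. If `|ζ² - r²| ≥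
ε` for the relevant `r`, the term `(k,ℓ)` is at most a constant times `d_k² (D/|ζ|)ᵏ`
(`norm_term_le`). The dimensions `d_k` grow subexponentially, so the series has a summable majorant,
locally uniformly in `|ζ| > D`. Positivity also gives the sign of the imaginary part of `-∫ rᵏ
dμ_{k,ℓ}/(z - r²)`.

For the asymptotics, orthonormality extracts one Stieltjes integral, and iterating `z/(z - r²) = 1 +
r²/(z - r²)` shows that the error is `∫ r^(k+2M+2) dμ_{k,ℓ}/(ζ² - r²)` (`scaledRemainder_sub`). In a
sector `|z - r²| ≥ sin δ · max(|z|, r²)`, and dominated convergence finishes the proof. Uniformity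
fails when `μ_{k,ℓ}` is the mass `R_k⁻ᵏ` at a radius `R_k → ∞`: all zeroth moments are `1`, but the
error at `|ζ| = R_k` does not become small. -/

theorem polyLaplacian_apply (p : MvPolynomial (Fin n) ℝ) :
    polyLaplacian n p = ∑ i, pderiv i (pderiv i p) := by
  simp [polyLaplacian]

theorem pderiv_pderiv_comm (i j : Fin n) (p : MvPolynomial (Fin n) ℝ) :
    pderiv i (pderiv j p) = pderiv j (pderiv i p) := by
  have h : ⁅pderiv (R := ℝ) i, pderiv (R := ℝ) j⁆ = 0 := by
    refine MvPolynomial.derivation_ext fun m => ?_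
    rw [Derivation.commutator_apply, pderiv_X, pderiv_X]
    rcases eq_or_ne m i with rfl | h1 <;> rcases eq_or_ne m j with rfl | h2 <;>
      simp_all
  have := DFunLike.congr_fun h p
  rw [Derivation.commutator_apply] at this
  exact sub_eq_zero.1 this

theorem polyLaplacian_pderiv (i : Fin n) (p : MvPolynomial (Fin n) ℝ) :
    polyLaplacian n (pderiv i p) = pderiv i (polyLaplacian n p) := by
  simp only [polyLaplacian_apply, map_sum]
  exact Finset.sum_congr rfl fun j _ => by
    rw [pderiv_pderiv_comm j i p, pderiv_pderiv_comm j i]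

theorem polyLaplacian_mul (p q : MvPolynomial (Fin n) ℝ) :
    polyLaplacian n (p * q) = polyLaplacian n p * q
      + 2 * ∑ i, pderiv i p * pderiv i q + p * polyLaplacian n q := by
  simp only [polyLaplacian_apply, Finset.mul_sum, Finset.sum_mul, ← Finset.sum_add_distrib]
  refine Finset.sum_congr rfl fun i _ => ?_
  simp only [pderiv_mul, map_add]
  ring

/-- The linear form `x ↦ ⟨η, x⟩` as a polynomial. -/
def linForm (η : Fin n → ℝ) : MvPolynomial (Fin n) ℝ := ∑ i, C (η i) * X i

/-- The polynomial `|x|²`. -/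
def sqNorm (n : ℕ) : MvPolynomial (Fin n) ℝ := ∑ i, X i * X i

/-- The derivative in the direction `η`. -/
def dirDeriv (η : Fin n → ℝ) : Derivation ℝ (MvPolynomial (Fin n) ℝ) (MvPolynomial (Fin n) ℝ) :=
  ∑ i, (C (η i) : MvPolynomial (Fin n) ℝ) • pderiv i

theorem dirDeriv_apply (η : Fin n → ℝ) (p : MvPolynomial (Fin n) ℝ) :
    dirDeriv η p = ∑ i, C (η i) * pderiv i p := by
  change Derivation.coeFnAddMonoidHom (dirDeriv η) p = _
  rw [dirDeriv, map_sum, Finset.sum_apply]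
  rfl

@[simp] theorem pderiv_linForm (η : Fin n → ℝ) (i : Fin n) : pderiv i (linForm η) = C (η i) := by
  simp [linForm, pderiv_X, Pi.single_apply]

@[simp] theorem pderiv_sqNorm (i : Fin n) : pderiv i (sqNorm n) = 2 * X i := by
  simp [sqNorm, pderiv_X, Pi.single_apply, Finset.sum_add_distrib, two_mul]

theorem dirDeriv_linForm {η : Fin n → ℝ} (hη : ∑ i, η i ^ 2 = 1) :
    dirDeriv η (linForm η) = 1 := by
  rw [dirDeriv_apply, ← C_1, ← hη, map_sum]
  exact Finset.sum_congr rfl fun i _ => by rw [pderiv_linForm, ← C_mul, sq]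

theorem dirDeriv_sqNorm (η : Fin n → ℝ) : dirDeriv η (sqNorm n) = 2 * linForm η := by
  rw [dirDeriv_apply, linForm, Finset.mul_sum]
  exact Finset.sum_congr rfl fun i _ => by rw [pderiv_sqNorm]; ring

theorem linForm_isHomogeneous (η : Fin n → ℝ) : (linForm η).IsHomogeneous 1 :=
  IsHomogeneous.sum _ _ _ fun i _ => by
    simpa using (isHomogeneous_C (Fin n) (η i)).mul (isHomogeneous_X ℝ i)

theorem sqNorm_isHomogeneous (n : ℕ) : (sqNorm n).IsHomogeneous 2 :=
  IsHomogeneous.sum _ _ _ fun i _ => (isHomogeneous_X ℝ i).mul (isHomogeneous_X ℝ i)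

theorem _root_.MvPolynomial.IsHomogeneous.dirDeriv {p : MvPolynomial (Fin n) ℝ} {k : ℕ}
    (hp : p.IsHomogeneous k) (η : Fin n → ℝ) : (dirDeriv η p).IsHomogeneous (k - 1) := by
  rw [dirDeriv_apply]
  exact IsHomogeneous.sum _ _ _ fun i _ => by
    simpa using (isHomogeneous_C (Fin n) (η i)).mul (hp.pderiv (i := i))

theorem polyLaplacian_dirDeriv (η : Fin n → ℝ) (p : MvPolynomial (Fin n) ℝ) :
    polyLaplacian n (dirDeriv η p) = dirDeriv η (polyLaplacian n p) := by
  simp only [dirDeriv_apply, map_sum, ← MvPolynomial.smul_eq_C_mul, map_smul,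
    polyLaplacian_pderiv]

theorem polyLaplacian_linForm_mul (η : Fin n → ℝ) (p : MvPolynomial (Fin n) ℝ) :
    polyLaplacian n (linForm η * p) = linForm η * polyLaplacian n p + 2 * dirDeriv η p := by
  rw [polyLaplacian_mul, dirDeriv_apply]
  simp only [polyLaplacian_apply (linForm η), pderiv_linForm, pderiv_C, Finset.sum_const_zero]
  ring

theorem polyLaplacian_sqNorm_mul {p : MvPolynomial (Fin n) ℝ} {k : ℕ} (hp : p.IsHomogeneous k) :
    polyLaplacian n (sqNorm n * p) = sqNorm n * polyLaplacian n p + C (2 * n + 4 * k : ℝ) * p := by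
  have h1 : polyLaplacian n (sqNorm n) = C (2 * n : ℝ) := by
    have (i : Fin n) : pderiv i (2 * X i : MvPolynomial (Fin n) ℝ) = C 2 := by
      rw [← map_ofNat C 2, pderiv_C_mul, pderiv_X_self, mul_one]
    simp only [polyLaplacian_apply, pderiv_sqNorm, this, Finset.sum_const, Finset.card_univ,
      Fintype.card_fin, nsmul_eq_mul, map_mul, map_natCast]
    ring
  have h2 : ∑ i, pderiv i (sqNorm n) * pderiv i p = 2 * (C (k : ℝ) * p) := by
    have := hp.sum_X_mul_pderiv
    simp only [pderiv_sqNorm, mul_assoc, ← Finset.mul_sum, this, nsmul_eq_mul, map_natCast]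
  rw [polyLaplacian_mul, h1, h2]
  simp only [map_add, map_mul, map_ofNat, map_natCast]
  ring

/-- The harmonic homogeneous polynomials, invariant under the rotations which fix the unit vector
`η`, normalized to have the form `⟨η, x⟩ᵏ` plus a multiple of `|x|²`. -/
def zonal (η : Fin n → ℝ) : ℕ → MvPolynomial (Fin n) ℝ
  | 0 => 1
  | k + 1 => linForm η * zonal η k
      - C (1 / (2 * k + n - 2) : ℝ) * (sqNorm n * dirDeriv η (zonal η k))

theorem zonal_zero (η : Fin n → ℝ) : zonal η 0 = 1 := rfl

theorem zonal_succ (η : Fin n → ℝ) (k : ℕ) : zonal η (k + 1) = linForm η * zonal η k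
      - C (1 / (2 * k + n - 2) : ℝ) * (sqNorm n * dirDeriv η (zonal η k)) := rfl

theorem dirDeriv_one (η : Fin n → ℝ) : dirDeriv η 1 = 0 := (dirDeriv η).map_one_eq_zero

theorem zonal_one (η : Fin n → ℝ) : zonal η 1 = linForm η := by
  simp [zonal_succ, zonal_zero]

theorem zonal_isHomogeneous (η : Fin n → ℝ) (k : ℕ) : (zonal η k).IsHomogeneous k := by
  induction k with
  | zero => exact isHomogeneous_one _ _
  | succ k ih =>
    rw [zonal_succ]
    refine Submodule.sub_mem (homogeneousSubmodule (Fin n) ℝ (k + 1)) ?_ ?_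
    · rw [mem_homogeneousSubmodule, add_comm]
      exact (linForm_isHomogeneous η).mul ih
    -- Degree `0` is separate: truncated subtraction would give `|x|² ∂_η h₀` degree `2` instead of
    -- `1`, but that term is zero.
    · rcases k with _ | k
      · simp [zonal_zero]
      · rw [mem_homogeneousSubmodule]
        have := (isHomogeneous_C (Fin n) (1 / (2 * (k + 1 : ℕ) + n - 2) : ℝ)).mul
          ((sqNorm_isHomogeneous n).mul (ih.dirDeriv η))
        convert this using 1
        omega

/-- The correction term is chosen for this: `∂_η h_k` is harmonic of degree `k - 1`, so the
Laplacian of `|x|² ∂_η h_k` is `(2n + 4(k-1)) ∂_η h_k`, and division by `2k + n - 2` leaves exactly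
the `2 ∂_η h_k` produced by the linear factor. -/
theorem polyLaplacian_zonal (hn : 2 ≤ n) (η : Fin n → ℝ) (k : ℕ) :
    polyLaplacian n (zonal η k) = 0 := by
  induction k with
  | zero => simp [zonal_zero, polyLaplacian_apply]
  | succ k ih =>
    rcases k with _ | k
    · simp [zonal_one, polyLaplacian_apply]
    rw [zonal_succ, map_sub, polyLaplacian_linForm_mul, ih, ← smul_eq_C_mul, map_smul,
      polyLaplacian_sqNorm_mul ((zonal_isHomogeneous η (k + 1)).dirDeriv η),
      polyLaplacian_dirDeriv, ih, map_zero, smul_eq_C_mul, mul_zero, mul_zero, zero_add, zero_add,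
      ← mul_assoc, ← C_mul]
    have hn' : (2 : ℝ) ≤ n := by exact_mod_cast hn
    have h : (2 * (k + 1 : ℕ) + n - 2 : ℝ) ≠ 0 := by push_cast; linarith [(Nat.cast_nonneg k : (0:ℝ) ≤ k)]
    have h2 : (1 / (2 * (k + 1 : ℕ) + n - 2) * (2 * n + 4 * (k + 1 - 1 : ℕ)) : ℝ) = 2 := by
      field_simp
      rw [Nat.add_sub_cancel]
      push_cast
      ring
    rw [h2, map_ofNat, sub_self]

/-- The factor in `∂_η h_k = α_k h_{k-1}`. -/
def zonalDeriv (n : ℕ) : ℕ → ℝ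
  | 0 => 0
  | 1 => 1
  | k + 2 => (k + 2) * (k + n - 1) / (2 * k + n)

/-- This turns the defining recursion, which involves a derivative, into a three-term recurrence.
The factor for `k = 1` is listed separately in `zonalDeriv` because the general formula becomes
`0/0` there when `n = 2`. -/
theorem dirDeriv_zonal (hn : 2 ≤ n) {η : Fin n → ℝ} (hη : ∑ i, η i ^ 2 = 1) (k : ℕ) :
    dirDeriv η (zonal η (k + 1)) = C (zonalDeriv n (k + 1)) * zonal η k := by
  have hn' : (2 : ℝ) ≤ n := by exact_mod_cast hn
  have hC : ∀ (a : ℝ) (p : MvPolynomial (Fin n) ℝ), dirDeriv η (C a * p) = C a * dirDeriv η p :=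
    fun a p => by
    rw [← smul_eq_C_mul, ← smul_eq_C_mul, Derivation.map_smul]
  have hT : ∀ p, dirDeriv η (linForm η * p) = p + linForm η * dirDeriv η p := fun p => by
    rw [Derivation.leibniz, dirDeriv_linForm hη]; simp only [smul_eq_mul]; ring
  have hS : ∀ p, dirDeriv η (sqNorm n * p) = 2 * (linForm η * p) + sqNorm n * dirDeriv η p :=
    fun p => by
    rw [Derivation.leibniz, dirDeriv_sqNorm]; simp only [smul_eq_mul]; ring
  induction k using Nat.twoStepInduction with
  | zero => simp [zonal_one, zonal_zero, dirDeriv_linForm hη, zonalDeriv]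
  | one =>
    rw [zonal_succ, map_sub, hC, hT, hS, zonal_one, dirDeriv_linForm hη, dirDeriv_one]
    have : (1 : ℝ) - 1 / (2 * (1 : ℕ) + n - 2) * 2 + 1 = zonalDeriv n 2 := by
      have h : (2 * (1 : ℕ) + n - 2 : ℝ) = n := by push_cast; ring
      have h0 : (n : ℝ) ≠ 0 := by positivity
      rw [h]
      simp only [zonalDeriv]; push_cast
      simp only [mul_zero, zero_add]
      field_simp; ring
    rw [← this]
    simp only [map_add, map_sub, map_mul, map_one, map_ofNat]
    ring
  | more k ih0 ih1 =>
    -- The recursion is solved for `⟨η,x⟩ h_{k+1}`. After substitution `e2` is the comparison of the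
    -- coefficients of `h_{k+2}`, and `e3` makes the multiples of `|x|² h_k` cancel.
    have e1 : linForm η * zonal η (k + 1) = zonal η (k + 2) +
        C (1 / (2 * (k + 1 : ℕ) + n - 2) * zonalDeriv n (k + 1)) * (sqNorm n * zonal η k) := by
      rw [zonal_succ η (k + 1), ih0, C_mul]; ring
    have hk : (2 * (k : ℝ) + n) ≠ 0 := by positivity
    have hk' : (2 * ((k : ℝ) + 1) + n) ≠ 0 := by positivity
    have hk1 : (2 * ((k : ℝ) + 1) + n - 2) ≠ 0 := by ring_nf; ring_nf at hk; exact hk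
    have hk2 : (2 * ((k : ℝ) + 2) + n - 2) ≠ 0 := by ring_nf; ring_nf at hk'; exact hk'
    have e2 : (1 : ℝ) + zonalDeriv n (k + 2) - 2 * (1 / (2 * (k + 2 : ℕ) + n - 2)) *
        zonalDeriv n (k + 2) = zonalDeriv n (k + 3) := by
      simp only [zonalDeriv]; push_cast
      field_simp; ring
    have e3 : (1 : ℝ) / (2 * (k + 1 : ℕ) + n - 2) * (1 - 2 * (1 / (2 * (k + 2 : ℕ) + n - 2)))
        = 1 / (2 * (k + 2 : ℕ) + n - 2) := by
      push_cast
      field_simp; ring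
    rw [zonal_succ η (k + 2), map_sub, hC, hT, hS, ih1, hC, ih0]
    have e2' := congrArg (C : ℝ → MvPolynomial (Fin n) ℝ) e2
    have e3' := congrArg (C : ℝ → MvPolynomial (Fin n) ℝ) e3
    simp only [C_mul, map_add, map_sub, map_one, map_ofNat] at e1 e2' e3'
    generalize C (σ := Fin n) (1 / (2 * ((k + 1 : ℕ) : ℝ) + n - 2)) = a at *
    generalize C (σ := Fin n) (1 / (2 * ((k + 2 : ℕ) : ℝ) + n - 2)) = b at *
    linear_combination (C (zonalDeriv n (k + 2)) - 2 * b * C (zonalDeriv n (k + 2))) * e1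
      + zonal η (k + 2) * e2'
      + C (zonalDeriv n (k + 2)) * C (zonalDeriv n (k + 1)) * sqNorm n * zonal η k * e3'

end Algebra

/-! ### Gaussian integration by parts and the reproducing property -/

section Gaussian

open MvPolynomial

variable {n : ℕ}

theorem integrable_pow_mul_exp_neg_sq_half (j : ℕ) :
    Integrable fun x : ℝ => x ^ j * Real.exp (-x ^ 2 / 2) := by
  have h := integrable_rpow_mul_exp_neg_mul_sq (b := 1 / 2) (by norm_num) (s := j)
    (by linarith [(Nat.cast_nonneg j : (0 : ℝ) ≤ j)])
  refine h.congr (Eventually.of_forall fun x => ?_)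
  simp only [Real.rpow_natCast]
  congr 2
  ring

/-- The moments of the (unnormalized) Gaussian weight. -/
def gaussMoment (j : ℕ) : ℝ := ∫ x : ℝ, x ^ j * Real.exp (-x ^ 2 / 2)

theorem gaussMoment_succ (j : ℕ) : gaussMoment (j + 1) = j * gaussMoment (j - 1) := by
  have hv : ∀ x : ℝ, HasDerivAt (fun x : ℝ => -Real.exp (-x ^ 2 / 2))
      (x * Real.exp (-x ^ 2 / 2)) x := fun x => by
    have := ((((hasDerivAt_id x).pow 2).neg.div_const 2).exp).neg
    refine this.congr_deriv ?_
    simp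
    ring
  have h := integral_mul_deriv_eq_deriv_mul_of_integrable (u := fun x : ℝ => x ^ j)
    (fun x _ => hasDerivAt_pow j x) (fun x _ => hv x) ?_ ?_ ?_
  · rw [gaussMoment, gaussMoment, ← integral_const_mul]
    calc _ = ∫ x : ℝ, x ^ j * (x * Real.exp (-x ^ 2 / 2)) := by
          congr 1; ext x; ring
      _ = _ := by
        rw [h, ← integral_neg]
        congr 1; ext x; ring
  · refine (integrable_pow_mul_exp_neg_sq_half (j + 1)).congr (Eventually.of_forall fun x => ?_)
    simp only [Pi.mul_apply]; ring
  · refine ((integrable_pow_mul_exp_neg_sq_half (j - 1)).const_mul (-j)).congr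
      (Eventually.of_forall fun x => ?_)
    simp only [Pi.mul_apply]; ring
  · refine (integrable_pow_mul_exp_neg_sq_half j).neg.congr (Eventually.of_forall fun x => ?_)
    simp only [Pi.mul_apply, Pi.neg_apply]; ring

theorem eval_monomial_mul_exp (s : Fin n →₀ ℕ) (a : ℝ) (x : Space n) :
    eval (fun m => x m) (monomial s a) * Real.exp (-‖x‖ ^ 2 / 2) =
      a * ∏ i, (x i ^ s i * Real.exp (-x i ^ 2 / 2)) := by
  rw [eval_monomial, Finsupp.prod_fintype _ _ (by simp), Finset.prod_mul_distrib, ← Real.exp_sum,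
    EuclideanSpace.real_norm_sq_eq, ← Finset.sum_div, Finset.sum_neg_distrib, mul_assoc]

theorem integrable_eval_mul_exp (p : MvPolynomial (Fin n) ℝ) :
    Integrable fun x : Space n => eval (fun m => x m) p * Real.exp (-‖x‖ ^ 2 / 2) := by
  induction p using MvPolynomial.induction_on' with
  | monomial s a =>
    simp_rw [eval_monomial_mul_exp]
    refine Integrable.const_mul ?_ a
    exact ((PiLp.volume_preserving_ofLp (Fin n)).integrable_comp_emb
      (MeasurableEquiv.toLp 2 (Fin n → ℝ)).symm.measurableEmbedding).2
      (Integrable.fintype_prod fun i => integrable_pow_mul_exp_neg_sq_half (s i))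
  | add p q hp hq =>
    simp only [map_add, add_mul]
    exact hp.add hq

/-- The integral of a polynomial against the Gaussian weight. -/
def gaussInt (p : MvPolynomial (Fin n) ℝ) : ℝ :=
  ∫ x : Space n, eval (fun m => x m) p * Real.exp (-‖x‖ ^ 2 / 2)

theorem gaussInt_add (p q : MvPolynomial (Fin n) ℝ) :
    gaussInt (p + q) = gaussInt p + gaussInt q := by
  simp only [gaussInt, map_add, add_mul]
  exact integral_add (integrable_eval_mul_exp p) (integrable_eval_mul_exp q)

theorem gaussInt_C_mul (a : ℝ) (p : MvPolynomial (Fin n) ℝ) :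
    gaussInt (C a * p) = a * gaussInt p := by
  simp only [gaussInt, map_mul, eval_C, mul_assoc, integral_const_mul]

/-- Gaussian integration as a linear map. -/
def gaussIntₗ (n : ℕ) : MvPolynomial (Fin n) ℝ →ₗ[ℝ] ℝ where
  toFun := gaussInt
  map_add' := gaussInt_add
  map_smul' a p := by rw [smul_eq_C_mul, gaussInt_C_mul]; rfl

theorem gaussInt_sum {ι : Type*} (s : Finset ι) (p : ι → MvPolynomial (Fin n) ℝ) :
    gaussInt (∑ i ∈ s, p i) = ∑ i ∈ s, gaussInt (p i) :=
  map_sum (gaussIntₗ n) p s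

theorem gaussInt_sub (p q : MvPolynomial (Fin n) ℝ) :
    gaussInt (p - q) = gaussInt p - gaussInt q :=
  map_sub (gaussIntₗ n) p q

theorem gaussInt_monomial (s : Fin n →₀ ℕ) (a : ℝ) :
    gaussInt (monomial s a) = a * ∏ i, gaussMoment (s i) := by
  simp only [gaussInt, eval_monomial_mul_exp, gaussMoment, integral_const_mul]
  rw [← integral_fintype_prod_volume_eq_prod fun i (x : ℝ) => x ^ s i * Real.exp (-x ^ 2 / 2),
    ← (PiLp.volume_preserving_ofLp (Fin n)).integral_comp
      (MeasurableEquiv.toLp 2 (Fin n → ℝ)).symm.measurableEmbedding]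

theorem gaussInt_X_mul (i : Fin n) (p : MvPolynomial (Fin n) ℝ) :
    gaussInt (X i * p) = gaussInt (pderiv i p) := by
  induction p using MvPolynomial.induction_on' with
  | monomial s a =>
    rw [pderiv_monomial, X, monomial_mul, gaussInt_monomial, gaussInt_monomial, one_mul, mul_assoc,
      ← Finset.mul_prod_erase Finset.univ _ (Finset.mem_univ i),
      ← Finset.mul_prod_erase Finset.univ _ (Finset.mem_univ i), ← mul_assoc (s i : ℝ)]
    congr 2
    · simp [add_comm 1, gaussMoment_succ]
    · refine Finset.prod_congr rfl fun j hj => ?_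
      have : i ≠ j := (Finset.ne_of_mem_erase hj).symm
      simp [this]
  | add p q hp hq => rw [mul_add, map_add, gaussInt_add, gaussInt_add, hp, hq]

theorem gaussInt_one_pos : 0 < gaussInt (1 : MvPolynomial (Fin n) ℝ) := by
  have h := integral_gaussian (1 / 2)
  have h0 : gaussMoment 0 = √(Real.pi / (1 / 2)) := by
    rw [← h, gaussMoment]
    congr 1; ext x; rw [pow_zero, one_mul]; congr 1; ring
  have := gaussInt_monomial (0 : Fin n →₀ ℕ) 1
  rw [show (monomial (0 : Fin n →₀ ℕ)) (1 : ℝ) = 1 from rfl] at this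
  rw [this, one_mul]
  refine Finset.prod_pos fun i _ => ?_
  rw [Finsupp.coe_zero, Pi.zero_apply, h0]
  have := Real.pi_pos
  positivity

theorem gaussInt_sqNorm_mul {p : MvPolynomial (Fin n) ℝ} {m : ℕ} (hp : p.IsHomogeneous m) :
    gaussInt (sqNorm n * p) = (n + m) * gaussInt p := by
  have h : ∀ i, gaussInt (X i * X i * p) = gaussInt p + gaussInt (X i * pderiv i p) := fun i => by
    rw [mul_assoc, gaussInt_X_mul, pderiv_mul, pderiv_X_self, one_mul, gaussInt_add]
  rw [sqNorm, Finset.sum_mul, gaussInt_sum]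
  simp only [h, Finset.sum_add_distrib]
  rw [← gaussInt_sum Finset.univ fun i => X i * pderiv i p, hp.sum_X_mul_pderiv, nsmul_eq_mul, ← map_natCast (C : ℝ →+* _),
    gaussInt_C_mul]
  simp
  ring

theorem gaussInt_linForm_mul (η : Fin n → ℝ) (p : MvPolynomial (Fin n) ℝ) :
    gaussInt (linForm η * p) = gaussInt (dirDeriv η p) := by
  rw [linForm, Finset.sum_mul, gaussInt_sum, dirDeriv_apply, gaussInt_sum]
  refine Finset.sum_congr rfl fun i _ => ?_
  rw [mul_assoc, gaussInt_C_mul, gaussInt_C_mul, gaussInt_X_mul]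

theorem mem_solidHarmonics {k : ℕ} {p : MvPolynomial (Fin n) ℝ} :
    p ∈ solidHarmonics n k ↔ p.IsHomogeneous k ∧ polyLaplacian n p = 0 := by
  simp [solidHarmonics]

theorem pderiv_mem_solidHarmonics {k : ℕ} {p : MvPolynomial (Fin n) ℝ}
    (hp : p ∈ solidHarmonics n k) (i : Fin n) : pderiv i p ∈ solidHarmonics n (k - 1) := by
  rw [mem_solidHarmonics] at hp ⊢
  exact ⟨hp.1.pderiv, by rw [polyLaplacian_pderiv, hp.2, map_zero]⟩

theorem dirDeriv_mem_solidHarmonics {k : ℕ} {p : MvPolynomial (Fin n) ℝ}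
    (hp : p ∈ solidHarmonics n k) (η : Fin n → ℝ) :
    dirDeriv η p ∈ solidHarmonics n (k - 1) := by
  rw [mem_solidHarmonics] at hp ⊢
  exact ⟨hp.1.dirDeriv η, by rw [polyLaplacian_dirDeriv, hp.2, map_zero]⟩

/-- Euler's identity replaces `k q` by `∑ x_i ∂_i q`; integrating each `x_i` by parts leaves the
gradient pairing and a Laplacian of `q`, which vanishes. -/
theorem gaussInt_mul_harmonic (g : MvPolynomial (Fin n) ℝ) {q : MvPolynomial (Fin n) ℝ} {k : ℕ}
    (hq : q ∈ solidHarmonics n k) :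
    k * gaussInt (g * q) = ∑ i, gaussInt (pderiv i g * pderiv i q) := by
  rw [mem_solidHarmonics] at hq
  have h : ∀ i, gaussInt (g * (X i * pderiv i q)) =
      gaussInt (pderiv i g * pderiv i q) + gaussInt (g * pderiv i (pderiv i q)) := fun i => by
    rw [← gaussInt_add, ← pderiv_mul, ← gaussInt_X_mul]
    congr 1; ring
  have h2 : ∑ i, gaussInt (g * pderiv i (pderiv i q)) = 0 := by
    rw [← gaussInt_sum, ← Finset.mul_sum, ← polyLaplacian_apply, hq.2, mul_zero]
    exact map_zero (gaussIntₗ n)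
  rw [← add_zero (∑ i, _), ← h2, ← Finset.sum_add_distrib, ← gaussInt_C_mul, map_natCast,
    mul_left_comm, ← nsmul_eq_mul, ← hq.1.sum_X_mul_pderiv, Finset.mul_sum, gaussInt_sum]
  exact Finset.sum_congr rfl fun i _ => h i

/-- Each use of `gaussInt_mul_harmonic` lowers both degrees by one, until the first factor is
constant and its gradient is zero. -/
theorem gaussInt_mul_eq_zero {g q : MvPolynomial (Fin n) ℝ} {m k : ℕ} (hg : g.IsHomogeneous m)
    (hq : q ∈ solidHarmonics n k) (hmk : m < k) : gaussInt (g * q) = 0 := by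
  have h0 : gaussInt (0 : MvPolynomial (Fin n) ℝ) = 0 := map_zero (gaussIntₗ n)
  have hk : (k : ℝ) ≠ 0 := by exact_mod_cast (Nat.ne_zero_of_lt hmk)
  induction m generalizing g q k with
  | zero =>
    have hC : g = C (coeff 0 g) := totalDegree_eq_zero_iff_eq_C.1 (Nat.le_zero.1 hg.totalDegree_le)
    refine (mul_eq_zero_iff_left hk).1 ?_
    rw [gaussInt_mul_harmonic g hq, hC]
    simp [h0]
  | succ m ih =>
    refine (mul_eq_zero_iff_left hk).1 ?_
    rw [gaussInt_mul_harmonic g hq]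
    refine Finset.sum_eq_zero fun i _ => ih (by simpa using hg.pderiv (i := i))
      (pderiv_mem_solidHarmonics hq i) (by omega) (by norm_cast; omega)

theorem zonal_mem_solidHarmonics (hn : 2 ≤ n) (η : Fin n → ℝ) (k : ℕ) :
    zonal η k ∈ solidHarmonics n k :=
  mem_solidHarmonics.2 ⟨zonal_isHomogeneous η k, polyLaplacian_zonal hn η k⟩

theorem eval_dirDeriv_self {p : MvPolynomial (Fin n) ℝ} {k : ℕ} (hp : p.IsHomogeneous k)
    (η : Fin n → ℝ) : eval η (dirDeriv η p) = k * eval η p := by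
  have := congrArg (eval η) hp.sum_X_mul_pderiv
  simpa [dirDeriv_apply] using this

/-- The reproducing property of the zonal polynomials, for the Gaussian weight. -/
theorem gaussInt_zonal_mul (η : Fin n → ℝ) (k : ℕ)
    {q : MvPolynomial (Fin n) ℝ} (hq : q ∈ solidHarmonics n k) :
    gaussInt (zonal η k * q) = gaussInt (1 : MvPolynomial (Fin n) ℝ) * k.factorial * eval η q := by
  induction k generalizing q with
  | zero =>
    have hC : q = C (coeff 0 q) := totalDegree_eq_zero_iff_eq_C.1
      (Nat.le_zero.1 (mem_solidHarmonics.1 hq).1.totalDegree_le)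
    rw [hC, zonal_zero, mul_comm, gaussInt_C_mul]
    simp
    ring
  | succ k ih =>
    have hq' := mem_solidHarmonics.1 hq
    have hd : (dirDeriv η (zonal η k)).IsHomogeneous (k - 1) :=
      (zonal_isHomogeneous η k).dirDeriv η
    -- Multiplication by `|x|²` only rescales the Gaussian integral of a homogeneous polynomial, so
    -- this removes both the correction term of the recursion and one half of the product rule for
    -- the linear factor.
    have h0 : gaussInt (dirDeriv η (zonal η k) * q) = 0 :=
      gaussInt_mul_eq_zero hd hq (by omega)
    rw [zonal_succ, sub_mul, gaussInt_sub, mul_assoc, gaussInt_linForm_mul, mul_assoc,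
      gaussInt_C_mul, mul_assoc, gaussInt_sqNorm_mul (hd.mul hq'.1), h0, Derivation.leibniz,
      gaussInt_add, smul_eq_mul, smul_eq_mul, mul_comm q, h0,
      ih (by simpa using dirDeriv_mem_solidHarmonics hq η), eval_dirDeriv_self hq'.1,
      Nat.factorial_succ]
    push_cast
    ring

theorem gaussInt_sqNorm_pow (k : ℕ) : gaussInt (sqNorm n ^ k) =
    gaussInt (1 : MvPolynomial (Fin n) ℝ) * ∏ j ∈ Finset.range k, (n + 2 * j : ℝ) := by
  induction k with
  | zero => simp
  | succ k ih =>
    rw [pow_succ', gaussInt_sqNorm_mul ((sqNorm_isHomogeneous n).pow k), ih,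
      Finset.prod_range_succ]
    push_cast
    ring

theorem eval_smul_of_isHomogeneous {p : MvPolynomial (Fin n) ℝ} {k : ℕ} (hp : p.IsHomogeneous k)
    (r : ℝ) (x : Fin n → ℝ) : eval (fun i => r * x i) p = r ^ k * eval x p := by
  rw [eval_eq', eval_eq', Finset.mul_sum]
  refine Finset.sum_congr rfl fun d hd => ?_
  have : ∑ i, d i = k := by
    have := hp (mem_support_iff.1 hd)
    rwa [← Finsupp.degree_eq_sum, Finsupp.degree_eq_weight_one]
  simp only [mul_pow, Finset.prod_mul_distrib, Finset.prod_pow_eq_pow_sum, this]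
  ring

theorem nontrivial_space (hn : 2 ≤ n) : Nontrivial (Space n) :=
  Module.nontrivial_of_finrank_pos (R := ℝ) (by rw [finrank_euclideanSpace_fin]; omega)

/-- Polar coordinates split off a radial integral depending only on the degree `m`. Its value is
never needed. -/
theorem exists_gaussInt_eq_sphere (hn : 2 ≤ n) (m : ℕ) : ∃ c : ℝ,
    ∀ p : MvPolynomial (Fin n) ℝ, p.IsHomogeneous m →
      gaussInt p = c * ∫ θ : Sphere n, eval (fun i => (θ : Space n) i) p ∂(sphereMeasure n) := by
  have := nontrivial_space hn
  set V := (volume : Measure (Space n))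
  have hV0 : V.toSphere Set.univ ≠ 0 := Measure.measure_univ_ne_zero.2 V.toSphere_ne_zero
  refine ⟨(V.toSphere Set.univ).toReal * ∫ r : Set.Ioi (0 : ℝ), (r : ℝ) ^ m *
    Real.exp (-(r : ℝ) ^ 2 / 2) ∂(Measure.volumeIoiPow (Module.finrank ℝ (Space n) - 1)),
    fun p hp => ?_⟩
  set f : Space n → ℝ := fun x => eval (fun i => x i) p * Real.exp (-‖x‖ ^ 2 / 2)
  calc gaussInt p = ∫ x : ({(0)}ᶜ : Set (Space n)), f x ∂(V.comap (↑)) := by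
        rw [integral_subtype_comap (measurableSet_singleton _).compl f, restrict_compl_singleton]
        rfl
    _ = ∫ q : Sphere n × Set.Ioi (0 : ℝ), eval (fun i => (q.1 : Space n) i) p *
          ((q.2 : ℝ) ^ m * Real.exp (-(q.2 : ℝ) ^ 2 / 2))
          ∂(V.toSphere.prod (.volumeIoiPow (Module.finrank ℝ (Space n) - 1))) := by
        rw [← V.measurePreserving_homeomorphUnitSphereProd.integral_comp
          (Homeomorph.measurableEmbedding _)]
        refine integral_congr_ae (Eventually.of_forall fun x => ?_)
        have hx : ‖(x : Space n)‖ ≠ 0 := norm_ne_zero_iff.2 x.2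
        simp only [f, homeomorphUnitSphereProd_apply_snd_coe,
          homeomorphUnitSphereProd_apply_fst_coe]
        have h := eval_smul_of_isHomogeneous hp ‖(x : Space n)‖
          (fun i => (‖(x : Space n)‖⁻¹ • (x : Space n)) i)
        simp only [PiLp.smul_apply, smul_eq_mul, mul_inv_cancel_left₀ hx] at h ⊢
        rw [h]
        ring
    _ = _ := by
        rw [integral_prod_mul (fun θ : Sphere n => eval (fun i => (θ : Space n) i) p)
          (fun r : Set.Ioi (0 : ℝ) => (r : ℝ) ^ m * Real.exp (-(r : ℝ) ^ 2 / 2)), sphereMeasure,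
          integral_smul_measure, ENNReal.toReal_inv,
          smul_eq_mul]
        have : (V.toSphere Set.univ).toReal ≠ 0 :=
          ENNReal.toReal_ne_zero.2 ⟨hV0, measure_ne_top _ _⟩
        simp only [V] at this ⊢
        field_simp

theorem isProbabilityMeasure_sphereMeasure (hn : 2 ≤ n) :
    IsProbabilityMeasure (sphereMeasure n) := by
  have := nontrivial_space hn
  have h0 : (volume : Measure (Space n)).toSphere Set.univ ≠ 0 :=
    Measure.measure_univ_ne_zero.2 (Measure.toSphere_ne_zero _)
  exact ⟨by rw [sphereMeasure, Measure.smul_apply, smul_eq_mul,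
    ENNReal.inv_mul_cancel h0 (measure_ne_top _ _)]⟩

theorem eval_sqNorm (x : Space n) : eval (fun i => x i) (sqNorm n) = ‖x‖ ^ 2 := by
  rw [EuclideanSpace.real_norm_sq_eq]
  simp [sqNorm, sq]

theorem eval_sqNorm_sphere (θ : Sphere n) : eval (fun i => (θ : Space n) i) (sqNorm n) = 1 := by
  rw [eval_sqNorm, norm_eq_of_mem_sphere, one_pow]

/-- The constants which make the zonal polynomials a reproducing kernel on the sphere. -/
def zonalConst (n k : ℕ) : ℝ := (∏ j ∈ Finset.range k, (n + 2 * j : ℝ)) / k.factorial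

theorem zonalConst_succ (n k : ℕ) :
    zonalConst n (k + 1) = zonalConst n k * ((n + 2 * k) / (k + 1)) := by
  rw [zonalConst, zonalConst, Finset.prod_range_succ, Nat.factorial_succ, div_mul_div_comm]
  push_cast
  rw [mul_comm (k + 1 : ℝ)]

/-- The reproducing property of the zonal polynomials. -/
theorem integral_zonal_mul (hn : 2 ≤ n) (η : Fin n → ℝ) (k : ℕ) {q : MvPolynomial (Fin n) ℝ}
    (hq : q ∈ solidHarmonics n k) :
    zonalConst n k * ∫ θ : Sphere n, eval (fun i => (θ : Space n) i) (zonal η k * q)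
      ∂(sphereMeasure n) = eval η q := by
  have := isProbabilityMeasure_sphereMeasure hn
  obtain ⟨c, hc⟩ := exists_gaussInt_eq_sphere hn (2 * k)
  -- The unknown constant is eliminated by testing with `|x|^(2k)`, which has the right degree and
  -- equals `1` on the sphere.
  have hS := hc (sqNorm n ^ k) ((sqNorm_isHomogeneous n).pow k)
  simp only [map_pow, eval_sqNorm_sphere, one_pow, integral_const, probReal_univ, smul_eq_mul,
    mul_one, gaussInt_sqNorm_pow] at hS
  have h := hc (zonal η k * q)
    (by simpa [two_mul] using (zonal_isHomogeneous η k).mul (mem_solidHarmonics.1 hq).1)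
  rw [gaussInt_zonal_mul η k hq, ← hS] at h
  have h1 := (gaussInt_one_pos (n := n)).ne'
  have h2 : (k.factorial : ℝ) ≠ 0 := by positivity
  rw [zonalConst, div_mul_eq_mul_div, div_eq_iff h2]
  refine mul_left_cancel₀ h1 ?_
  linear_combination -h

end Gaussian

/-! ### The addition theorem and Gegenbauer polynomials -/

section Zonal

open MvPolynomial

variable {n : ℕ}

theorem sum_sq_sphere (η : Sphere n) : ∑ i, (η : Space n) i ^ 2 = 1 := by
  rw [← EuclideanSpace.real_norm_sq_eq, norm_eq_of_mem_sphere, one_pow]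

theorem eval_linForm (η x : Space n) :
    eval (fun i => x i) (linForm fun i => η i) = inner ℝ η x := by
  simp only [linForm, map_sum, map_mul, eval_C, eval_X, PiLp.inner_apply]
  exact Finset.sum_congr rfl fun i _ => by simp [mul_comm]

/-- The addition theorem: the reproducing kernel of the spherical harmonics of degree `k`. -/
theorem sum_val_mul_val (hn : 2 ≤ n) (Y : HarmonicBasis n) (k : ℕ) (η x : Space n) :
    ∑ l, Y.val ⟨k, l⟩ η * Y.val ⟨k, l⟩ x =
      zonalConst n k * eval (fun i => x i) (zonal (fun i => η i) k) := by
  have := isProbabilityMeasure_sphereMeasure hn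
  have hcont : ∀ p : MvPolynomial (Fin n) ℝ,
      Integrable (fun θ : Sphere n => eval (fun i => (θ : Space n) i) p) (sphereMeasure n) :=
    fun p => Continuous.integrable_of_hasCompactSupport
      ((p.continuous_eval).comp (by fun_prop)) (HasCompactSupport.of_compactSpace _)
  set z : solidHarmonics n k := ⟨zonal (fun i => η i) k, zonal_mem_solidHarmonics hn _ k⟩
  have hz : (z : MvPolynomial (Fin n) ℝ) =
      ∑ l, (Y.basis k).repr z l • (Y.basis k l : MvPolynomial (Fin n) ℝ) := by
    have := congrArg Subtype.val ((Y.basis k).sum_repr z)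
    refine this.symm.trans ?_
    rw [Submodule.coe_sum]
    rfl
  -- Pairing the zonal polynomial with a basis element gives its coordinate by orthonormality, and
  -- the value of the basis element at `η` by the reproducing property.
  have hr : ∀ l, zonalConst n k * (Y.basis k).repr z l = Y.val ⟨k, l⟩ η := fun l => by
    rw [HarmonicBasis.val, ← integral_zonal_mul hn _ k (Y.basis k l).2]
    congr 1
    rw [show zonal (fun i => η i) k = z from rfl, hz]
    simp only [Finset.sum_mul, map_sum, smul_mul_assoc, smul_eval]
    rw [integral_finsetSum _ fun m _ => (hcont _).const_mul _]
    simp only [integral_const_mul, map_mul]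
    rw [Finset.sum_eq_single l]
    · have := Y.orthonormal ⟨k, l⟩ ⟨k, l⟩
      simp only at this
      rw [this]
      simp
    · intro m _ hm
      have := Y.orthonormal ⟨k, m⟩ ⟨k, l⟩
      simp only at this
      rw [this, if_neg (by simpa using hm), mul_zero]
    · simp
  rw [show zonal (fun i => η i) k = z from rfl, hz]
  simp only [map_sum, smul_eval, Finset.mul_sum, ← mul_assoc, hr]
  rfl

/-- The Gegenbauer polynomials for the parameter `n / 2`. -/
def gegenbauer (n : ℕ) (t : ℝ) : ℕ → ℝ
  | 0 => 1
  | 1 => n * t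
  | k + 2 => ((2 * k + n + 2) * t * gegenbauer n t (k + 1) - (k + n) * gegenbauer n t k) / (k + 2)

/-- The reproducing kernel of the spherical harmonics of degree `k` as a function of the inner
product. -/
def zonalValue (n : ℕ) (t : ℝ) : ℕ → ℝ
  | 0 => 1
  | 1 => n * t
  | k + 2 => gegenbauer n t (k + 2) - gegenbauer n t k

theorem gegenbauer_succ_succ (n : ℕ) (t : ℝ) (k : ℕ) : (k + 2) * gegenbauer n t (k + 2) =
    (2 * k + n + 2) * t * gegenbauer n t (k + 1) - (k + n) * gegenbauer n t k := by
  rw [gegenbauer]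
  field_simp

theorem zonalValue_succ_succ (n : ℕ) (t : ℝ) (k : ℕ) : (k + 2) * zonalValue n t (k + 2) =
    (2 * k + n + 2) * (t * gegenbauer n t (k + 1) - gegenbauer n t k) := by
  rw [zonalValue, mul_sub, gegenbauer_succ_succ]
  ring

/-- For `k ≥ 2` both lower terms are differences of Gegenbauer polynomials, and the claim reduces to
their own recurrence two degrees lower. For `k = 0, 1` the initial values are not such differences
and are checked directly. -/
theorem zonalValue_recurrence (hn : 2 ≤ n) (t : ℝ) (k : ℕ) :
    (k + 2) * zonalValue n t (k + 2) = (2 * k + n + 2) * (t * zonalValue n t (k + 1)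
      - zonalDeriv n (k + 1) / (k + 1) * zonalValue n t k) := by
  have hn' : (2 : ℝ) ≤ n := by exact_mod_cast hn
  rw [zonalValue_succ_succ]
  congr 1
  rcases k with _ | _ | k
  · simp [zonalValue, gegenbauer, zonalDeriv]
  · have h1 := zonalValue_succ_succ n t 0
    have h2 := gegenbauer_succ_succ n t 0
    simp only [zonalValue, gegenbauer, zonalDeriv] at h1 h2 ⊢
    push_cast at *
    field_simp
    ring
  · have h2 := gegenbauer_succ_succ n t k
    have hk : (2 * ((k : ℝ) + 1) + n) ≠ 0 := by positivity
    have hc : zonalDeriv n (k + 2 + 1) / ((k + 2 : ℕ) + 1 : ℝ) =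
        (k + n) / (2 * ((k : ℝ) + 1) + n) := by
      simp only [zonalDeriv]
      push_cast
      field_simp
      ring
    have hc' : (k + n) / (2 * ((k : ℝ) + 1) + n) * (2 * ((k : ℝ) + 1) + n) = k + n := by
      field_simp
    simp only [zonalValue, show k + 1 + 1 = k + 2 from rfl, show k + 1 + 2 = k + 3 from rfl, hc]
    refine mul_left_cancel₀ hk ?_
    linear_combination (-1 : ℝ) * h2 + (gegenbauer n t (k + 2) - gegenbauer n t k) * hc'

/-- Both sides satisfy the same three-term recurrence: on the left it comes from `dirDeriv_zonal`,
with `|x|² = 1` on the sphere. -/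
theorem zonalConst_mul_eval_zonal (hn : 2 ≤ n) (η θ : Sphere n) (k : ℕ) :
    zonalConst n k * eval (fun i => (θ : Space n) i) (zonal (fun i => (η : Space n) i) k) =
      zonalValue n (inner ℝ (η : Space n) (θ : Space n)) k := by
  have hn' : (2 : ℝ) ≤ n := by exact_mod_cast hn
  induction k using Nat.twoStepInduction with
  | zero => simp [zonal_zero, zonalConst, zonalValue]
  | one => simp [zonal_one, zonalConst, zonalValue, eval_linForm]
  | more k ih0 ih1 =>
    have h := zonalValue_recurrence hn (inner ℝ (η : Space n) (θ : Space n)) k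
    have hk : (k + 2 : ℝ) ≠ 0 := by positivity
    refine mul_left_cancel₀ hk ?_
    rw [h, ← ih0, ← ih1, zonal_succ _ (k + 1), dirDeriv_zonal hn (sum_sq_sphere η), map_sub,
      map_mul, map_mul, map_mul, map_mul, eval_C, eval_C, eval_linForm, eval_sqNorm_sphere,
      zonalConst_succ n (k + 1), zonalConst_succ n k]
    have hk2 : (2 * ((k : ℝ) + 1) + n - 2) ≠ 0 := by ring_nf; positivity
    push_cast
    field_simp
    ring

theorem sum_val_mul_val_sphere (hn : 2 ≤ n) (Y : HarmonicBasis n) (k : ℕ) (η θ : Sphere n) :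
    ∑ l, Y.val ⟨k, l⟩ (η : Space n) * Y.val ⟨k, l⟩ (θ : Space n) =
      zonalValue n (inner ℝ (η : Space n) (θ : Space n)) k := by
  rw [sum_val_mul_val hn, zonalConst_mul_eval_zonal hn]

end Zonal

/-! ### Generating functions on the unit disc -/

section Generating

variable {n : ℕ}

/-- The Taylor coefficients of a function at the origin. -/
def taylorCoeff (f : ℂ → ℂ) (k : ℕ) : ℂ := iteratedDeriv k f 0 / k.factorial

theorem taylorCoeff_add {f g : ℂ → ℂ} (hf : AnalyticAt ℂ f 0) (hg : AnalyticAt ℂ g 0) (k : ℕ) :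
    taylorCoeff (fun w => f w + g w) k = taylorCoeff f k + taylorCoeff g k := by
  rw [taylorCoeff, iteratedDeriv_fun_add hf.contDiffAt hg.contDiffAt, add_div]
  rfl

theorem taylorCoeff_const_mul (c : ℂ) {f : ℂ → ℂ} (k : ℕ) :
    taylorCoeff (fun w => c * f w) k = c * taylorCoeff f k := by
  rw [taylorCoeff, iteratedDeriv_const_mul_field, mul_div_assoc]
  rfl

theorem taylorCoeff_deriv (f : ℂ → ℂ) (k : ℕ) :
    taylorCoeff (deriv f) k = (k + 1) * taylorCoeff f (k + 1) := by
  rw [taylorCoeff, taylorCoeff, iteratedDeriv_succ', Nat.factorial_succ]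
  push_cast
  have : (k + 1 : ℂ) ≠ 0 := by exact_mod_cast k.succ_ne_zero
  field_simp

theorem taylorCoeff_id_mul_zero (f : ℂ → ℂ) : taylorCoeff (fun w => w * f w) 0 = 0 := by
  simp [taylorCoeff]

theorem taylorCoeff_id_mul_succ {f : ℂ → ℂ} (hf : AnalyticAt ℂ f 0) (k : ℕ) :
    taylorCoeff (fun w => w * f w) (k + 1) = taylorCoeff f k := by
  have h := iteratedDeriv_fun_mul (n := k + 1) (x := (0 : ℂ)) (f := fun w => w) (g := f)
    contDiffAt_id hf.contDiffAt
  rw [taylorCoeff, taylorCoeff, h, Finset.sum_eq_single 1]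
  · rw [iteratedDeriv_one, Nat.factorial_succ]
    have : (k + 1 : ℂ) ≠ 0 := by exact_mod_cast k.succ_ne_zero
    simp
    field_simp
  · intro j _ hj
    rcases j with _ | _ | j
    · simp
    · exact absurd rfl hj
    · rw [iteratedDeriv_succ', show deriv (fun w : ℂ => w) = fun _ => 1 from deriv_id', 
        iteratedDeriv_const]
      simp
  · simp

/-- The imaginary part is `2 Im w (Re w - t)`. If it vanishes, either `w` is real and the value is
at least `(1 - |w|)² > 0`, or `Re w = t` and the value is `1 - |w|² > 0`. Hence the principal power
is holomorphic on the whole disc. -/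
theorem one_sub_mem_slitPlane {t : ℝ} (ht : |t| ≤ 1) {w : ℂ} (hw : ‖w‖ < 1) :
    1 - 2 * t * w + w ^ 2 ∈ Complex.slitPlane := by
  have hw2 : w.re ^ 2 + w.im ^ 2 < 1 := by
    have h := Complex.sq_norm w
    rw [Complex.normSq_apply] at h
    nlinarith [norm_nonneg w]
  have ht2 : t ^ 2 ≤ 1 := (sq_le_one_iff_abs_le_one t).2 ht
  rw [Complex.mem_slitPlane_iff]
  by_contra! h
  simp [sq] at h
  obtain ⟨h1, h2⟩ := h
  have h3 : w.im * (w.re - t) = 0 := by linarith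
  rcases mul_eq_zero.1 h3 with h3 | h3
  · rw [h3] at h1 hw2
    nlinarith [sq_nonneg (w.re - t)]
  · have h4 : w.re = t := by linarith
    rw [h4] at h1 hw2
    nlinarith

/-- The generating function of the Gegenbauer polynomials. -/
def gegenbauerGen (n : ℕ) (t : ℝ) (w : ℂ) : ℂ := (1 - 2 * t * w + w ^ 2) ^ (-(n : ℂ) / 2)

theorem hasDerivAt_gegenbauerGen (n : ℕ) {t : ℝ} (ht : |t| ≤ 1) {w : ℂ} (hw : ‖w‖ < 1) :
    HasDerivAt (gegenbauerGen n t)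
      (n * (t - w) * gegenbauerGen n t w / (1 - 2 * t * w + w ^ 2)) w := by
  have h0 := one_sub_mem_slitPlane ht hw
  have h1 : HasDerivAt (fun w : ℂ => 1 - 2 * t * w + w ^ 2) (-(2 * t) + 2 * w) w := by
    have := (((hasDerivAt_id w).const_mul (2 * t : ℂ)).const_sub 1).add ((hasDerivAt_id w).pow 2)
    refine this.congr_deriv ?_
    simp
  refine (h1.cpow_const h0 (c := -(n : ℂ) / 2)).congr_deriv ?_
  rw [Complex.cpow_sub _ _ (Complex.slitPlane_ne_zero h0), Complex.cpow_one, gegenbauerGen]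
  field_simp
  ring

theorem analyticAt_gegenbauerGen (n : ℕ) {t : ℝ} (ht : |t| ≤ 1) {w : ℂ} (hw : ‖w‖ < 1) :
    AnalyticAt ℂ (gegenbauerGen n t) w := by
  have h : DifferentiableOn ℂ (gegenbauerGen n t) (Metric.ball 0 1) := fun z hz =>
    (hasDerivAt_gegenbauerGen n ht (mem_ball_zero_iff.1 hz)).differentiableAt.differentiableWithinAt
  exact h.analyticAt (Metric.isOpen_ball.mem_nhds (mem_ball_zero_iff.2 hw))

theorem taylorCoeff_gegenbauerGen (n : ℕ) {t : ℝ} (ht : |t| ≤ 1) (k : ℕ) :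
    taylorCoeff (gegenbauerGen n t) k = gegenbauer n t k := by
  set f := gegenbauerGen n t
  have hf : AnalyticAt ℂ f 0 := analyticAt_gegenbauerGen n ht (by simp)
  have hf' : AnalyticAt ℂ (deriv f) 0 := hf.deriv
  -- The differential equation `(1 - 2tw + w²) f' = n (t - w) f`, arranged so that comparing Taylor
  -- coefficients gives the Gegenbauer recurrence.
  have heq : deriv f =ᶠ[𝓝 0] fun w => (2 * t * (w * deriv f w) + n * t * f w) +
      (-1 * (w * (w * deriv f w)) + (-n) * (w * f w)) := by
    filter_upwards [Metric.ball_mem_nhds (0 : ℂ) one_pos] with w hw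
    have hw := mem_ball_zero_iff.1 hw
    have hd := (hasDerivAt_gegenbauerGen n ht hw).deriv
    have h0 := Complex.slitPlane_ne_zero (one_sub_mem_slitPlane ht hw)
    rw [eq_div_iff h0] at hd
    linear_combination hd
  have hrec : ∀ k, (k + 1) * taylorCoeff f (k + 1) = (2 * t * taylorCoeff (fun w => w * deriv f w) k
      + n * t * taylorCoeff f k) + (-1 * taylorCoeff (fun w => w * (w * deriv f w)) k
      + (-n) * taylorCoeff (fun w => w * f w) k) := fun k => by
    rw [← taylorCoeff_deriv, taylorCoeff, heq.iteratedDeriv_eq, ← taylorCoeff]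
    rw [taylorCoeff_add (by fun_prop) (by fun_prop), taylorCoeff_add (by fun_prop) (by fun_prop),
      taylorCoeff_add (by fun_prop) (by fun_prop)]
    simp only [taylorCoeff_const_mul]
  induction k using Nat.twoStepInduction with
  | zero => simp [taylorCoeff, f, gegenbauerGen, gegenbauer]
  | one =>
    have := hrec 0
    rw [taylorCoeff_id_mul_zero, taylorCoeff_id_mul_zero, taylorCoeff_id_mul_zero] at this
    simp [taylorCoeff, f, gegenbauerGen, gegenbauer] at this ⊢
    exact this
  | more k ih0 ih1 =>
    have h := hrec (k + 1)
    have hg := congrArg (fun x : ℝ => (x : ℂ)) (gegenbauer_succ_succ n t k)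
    rw [taylorCoeff_id_mul_succ hf', taylorCoeff_id_mul_succ (by fun_prop),
      taylorCoeff_id_mul_succ hf, taylorCoeff_deriv, ih0, ih1] at h
    have hk : (k + 2 : ℂ) ≠ 0 := by exact_mod_cast (k + 1).succ_ne_zero
    have h2 : taylorCoeff (fun w => w * deriv f w) k = k * taylorCoeff f k := by
      rcases k with _ | k
      · rw [taylorCoeff_id_mul_zero]; simp
      · rw [taylorCoeff_id_mul_succ hf', taylorCoeff_deriv]; push_cast; ring
    rw [h2, ih0] at h
    refine mul_left_cancel₀ hk ?_
    push_cast at h hg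
    rw [hg]
    linear_combination h

theorem hasSum_gegenbauer (n : ℕ) {t : ℝ} (ht : |t| ≤ 1) {w : ℂ} (hw : ‖w‖ < 1) :
    HasSum (fun k => (gegenbauer n t k : ℂ) * w ^ k) (gegenbauerGen n t w) := by
  have h : DifferentiableOn ℂ (gegenbauerGen n t) (Metric.ball 0 (1 : NNReal)) := fun z hz =>
    (hasDerivAt_gegenbauerGen n ht
      (by simpa using hz)).differentiableAt.differentiableWithinAt
  have := Complex.hasSum_taylorSeries_on_ball h (z := w) (by simpa using hw)
  refine this.congr_fun fun k => ?_
  rw [← taylorCoeff_gegenbauerGen n ht, taylorCoeff, sub_zero, smul_eq_mul, smul_eq_mul]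
  ring

/-- The expansion of the Poisson kernel. -/
theorem hasSum_zonalValue (n : ℕ) {t : ℝ} (ht : |t| ≤ 1) {w : ℂ} (hw : ‖w‖ < 1) :
    HasSum (fun k => (zonalValue n t k : ℂ) * w ^ k) ((1 - w ^ 2) * gegenbauerGen n t w) := by
  have h := hasSum_gegenbauer n ht hw
  have h2 : HasSum (fun k => if k < 2 then 0 else (gegenbauer n t (k - 2) : ℂ) * w ^ k)
      (w ^ 2 * gegenbauerGen n t w) := by
    rw [← hasSum_nat_add_iff' 2]
    rw [show ∑ i ∈ Finset.range 2, (if i < 2 then 0 else (gegenbauer n t (i - 2) : ℂ) * w ^ i) = 0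
      by simp [Finset.sum_range_succ], sub_zero]
    refine (h.mul_left (w ^ 2)).congr_fun fun k => ?_
    simp
    ring
  rw [sub_mul, one_mul]
  refine (h.sub h2).congr_fun fun k => ?_
  rcases k with _ | _ | k
  · simp [zonalValue, gegenbauer]
  · simp [zonalValue, gegenbauer]
  · simp [zonalValue]
    ring

theorem summable_zonalValue_one (n : ℕ) {ρ : ℝ} (h0 : 0 ≤ ρ) (h1 : ρ < 1) :
    Summable (fun k => zonalValue n 1 k * ρ ^ k) := by
  have := (hasSum_zonalValue n (t := 1) (by simp) (w := ρ) (by simpa [abs_of_nonneg h0])).summable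
  exact_mod_cast this

/-- Radius of convergence at least `1` survives squaring the coefficients: with `σ = ρ^(1/4)` the
sequence `a_k σᵏ` is bounded, so `a_k² ρᵏ` is dominated by a geometric series of ratio `σ² < 1`.
This replaces any explicit growth estimate for `d_k`. -/
theorem summable_sq_mul_pow {a : ℕ → ℝ}
    (ha : ∀ ρ : ℝ, 0 ≤ ρ → ρ < 1 → Summable fun k => a k * ρ ^ k) {ρ : ℝ} (h0 : 0 ≤ ρ)
    (h1 : ρ < 1) : Summable fun k => a k ^ 2 * ρ ^ k := by
  have hσ : ∀ x : ℝ, x < 1 → √x < 1 := fun x hx => by rw [Real.sqrt_lt' one_pos]; simpa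
  set σ := √√ρ
  have hσ2 : σ ^ 2 = √ρ := Real.sq_sqrt (Real.sqrt_nonneg ρ)
  have hρ : (σ ^ 2) ^ 2 = ρ := by rw [hσ2, Real.sq_sqrt h0]
  have hs := ha σ (Real.sqrt_nonneg _) (hσ _ (hσ ρ h1))
  obtain ⟨B, hB⟩ := hs.tendsto_atTop_zero.norm.bddAbove_range
  refine Summable.of_nonneg_of_le (fun k => by positivity) (fun k => ?_)
    ((summable_geometric_of_lt_one (r := σ ^ 2) (by positivity)
      (hσ2 ▸ hσ ρ h1)).mul_left (B ^ 2))
  have hk : |a k * σ ^ k| ≤ B := hB ⟨k, rfl⟩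
  calc a k ^ 2 * ρ ^ k = (a k * σ ^ k) ^ 2 * (σ ^ 2) ^ k := by
        rw [← hρ]; ring
    _ ≤ B ^ 2 * (σ ^ 2) ^ k :=
        mul_le_mul_of_nonneg_right (sq_le_sq' (abs_le.1 hk).1 (abs_le.1 hk).2) (by positivity)

end Generating

/-! ### Bounds for spherical harmonics and the expansion of the kernel -/

section Expansion

variable {n : ℕ}

theorem HarmonicBasis.continuous_val (Y : HarmonicBasis n) (i : HIndex n) :
    Continuous (Y.val i) :=
  (MvPolynomial.continuous_eval _).comp (by fun_prop)

theorem HarmonicBasis.val_smul (Y : HarmonicBasis n) (i : HIndex n) (r : ℝ) (x : Space n) :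
    Y.val i (r • x) = r ^ i.1 * Y.val i x :=
  eval_smul_of_isHomogeneous (mem_solidHarmonics.1 (Y.basis i.1 i.2).2).1 r fun m => x m

theorem integrable_sphere (hn : 2 ≤ n) {E : Type*} [NormedAddCommGroup E] {f : Sphere n → E}
    (hf : Continuous f) : Integrable f (sphereMeasure n) := by
  have := isProbabilityMeasure_sphereMeasure hn
  exact hf.integrable_of_hasCompactSupport (HasCompactSupport.of_compactSpace _)

/-- The addition theorem on the diagonal is integrated over the sphere; each of the `d_k` basis
elements contributes `1`. -/
theorem zonalValue_one (hn : 2 ≤ n) (Y : HarmonicBasis n) (k : ℕ) :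
    zonalValue n 1 k = harmonicDim n k := by
  have := isProbabilityMeasure_sphereMeasure hn
  have h : ∀ θ : Sphere n, ∑ l, Y.val ⟨k, l⟩ (θ : Space n) * Y.val ⟨k, l⟩ (θ : Space n) =
      zonalValue n 1 k := fun θ => by
    rw [sum_val_mul_val_sphere hn, real_inner_self_eq_norm_sq, norm_eq_of_mem_sphere, one_pow]
  have h2 : ∫ θ : Sphere n, ∑ l, Y.val ⟨k, l⟩ (θ : Space n) * Y.val ⟨k, l⟩ (θ : Space n)
      ∂(sphereMeasure n) = zonalValue n 1 k := by simp [h]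
  rw [← h2, integral_finsetSum]
  · have h3 : ∀ l, ∫ θ : Sphere n, Y.val ⟨k, l⟩ (θ : Space n) * Y.val ⟨k, l⟩ (θ : Space n)
        ∂(sphereMeasure n) = 1 := fun l => (Y.orthonormal ⟨k, l⟩ ⟨k, l⟩).trans (if_pos rfl)
    simp [h3]
  · intro l _
    have := Y.continuous_val ⟨k, l⟩
    exact integrable_sphere hn (by fun_prop)

theorem one_le_harmonicDim (i : HIndex n) : (1 : ℝ) ≤ harmonicDim n i.1 := by
  exact_mod_cast Nat.one_le_iff_ne_zero.2 (Fin.pos i.2).ne'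

/-- The squares of one degree sum to `d_k` at every point. The resulting bound `√d_k` is relaxed to
`d_k`, since only subexponential growth matters. -/
theorem abs_val_sphere_le (hn : 2 ≤ n) (Y : HarmonicBasis n) (i : HIndex n) (θ : Sphere n) :
    |Y.val i θ| ≤ harmonicDim n i.1 := by
  refine abs_le_of_sq_le_sq ?_ (Nat.cast_nonneg _)
  have h1 := one_le_harmonicDim i
  have h := sum_val_mul_val_sphere hn Y i.1 θ θ
  rw [real_inner_self_eq_norm_sq, norm_eq_of_mem_sphere, one_pow, zonalValue_one hn Y] at h
  have h2 : Y.val i θ * Y.val i θ ≤ harmonicDim n i.1 := by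
    rw [← h]
    exact Finset.single_le_sum (f := fun l => Y.val ⟨i.1, l⟩ (θ : Space n) *
      Y.val ⟨i.1, l⟩ (θ : Space n)) (fun l _ => mul_self_nonneg _) (Finset.mem_univ i.2)
  nlinarith

/-- The value `Y_{k,ℓ}(x / |x|)`. -/
def HarmonicBasis.angular (Y : HarmonicBasis n) (i : HIndex n) (x : Space n) : ℝ :=
  Y.val i (‖x‖⁻¹ • x)

theorem HarmonicBasis.measurable_angular (Y : HarmonicBasis n) (i : HIndex n) :
    Measurable (Y.angular i) :=
  (Y.continuous_val i).measurable.comp (by fun_prop)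

theorem HarmonicBasis.pow_mul_angular (Y : HarmonicBasis n) (i : HIndex n) (x : Space n) :
    ‖x‖ ^ i.1 * Y.angular i x = Y.val i x := by
  rw [HarmonicBasis.angular, ← Y.val_smul]
  rcases eq_or_ne x 0 with rfl | hx
  · simp
  · rw [smul_inv_smul₀ (norm_ne_zero_iff.2 hx)]

theorem HarmonicBasis.angular_sphere (Y : HarmonicBasis n) (i : HIndex n) (θ : Sphere n) {r : ℝ}
    (hr : 0 < r) : Y.angular i (r • (θ : Space n)) = Y.val i θ := by
  rw [HarmonicBasis.angular, norm_smul, norm_eq_of_mem_sphere, mul_one, Real.norm_of_nonneg hr.le,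
    inv_smul_smul₀ hr.ne']

theorem exists_sphere (hn : 2 ≤ n) : Nonempty (Sphere n) := by
  have := nontrivial_space hn
  exact (NormedSpace.sphere_nonempty.2 zero_le_one).to_subtype

theorem abs_angular_le (hn : 2 ≤ n) (Y : HarmonicBasis n) (i : HIndex n) (x : Space n) :
    |Y.angular i x| ≤ harmonicDim n i.1 := by
  rcases eq_or_ne x 0 with rfl | hx
  · obtain ⟨θ⟩ := exists_sphere hn
    have h : Y.val i 0 = 0 ^ i.1 * Y.val i θ := by simpa using Y.val_smul i 0 θ
    refine le_trans ?_ (abs_val_sphere_le hn Y i θ)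
    rw [HarmonicBasis.angular, smul_zero, h, abs_mul]
    refine mul_le_of_le_one_left (abs_nonneg _) ?_
    rcases i.1 with _ | k <;> simp
  · exact abs_val_sphere_le hn Y i ⟨‖x‖⁻¹ • x, by simp [norm_smul, hx]⟩

theorem summable_harmonicDim (hn : 2 ≤ n) (Y : HarmonicBasis n) {ρ : ℝ} (h0 : 0 ≤ ρ)
    (h1 : ρ < 1) : Summable fun i : HIndex n => (harmonicDim n i.1 : ℝ) ^ 2 * ρ ^ i.1 := by
  refine (summable_sigma_of_nonneg fun i => by positivity).2 ⟨fun k => ?_, ?_⟩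
  · exact (hasSum_fintype _).summable
  · have h4 := summable_sq_mul_pow (a := fun k => (zonalValue n 1 k ^ 2))
      (fun ρ h0 h1 => summable_sq_mul_pow (fun ρ => summable_zonalValue_one n) h0 h1) h0 h1
    refine Summable.of_nonneg_of_le (fun k => tsum_nonneg fun l => by positivity) (fun k => ?_) h4
    rw [tsum_fintype, zonalValue_one hn Y]
    simp only [Finset.sum_const, Finset.card_univ, Fintype.card_fin, nsmul_eq_mul, ← mul_assoc]
    gcongr
    -- The sum over `ℓ` contributes a third factor `d_k`; it is raised to a fourth power so that the
    -- squaring lemma, used twice, applies.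
    have : harmonicDim n k * harmonicDim n k ^ 2 ≤ (harmonicDim n k ^ 2) ^ 2 := by
      rcases Nat.eq_zero_or_pos (harmonicDim n k) with h | h
      · simp [h]
      · rw [← pow_succ', ← pow_mul]
        exact Nat.pow_le_pow_right h (by norm_num)
    exact_mod_cast this

theorem kernel_eq (hn : 2 ≤ n) (θ : Sphere n) (x : Space n) {ζ : ℂ} (hζ : ζ ≠ 0) :
    kernel ζ θ x = ζ⁻¹ * gegenbauerGen n (inner ℝ (θ : Space n) (‖x‖⁻¹ • x)) (‖x‖ / ζ) := by
  have h : ((inner ℝ (θ : Space n) (‖x‖⁻¹ • x) : ℝ) : ℂ) * ‖x‖ =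
      (inner ℝ (θ : Space n) x : ℝ) := by
    rw [real_inner_smul_right]
    rcases eq_or_ne x 0 with rfl | hx
    · simp
    · have : (‖x‖ : ℂ) ≠ 0 := by simpa using hx
      push_cast
      field_simp
  have hu : 1 - 2 * ((inner ℝ (θ : Space n) (‖x‖⁻¹ • x) : ℝ) : ℂ) * (‖x‖ / ζ) + (‖x‖ / ζ) ^ 2 =
      1 - 2 * (inner ℝ (θ : Space n) x : ℝ) / ζ + (‖x‖ : ℂ) ^ 2 / ζ ^ 2 := by
    rw [← h]; ring
  rw [gegenbauerGen, hu, kernel, distRoot, mul_pow, neg_div, Complex.cpow_neg,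
    show (n : ℂ) / 2 = n * (1 / 2) by ring, Complex.cpow_nat_mul]
  obtain ⟨m, rfl⟩ : ∃ m, n = m + 1 := ⟨n - 1, by omega⟩
  rw [Nat.add_sub_cancel, pow_succ ζ]
  field_simp

/-- The factor `|x|ᵏ` makes this valid at `x = 0`, where `x/|x|` is read as `0`: it kills all
degrees `k ≥ 1`, and degree `0` is constant. -/
theorem sum_val_mul_angular (hn : 2 ≤ n) (Y : HarmonicBasis n) (k : ℕ) (θ : Sphere n)
    (x : Space n) : ‖x‖ ^ k * ∑ l, Y.val ⟨k, l⟩ θ * Y.angular ⟨k, l⟩ x =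
      ‖x‖ ^ k * zonalValue n (inner ℝ (θ : Space n) (‖x‖⁻¹ • x)) k := by
  rcases eq_or_ne x 0 with rfl | hx
  · rcases k with _ | k
    · simp [HarmonicBasis.angular, sum_val_mul_val hn, zonal_zero, zonalConst, zonalValue]
    · simp
  · congr 1
    exact sum_val_mul_val_sphere hn Y k θ ⟨‖x‖⁻¹ • x, by simp [norm_smul, hx]⟩

theorem norm_zpow_one_sub {ζ : ℂ} (hζ : ζ ≠ 0) (k : ℕ) :
    ‖ζ ^ (1 - (k : ℤ))‖ = ‖ζ‖ / ‖ζ‖ ^ k := by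
  rw [zpow_sub₀ hζ, zpow_one, zpow_natCast, norm_div, norm_pow]

theorem norm_kernel_term_le (hn : 2 ≤ n) (Y : HarmonicBasis n) (θ : Sphere n) (x : Space n)
    {ζ : ℂ} {R : ℝ} (hx : ‖x‖ ≤ R) (hR : R < ‖ζ‖) (i : HIndex n) :
    ‖ζ ^ (1 - (i.1 : ℤ)) * (Y.val i θ : ℂ) *
      (Y.angular i x * ((‖x‖ : ℂ) ^ i.1 / (ζ ^ 2 - (‖x‖ : ℂ) ^ 2)))‖ ≤
      (‖ζ‖ / (‖ζ‖ ^ 2 - R ^ 2)) * ((harmonicDim n i.1 : ℝ) ^ 2 * (R / ‖ζ‖) ^ i.1) := by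
  have h0 : 0 ≤ R := (norm_nonneg x).trans hx
  have hζ : ζ ≠ 0 := norm_pos_iff.1 (h0.trans_lt hR)
  have hpos : 0 < ‖ζ‖ ^ 2 - R ^ 2 := by nlinarith
  have hden : ‖ζ‖ ^ 2 - R ^ 2 ≤ ‖ζ ^ 2 - (‖x‖ : ℂ) ^ 2‖ := by
    have := norm_sub_norm_le (ζ ^ 2) ((‖x‖ : ℂ) ^ 2)
    rw [norm_pow, norm_pow, Complex.norm_real, norm_norm] at this
    nlinarith [norm_nonneg x]
  rw [norm_mul, norm_mul, norm_mul, norm_zpow_one_sub hζ, norm_div, norm_pow, Complex.norm_real,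
    Complex.norm_real, Complex.norm_real, norm_norm]
  calc _ ≤ ‖ζ‖ / ‖ζ‖ ^ i.1 * harmonicDim n i.1 * (harmonicDim n i.1 *
        (R ^ i.1 / (‖ζ‖ ^ 2 - R ^ 2))) := by
        gcongr
        · exact abs_val_sphere_le hn Y i θ
        · exact abs_angular_le hn Y i x
    _ = _ := by
        rw [div_pow]
        ring

/-- The expansion of the Hua–Aronszajn kernel in spherical harmonics. -/
theorem hasSum_kernel (hn : 2 ≤ n) (Y : HarmonicBasis n) (θ : Sphere n) (x : Space n) {ζ : ℂ}
    (hx : ‖x‖ < ‖ζ‖) :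
    HasSum (fun i : HIndex n => ζ ^ (1 - (i.1 : ℤ)) * (Y.val i θ : ℂ) *
      (Y.angular i x * ((‖x‖ : ℂ) ^ i.1 / (ζ ^ 2 - (‖x‖ : ℂ) ^ 2)))) (kernel ζ θ x) := by
  have hζ : ζ ≠ 0 := norm_pos_iff.1 ((norm_nonneg x).trans_lt hx)
  set t := inner ℝ (θ : Space n) (‖x‖⁻¹ • x)
  have ht : |t| ≤ 1 := by
    refine (abs_real_inner_le_norm _ _).trans ?_
    rw [norm_eq_of_mem_sphere, one_mul, norm_smul, norm_inv, norm_norm]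
    exact inv_mul_le_one
  have hw : ‖(‖x‖ / ζ : ℂ)‖ < 1 := by
    rw [norm_div, Complex.norm_real, norm_norm, div_lt_one (norm_pos_iff.2 hζ)]
    exact hx
  have hd : ζ ^ 2 - (‖x‖ : ℂ) ^ 2 ≠ 0 := fun h => by
    have := congrArg norm (sub_eq_zero.1 h)
    rw [norm_pow, norm_pow, Complex.norm_real, norm_norm] at this
    exact hx.ne' ((pow_left_inj₀ (norm_nonneg _) (norm_nonneg _) two_ne_zero).1 this)
  have h := (hasSum_zonalValue n ht hw).mul_left (ζ / (ζ ^ 2 - (‖x‖ : ℂ) ^ 2))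
  -- The denominator of the Stieltjes transform absorbs the factor `1 - w²` that separates the
  -- Poisson kernel from the Gegenbauer generating function.
  have e : ζ / (ζ ^ 2 - (‖x‖ : ℂ) ^ 2) * ((1 - (‖x‖ / ζ : ℂ) ^ 2) *
      gegenbauerGen n t (‖x‖ / ζ)) = kernel ζ θ x := by
    have hk := kernel_eq hn θ x hζ
    change kernel ζ θ x = ζ⁻¹ * gegenbauerGen n t _ at hk
    rw [hk]
    field_simp
  rw [e] at h
  refine HasSum.sigma_of_hasSum h (fun k => ?_) ?_
  · convert! hasSum_fintype (_ : Fin (harmonicDim n k) → ℂ) using 1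
    have := congrArg (fun r : ℝ => (r : ℂ)) (sum_val_mul_angular hn Y k θ x)
    simp only [Finset.mul_sum] at this
    push_cast at this
    have hz : ζ ^ (1 - (k : ℤ)) = ζ / ζ ^ k := by rw [zpow_sub₀ hζ, zpow_one, zpow_natCast]
    change _ = (‖x‖ : ℂ) ^ k * (zonalValue n t k : ℂ) at this
    calc _ = ζ ^ (1 - (k : ℤ)) / (ζ ^ 2 - (‖x‖ : ℂ) ^ 2) * ((‖x‖ : ℂ) ^ k * zonalValue n t k) := by
          rw [hz, div_pow]; field_simp
      _ = _ := by
          rw [← this, Finset.mul_sum]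
          exact Finset.sum_congr rfl fun l _ => by ring
  · refine Summable.of_norm_bounded (g := fun i : HIndex n => (‖ζ‖ / (‖ζ‖ ^ 2 - ‖x‖ ^ 2)) *
      ((harmonicDim n i.1 : ℝ) ^ 2 * (‖x‖ / ‖ζ‖) ^ i.1)) ?_
      fun i => norm_kernel_term_le hn Y θ x le_rfl hx i
    refine (summable_harmonicDim hn Y (by positivity) ?_).mul_left _
    rwa [div_lt_one (norm_pos_iff.2 hζ)]

end Expansion

/-! ### Integration against a signed measure with a density -/

section Density

open scoped ENNReal

variable {α : Type*} [MeasurableSpace α] {m : Measure α} {E : Type*} [NormedAddCommGroup E]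
  [NormedSpace ℝ E]

/-- The variation has density `|g|`, and `|g| f` differs from `g f` only by a measurable sign. -/
theorem integrable_withDensityᵥ_iff {g : α → ℝ} (hg : Integrable g m) (hgm : Measurable g)
    {f : α → E} :
    (m.withDensityᵥ g).Integrable f ↔ Integrable (fun x => g x • f x) m := by
  rw [VectorMeasure.Integrable, Measure.variation_withDensityᵥ hg,
    integrable_withDensity_iff_integrable_smul₀' hgm.enorm.aemeasurable
      (Eventually.of_forall fun x => enorm_lt_top)]
  simp only [toReal_enorm, Real.norm_eq_abs]
  have hs : Measurable fun x => if 0 ≤ g x then (1 : ℝ) else -1 :=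
    Measurable.ite (measurableSet_le measurable_const hgm) measurable_const measurable_const
  constructor
  · intro h
    refine h.mono ((hs.aestronglyMeasurable.smul h.1).congr (Eventually.of_forall fun x => ?_))
      (Eventually.of_forall fun x => by simp [norm_smul])
    rcases le_or_gt 0 (g x) with hx | hx
    · simp [hx, abs_of_nonneg hx]
    · simp [hx.not_ge, abs_of_neg hx]
  · intro h
    refine h.mono ((hs.aestronglyMeasurable.smul h.1).congr (Eventually.of_forall fun x => ?_))
      (Eventually.of_forall fun x => by simp [norm_smul])
    rcases le_or_gt 0 (g x) with hx | hx
    · simp [hx, abs_of_nonneg hx]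
    · simp [hx.not_ge, abs_of_neg hx]

theorem integral_withDensityᵥ [CompleteSpace E] {g : α → ℝ} (hg : Integrable g m)
    (hgm : Measurable g) {f : α → E} (hf : Integrable (fun x => g x • f x) m) :
    ∫ᵛ x, f x ∂<•(m.withDensityᵥ g) = ∫ x, g x • f x ∂m := by
  have hle : ∀ h : α → ℝ, Measurable h → (∀ x, |h x| ≤ |g x|) →
      Integrable f (m.withDensity fun x => ENNReal.ofReal (h x)) := fun h hm hh => by
    have h1 := (integrable_withDensityᵥ_iff hg hgm).2 hf
    rw [VectorMeasure.Integrable, Measure.variation_withDensityᵥ hg] at h1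
    refine h1.mono_measure (withDensity_mono (Eventually.of_forall fun x => ?_))
    change _ ≤ ‖g x‖ₑ
    rw [Real.enorm_eq_ofReal_abs]
    exact ENNReal.ofReal_le_ofReal ((le_abs_self _).trans (hh x))
  have h1 := hle g hgm fun x => le_rfl
  have h2 := hle (fun x => -g x) hgm.neg fun x => (abs_neg _).le
  have := isFiniteMeasure_withDensity_ofReal hg.2
  have := isFiniteMeasure_withDensity_ofReal hg.neg.2
  have e : m.withDensityᵥ g = _ := withDensityᵥ_eq_withDensity_pos_part_sub_withDensity_neg_part hg
  rw [e, VectorMeasure.integral_sub_vectorMeasure, VectorMeasure.integral_toSignedMeasure]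
  · have e2 := VectorMeasure.integral_toSignedMeasure
      (μ := m.withDensity fun x => ENNReal.ofReal (-g x)) (f := f)
    refine (congrArg _ e2).trans ?_
    rw [integral_withDensity_eq_integral_toReal_smul hgm.ennreal_ofReal
      (Eventually.of_forall fun x => ENNReal.ofReal_lt_top),
      integral_withDensity_eq_integral_toReal_smul
        (f := fun x => ENNReal.ofReal (-g x)) hgm.neg.ennreal_ofReal
      (Eventually.of_forall fun x => ENNReal.ofReal_lt_top), ← integral_sub]
    · refine integral_congr_ae (Eventually.of_forall fun x => ?_)
      simp only [ENNReal.toReal_ofReal', ← sub_smul]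
      rcases le_total (g x) 0 with h | h <;> simp [h]
    · exact (integrable_withDensity_iff_integrable_smul' hgm.ennreal_ofReal
        (Eventually.of_forall fun x => ENNReal.ofReal_lt_top)).1 h1
    · exact (integrable_withDensity_iff_integrable_smul' hgm.neg.ennreal_ofReal
        (Eventually.of_forall fun x => ENNReal.ofReal_lt_top)).1 h2
  · rw [VectorMeasure.Integrable, Measure.variation_toSignedMeasure]
    exact h1
  · have e2 := Measure.variation_toSignedMeasure
      (μ := m.withDensity fun x => ENNReal.ofReal (-g x))
    exact (congrArg (fun M => Integrable f M) e2).mpr h2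

/-- The density with respect to the total variation serves here; it reduces vector-measure integrals
to ordinary ones in the change of variables to components. -/
theorem exists_eq_withDensityᵥ (μ : SignedMeasure α) : ∃ (m : Measure α) (g : α → ℝ),
    IsFiniteMeasure m ∧ Measurable g ∧ Integrable g m ∧ μ = m.withDensityᵥ g := by
  refine ⟨μ.totalVariation, μ.rnDeriv μ.totalVariation, inferInstance,
    SignedMeasure.measurable_rnDeriv _ _, SignedMeasure.integrable_rnDeriv _ _, ?_⟩
  refine (SignedMeasure.withDensityᵥ_rnDeriv_eq μ _ ?_).symm
  refine VectorMeasure.AbsolutelyContinuous.mk fun s hs h => ?_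
  rw [Measure.toENNRealVectorMeasure_apply_measurable hs] at h
  exact SignedMeasure.null_of_totalVariation_zero _ h

instance isFiniteMeasure_variation (μ : SignedMeasure α) : IsFiniteMeasure μ.variation := by
  rw [← SignedMeasure.totalVariation_eq_variation]
  infer_instance

theorem variation_toSignedMeasure_of_nonneg {μ : SignedMeasure α} (hμ : 0 ≤ μ) :
    μ = μ.variation.toSignedMeasure := by
  have h := SignedMeasure.toMeasureOfZeroLE_toSignedMeasure μ
    ((VectorMeasure.le_restrict_univ_iff_le _ _).2 hμ)
  conv_rhs => rw [Measure.toSignedMeasure_congr (by rw [← h, Measure.variation_toSignedMeasure])]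
  exact h.symm

end Density

/-! ### Component measures and their truncations -/

section Component

variable {n : ℕ}

theorem integrable_angular (hn : 2 ≤ n) (Y : HarmonicBasis n) (i : HIndex n)
    (m : Measure (Space n)) {E : Type*} [NormedAddCommGroup E] [NormedSpace ℝ E] {f : Space n → E}
    (hf : Integrable f m) : Integrable (fun x => Y.angular i x • f x) m :=
  hf.bdd_smul (harmonicDim n i.1) (Y.measurable_angular i).aestronglyMeasurable
    (Eventually.of_forall fun x => abs_angular_le hn Y i x)

theorem withDensity_angular (hn : 2 ≤ n) (Y : HarmonicBasis n) (i : HIndex n)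
    {m : Measure (Space n)} {g : Space n → ℝ} (hg : Integrable g m) (hgm : Measurable g) :
    (m.withDensityᵥ g).withDensity (Y.angular i) (ContinuousLinearMap.lsmul ℝ ℝ).flip =
      m.withDensityᵥ (fun x => Y.angular i x * g x) := by
  have hi := integrable_angular hn Y i m hg
  simp only [smul_eq_mul] at hi
  have hi' : Integrable (fun x => g x • Y.angular i x) m := by
    simpa only [smul_eq_mul, mul_comm] using hi
  ext s hs
  rw [VectorMeasure.withDensity_apply ((integrable_withDensityᵥ_iff hg hgm).2 hi'),
    ← VectorMeasure.integral_indicator hs, withDensityᵥ_apply hi hs, integral_withDensityᵥ hg hgm,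
    ← integral_indicator hs]
  · refine integral_congr_ae (Eventually.of_forall fun x => ?_)
    by_cases hx : x ∈ s <;> simp [hx, mul_comm]
  · refine (hi'.indicator hs).congr (Eventually.of_forall fun x => ?_)
    by_cases hx : x ∈ s <;> simp [hx]

theorem component_eq_map (hn : 2 ≤ n) (Y : HarmonicBasis n) (i : HIndex n)
    {m : Measure (Space n)} {g : Space n → ℝ} (hg : Integrable g m) (hgm : Measurable g) :
    component Y (m.withDensityᵥ g) i =
      (m.withDensityᵥ (fun x => Y.angular i x * g x)).map (fun x => ‖x‖) := by
  rw [← withDensity_angular hn Y i hg hgm]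
  rfl

/-- The variation of the component `μ_{k,ℓ}`, that is, the component itself as a measure, if it
is nonnegative. -/
def compMeasure (Y : HarmonicBasis n) (μ : SignedMeasure (Space n)) (i : HIndex n) : Measure ℝ :=
  (component Y μ i).variation

instance (Y : HarmonicBasis n) (μ : SignedMeasure (Space n)) (i : HIndex n) :
    IsFiniteMeasure (compMeasure Y μ i) :=
  isFiniteMeasure_variation _

theorem component_eq_toSignedMeasure {Y : HarmonicBasis n} {μ : SignedMeasure (Space n)}
    (hμ : IsPseudoPositive Y μ) (i : HIndex n) :
    component Y μ i = (compMeasure Y μ i).toSignedMeasure :=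
  variation_toSignedMeasure_of_nonneg (hμ i)

/-- Change of variables `r = |x|`. Only integrability against the weighted measure is required, so
it also covers moments for which `f(|x|)` alone need not be `μ`-integrable. -/
theorem integrable_compMeasure (hn : 2 ≤ n) (Y : HarmonicBasis n) {μ : SignedMeasure (Space n)}
    (i : HIndex n) {E : Type*} [NormedAddCommGroup E] [NormedSpace ℝ E] [CompleteSpace E]
    {f : ℝ → E} (hfm : StronglyMeasurable f)
    (hf : μ.Integrable fun x => Y.angular i x • f ‖x‖) :
    Integrable f (compMeasure Y μ i) ∧
      ∫ᵛ r, f r ∂<•(component Y μ i) = ∫ᵛ x, Y.angular i x • f ‖x‖ ∂<•μ := by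
  obtain ⟨m, g, _, hgm, hg, rfl⟩ := exists_eq_withDensityᵥ μ
  have hi := integrable_angular hn Y i m hg
  simp only [smul_eq_mul] at hi
  have him : Measurable fun x => Y.angular i x * g x := (Y.measurable_angular i).mul hgm
  have hf2 := (integrable_withDensityᵥ_iff hg hgm).1 hf
  have hf3 : Integrable (fun x => (Y.angular i x * g x) • (f ∘ fun x => ‖x‖) x) m := by
    refine hf2.congr (Eventually.of_forall fun x => ?_)
    simp only [smul_smul, Function.comp, mul_comm]
  have hf4 := (integrable_withDensityᵥ_iff hi him).2 hf3
  rw [compMeasure, component_eq_map hn Y i hg hgm]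
  refine ⟨VectorMeasure.Integrable.map hfm.aestronglyMeasurable hf4, ?_⟩
  rw [VectorMeasure.integral_map measurable_norm hfm.aestronglyMeasurable hf4]
  refine (integral_withDensityᵥ hi him hf3).trans ?_
  rw [integral_withDensityᵥ hg hgm hf2]
  refine integral_congr_ae (Eventually.of_forall fun x => ?_)
  simp only [smul_smul, Function.comp, mul_comm]

theorem integral_compMeasure (hn : 2 ≤ n) {Y : HarmonicBasis n} {μ : SignedMeasure (Space n)}
    (hμ : IsPseudoPositive Y μ) (i : HIndex n) {E : Type*} [NormedAddCommGroup E]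
    [NormedSpace ℝ E] [CompleteSpace E] {f : ℝ → E} (hfm : StronglyMeasurable f)
    (hf : μ.Integrable fun x => Y.angular i x • f ‖x‖) :
    ∫ r, f r ∂(compMeasure Y μ i) = ∫ᵛ x, Y.angular i x • f ‖x‖ ∂<•μ := by
  rw [← (integrable_compMeasure hn Y i hfm hf).2, component_eq_toSignedMeasure hμ i,
    VectorMeasure.integral_toSignedMeasure]

theorem compMeasure_nonneg (Y : HarmonicBasis n) (μ : SignedMeasure (Space n)) (i : HIndex n) :
    ∀ᵐ r ∂(compMeasure Y μ i), 0 ≤ r := by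
  have h : (compMeasure Y μ i) (Set.Iio 0) ≤ 0 := by
    refine (VectorMeasure.variation_map_le (Set.Iio 0)).trans ?_
    rw [Measure.map_apply measurable_norm measurableSet_Iio]
    rw [show (fun x : Space n => ‖x‖) ⁻¹' Set.Iio 0 = ∅ by ext x; simp, measure_empty]
  rw [ae_iff]
  simpa [Set.Iio] using h

theorem component_truncation (hn : 2 ≤ n) (Y : HarmonicBasis n) (μ : SignedMeasure (Space n))
    (R : ℝ) (i : HIndex n) :
    component Y (truncation μ R) i = (component Y μ i).restrict (Set.Iic R) := by
  have hf : μ.Integrable (Y.angular i) :=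
    Integrable.of_bound (Y.measurable_angular i).aestronglyMeasurable (harmonicDim n i.1)
      (Eventually.of_forall fun x => abs_angular_le hn Y i x)
  have hB : Metric.closedBall (0 : Space n) R = (fun x => ‖x‖) ⁻¹' Set.Iic R := by
    ext x; simp
  have h := VectorMeasure.restrict_withDensity (s := Metric.closedBall 0 R)
    (B := (ContinuousLinearMap.lsmul ℝ ℝ (E := ℝ)).flip) hf
  change ((μ.restrict _).withDensity (Y.angular i) _).map _ =
    ((μ.withDensity (Y.angular i) _).map _).restrict _
  rw [← h]
  ext s hs
  rw [VectorMeasure.map_apply _ measurable_norm hs, VectorMeasure.restrict_apply _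
    measurableSet_Iic hs, VectorMeasure.map_apply _ measurable_norm (hs.inter measurableSet_Iic),
    VectorMeasure.restrict_apply _ measurableSet_closedBall (measurable_norm hs), hB]
  rfl

/-- Cutting `μ` to a ball cuts every component to `r ≤ R`, because the ball is the preimage of that
half-line under the norm. -/
theorem compMeasure_truncation (hn : 2 ≤ n) (Y : HarmonicBasis n) (μ : SignedMeasure (Space n))
    (R : ℝ) (i : HIndex n) :
    compMeasure Y (truncation μ R) i = (compMeasure Y μ i).restrict (Set.Iic R) := by
  rw [compMeasure, component_truncation hn, VectorMeasure.variation_restrict measurableSet_Iic]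
  rfl

theorem IsPseudoPositive.truncation (hn : 2 ≤ n) {Y : HarmonicBasis n}
    {μ : SignedMeasure (Space n)} (hμ : IsPseudoPositive Y μ) (R : ℝ) :
    IsPseudoPositive Y (truncation μ R) := fun i => by
  rw [component_truncation hn, component_eq_toSignedMeasure hμ i,
    Measure.toSignedMeasure_restrict_eq_restrict_toSignedMeasure _ _ measurableSet_Iic]
  exact Measure.zero_le_toSignedMeasure _

end Component

/-! ### Absolute convergence of the transform -/

section Convergence

variable {n : ℕ}

/-- The moments of lowest order of the components are bounded by `C d_k D^k`. -/
def MomentBound (Y : HarmonicBasis n) (μ : SignedMeasure (Space n)) (C D : ℝ) : Prop :=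
  ∀ i, Integrable (fun r : ℝ => r ^ i.1) (compMeasure Y μ i) ∧
    ∫ r, r ^ i.1 ∂(compMeasure Y μ i) ≤ C * harmonicDim n i.1 * D ^ i.1

theorem SolvesMomentProblem.moment (hn : 2 ≤ n) {Y : HarmonicBasis n}
    {μ : SignedMeasure (Space n)} (hμ : IsPseudoPositive Y μ) {s : HIndex n → ℕ → ℝ} {J : ℕ}
    (hs : SolvesMomentProblem Y μ s J) (i : HIndex n) {j : ℕ} (hj : j ≤ J) :
    Integrable (fun r : ℝ => r ^ (i.1 + 2 * j)) (compMeasure Y μ i) ∧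
      ∫ r, r ^ (i.1 + 2 * j) ∂(compMeasure Y μ i) = s i j := by
  obtain ⟨h1, h2⟩ := hs i j hj
  have e : (fun x : Space n => Y.angular i x • ‖x‖ ^ (i.1 + 2 * j)) =
      fun x => ‖x‖ ^ (2 * j) * Y.val i x := by
    ext x
    rw [← Y.pow_mul_angular, smul_eq_mul, pow_add]
    ring
  have hm : StronglyMeasurable fun r : ℝ => r ^ (i.1 + 2 * j) := (by fun_prop : Measurable _).stronglyMeasurable
  rw [← e] at h1 h2
  exact ⟨(integrable_compMeasure hn Y i hm h1).1, (integral_compMeasure hn hμ i hm h1).trans h2.symm⟩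

theorem SolvesMomentProblem.momentBound (hn : 2 ≤ n) {Y : HarmonicBasis n}
    {μ : SignedMeasure (Space n)} (hμ : IsPseudoPositive Y μ) {s : HIndex n → ℕ → ℝ} {J : ℕ}
    (hs : SolvesMomentProblem Y μ s J) {C D : ℝ} (hC : 0 < C) (hD : 0 < D)
    (hg : GrowthBound s C D) : MomentBound Y μ C D := fun i => by
  have h := hs.moment hn hμ i (Nat.zero_le J)
  simp only [mul_zero, add_zero] at h
  refine ⟨h.1, h.2.le.trans ((le_abs_self _).trans ((hg i).trans ?_))⟩
  rw [mul_right_comm]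
  exact le_mul_of_one_le_right (by positivity) (one_le_harmonicDim i)

theorem compMeasure_real_univ_le (hn : 2 ≤ n) {Y : HarmonicBasis n}
    {μ : SignedMeasure (Space n)} (hμ : IsPseudoPositive Y μ) (i : HIndex n) :
    (compMeasure Y μ i).real Set.univ ≤ harmonicDim n i.1 * μ.variation.real Set.univ := by
  have hf : μ.Integrable fun x => Y.angular i x • (1 : ℝ) :=
    integrable_angular hn Y i _ (integrable_const 1)
  have h := integral_compMeasure hn hμ i (f := fun _ => (1 : ℝ)) stronglyMeasurable_const hf
  rw [integral_const, smul_eq_mul, mul_one] at h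
  rw [h]
  refine (Real.le_norm_self _).trans ((VectorMeasure.norm_integral_le_of_norm_le_const
    (C := (harmonicDim n i.1 : ℝ)) ?_).trans ?_)
  · refine Eventually.of_forall fun x => ?_
    simpa using abs_angular_le hn Y i x
  · refine mul_le_mul_of_nonneg_right (mul_le_of_le_one_right (by positivity) ?_) (by positivity)
    rw [ContinuousLinearMap.opNorm_flip]
    exact ContinuousLinearMap.opNorm_lsmul_le

/-- On `r ≤ R` the moment is at most `Rᵏ` times the mass of the component, and that mass is at most
`d_k |μ|`. This is where the factor `d_k` in `MomentBound` is needed; with it, truncations and the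
full measure share all later estimates. -/
theorem momentBound_truncation (hn : 2 ≤ n) {Y : HarmonicBasis n}
    {μ : SignedMeasure (Space n)} (hμ : IsPseudoPositive Y μ) {R : ℝ} (hR : 0 ≤ R) :
    MomentBound Y (truncation μ R) (μ.variation.real Set.univ) R := fun i => by
  rw [compMeasure_truncation hn]
  have h : ∀ᵐ r ∂(compMeasure Y μ i).restrict (Set.Iic R), ‖r ^ i.1‖ ≤ R ^ i.1 := by
    filter_upwards [ae_restrict_of_ae (compMeasure_nonneg Y μ i),
      ae_restrict_mem measurableSet_Iic] with r h0 hr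
    rw [norm_pow, Real.norm_of_nonneg h0]
    exact pow_le_pow_left₀ h0 hr _
  refine ⟨Integrable.of_bound (by fun_prop) _ h, ?_⟩
  refine (Real.le_norm_self _).trans ((norm_integral_le_of_norm_le_const h).trans ?_)
  have h2 : ((compMeasure Y μ i).restrict (Set.Iic R)).real Set.univ ≤
      (compMeasure Y μ i).real Set.univ := by
    rw [measureReal_restrict_apply_univ]
    exact measureReal_mono (Set.subset_univ _)
  rw [mul_comm, mul_comm (μ.variation.real _)]
  exact mul_le_mul_of_nonneg_right (h2.trans (compMeasure_real_univ_le hn hμ i)) (by positivity)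

theorem componentTransform_eq {Y : HarmonicBasis n} {μ : SignedMeasure (Space n)}
    (hμ : IsPseudoPositive Y μ) (i : HIndex n) (z : ℂ) :
    componentTransform Y μ i z = ∫ r, (r : ℂ) ^ i.1 / (z - (r : ℂ) ^ 2) ∂(compMeasure Y μ i) := by
  rw [componentTransform, component_eq_toSignedMeasure hμ i, VectorMeasure.integral_toSignedMeasure]

theorem norm_cauchy_le {ν : Measure ℝ} {z : ℂ} {ε : ℝ} (hε : 0 < ε) (k : ℕ)
    (h : ∀ᵐ r : ℝ ∂ν, 0 ≤ r ∧ ε ≤ ‖z - (r : ℂ) ^ 2‖) :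
    ∀ᵐ r : ℝ ∂ν, ‖(r : ℂ) ^ k / (z - (r : ℂ) ^ 2)‖ ≤ r ^ k / ε := by
  filter_upwards [h] with r hr
  rw [norm_div, norm_pow, Complex.norm_real, Real.norm_of_nonneg hr.1]
  have := pow_nonneg hr.1 k
  gcongr
  exact hr.2

theorem integrable_cauchy {ν : Measure ℝ} {z : ℂ} {ε : ℝ} (hε : 0 < ε) {k : ℕ}
    (h : ∀ᵐ r : ℝ ∂ν, 0 ≤ r ∧ ε ≤ ‖z - (r : ℂ) ^ 2‖) (hk : Integrable (fun r : ℝ => r ^ k) ν) :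
    Integrable (fun r : ℝ => (r : ℂ) ^ k / (z - (r : ℂ) ^ 2)) ν := by
  refine (hk.div_const ε).mono' ?_ (norm_cauchy_le hε k h)
  exact Measurable.aestronglyMeasurable (by fun_prop)

theorem integral_norm_cauchy_le {Y : HarmonicBasis n} {μ : SignedMeasure (Space n)} {C D : ℝ}
    (hM : MomentBound Y μ C D) (i : HIndex n) {z : ℂ} {ε : ℝ} (hε : 0 < ε)
    (h : ∀ᵐ r : ℝ ∂(compMeasure Y μ i), ε ≤ ‖z - (r : ℂ) ^ 2‖) :
    ∫ r, ‖(r : ℂ) ^ i.1 / (z - (r : ℂ) ^ 2)‖ ∂(compMeasure Y μ i) ≤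
      C * harmonicDim n i.1 * D ^ i.1 / ε := by
  have h' := (compMeasure_nonneg Y μ i).and h
  refine (integral_mono_ae (integrable_cauchy hε h' (hM i).1).norm ((hM i).1.div_const ε)
    (norm_cauchy_le hε i.1 h')).trans ?_
  rw [integral_div]
  gcongr
  exact (hM i).2

/-- The central majorant. One factor `d_k` comes from `Y_{k,ℓ}(θ)`, the other from the moment bound;
`ε` is a lower bound for the distance from `ζ²` to the squares of almost all radii. -/
theorem norm_term_le (hn : 2 ≤ n) {Y : HarmonicBasis n} {μ : SignedMeasure (Space n)} {C D : ℝ}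
    (hM : MomentBound Y μ C D) (i : HIndex n) {ζ : ℂ} (hζ : ζ ≠ 0) {ε : ℝ} (hε : 0 < ε)
    (h : ∀ᵐ r : ℝ ∂(compMeasure Y μ i), ε ≤ ‖ζ ^ 2 - (r : ℂ) ^ 2‖) (θ : Sphere n) :
    ‖ζ ^ (1 - (i.1 : ℤ))‖ * |Y.val i θ| *
        ∫ r, ‖(r : ℂ) ^ i.1 / (ζ ^ 2 - (r : ℂ) ^ 2)‖ ∂(compMeasure Y μ i) ≤
      ‖ζ‖ * C / ε * ((harmonicDim n i.1 : ℝ) ^ 2 * (D / ‖ζ‖) ^ i.1) := by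
  rw [norm_zpow_one_sub hζ]
  have h0 : (0 : ℝ) ≤ ∫ r, ‖(r : ℂ) ^ i.1 / (ζ ^ 2 - (r : ℂ) ^ 2)‖ ∂(compMeasure Y μ i) :=
    integral_nonneg fun r => norm_nonneg _
  calc _ ≤ ‖ζ‖ / ‖ζ‖ ^ i.1 * harmonicDim n i.1 * (C * harmonicDim n i.1 * D ^ i.1 / ε) := by
        gcongr
        · exact abs_val_sphere_le hn Y i θ
        · exact integral_norm_cauchy_le hM i hε h
    _ = _ := by
        rw [div_pow]
        ring

theorem summable_bound (hn : 2 ≤ n) (Y : HarmonicBasis n) {D : ℝ} (hD : 0 < D) {a : ℝ}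
    (ha : D < a) (b : ℝ) :
    Summable fun i : HIndex n => b * ((harmonicDim n i.1 : ℝ) ^ 2 * (D / a) ^ i.1) :=
  (summable_harmonicDim hn Y (div_nonneg hD.le (hD.trans ha).le)
    ((div_lt_one (hD.trans ha)).2 ha)).mul_left _

theorem transformConverges (hn : 2 ≤ n) {Y : HarmonicBasis n} {μ : SignedMeasure (Space n)}
    {C D : ℝ} (hM : MomentBound Y μ C D) (hD : 0 < D) {ζ : ℂ} (hζ : D < ‖ζ‖) {ε : ℝ} (hε : 0 < ε)
    (h : ∀ i, ∀ᵐ r : ℝ ∂(compMeasure Y μ i), ε ≤ ‖ζ ^ 2 - (r : ℂ) ^ 2‖) (θ : Sphere n) :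
    TransformConverges Y μ ζ θ := by
  have hζ0 : ζ ≠ 0 := norm_pos_iff.1 (hD.trans hζ)
  refine ⟨fun i => integrable_cauchy hε ((compMeasure_nonneg Y μ i).and (h i)) (hM i).1, ?_⟩
  refine Summable.of_nonneg_of_le (fun i => ?_)
    (fun i => norm_term_le hn hM i hζ0 hε (h i) θ) (summable_bound hn Y hD hζ _)
  have h0 : (0 : ℝ) ≤ ∫ r, ‖(r : ℂ) ^ i.1 / (ζ ^ 2 - (r : ℂ) ^ 2)‖ ∂(compMeasure Y μ i) :=
    integral_nonneg fun r => norm_nonneg _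
  positivity

theorem norm_transform_term_le (hn : 2 ≤ n) {Y : HarmonicBasis n} {μ : SignedMeasure (Space n)}
    (hμ : IsPseudoPositive Y μ) {C D : ℝ} (hM : MomentBound Y μ C D) (i : HIndex n) {ζ : ℂ}
    (hζ : ζ ≠ 0) {ε : ℝ} (hε : 0 < ε)
    (h : ∀ᵐ r : ℝ ∂(compMeasure Y μ i), ε ≤ ‖ζ ^ 2 - (r : ℂ) ^ 2‖) (θ : Sphere n) :
    ‖ζ ^ (1 - (i.1 : ℤ)) * (Y.val i θ : ℂ) * componentTransform Y μ i (ζ ^ 2)‖ ≤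
      ‖ζ‖ * C / ε * ((harmonicDim n i.1 : ℝ) ^ 2 * (D / ‖ζ‖) ^ i.1) := by
  refine le_trans ?_ (norm_term_le hn hM i hζ hε h θ)
  rw [norm_mul, norm_mul, Complex.norm_real, Real.norm_eq_abs, componentTransform_eq hμ]
  gcongr
  exact norm_integral_le_integral_norm _

/-- Dominated convergence for the series: by positivity the majorant of the full measure also
dominates its truncations, and each single integral over `r ≤ R` converges to the full one. -/
theorem tendsto_transform_truncation (hn : 2 ≤ n) {Y : HarmonicBasis n}
    {μ : SignedMeasure (Space n)} (hμ : IsPseudoPositive Y μ) {C D : ℝ}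
    (hM : MomentBound Y μ C D) (hD : 0 < D) {ζ : ℂ} (hζ : D < ‖ζ‖) {ε : ℝ} (hε : 0 < ε)
    (h : ∀ i, ∀ᵐ r : ℝ ∂(compMeasure Y μ i), ε ≤ ‖ζ ^ 2 - (r : ℂ) ^ 2‖) (θ : Sphere n) :
    Tendsto (fun R : ℝ => transform Y (truncation μ R) ζ θ) atTop (𝓝 (transform Y μ ζ θ)) := by
  have hζ0 : ζ ≠ 0 := norm_pos_iff.1 (hD.trans hζ)
  refine tendsto_tsum_of_dominated_convergence (summable_bound hn Y hD hζ _) (fun i => ?_)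
    (Eventually.of_forall fun R i => ?_) (bound := fun i : HIndex n =>
      ‖ζ‖ * C / ε * ((harmonicDim n i.1 : ℝ) ^ 2 * (D / ‖ζ‖) ^ i.1))
  · refine Tendsto.const_mul _ ?_
    rw [componentTransform_eq hμ]
    simp only [componentTransform_eq (hμ.truncation hn _), compMeasure_truncation hn]
    exact (aecover_Iic tendsto_id).integral_tendsto_of_countably_generated
      (integrable_cauchy hε ((compMeasure_nonneg Y μ i).and (h i)) (hM i).1)
  · refine le_trans ?_ (norm_term_le hn hM i hζ0 hε (h i) θ)
    rw [norm_mul, norm_mul, Complex.norm_real, Real.norm_eq_abs,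
      componentTransform_eq (hμ.truncation hn _), compMeasure_truncation hn]
    gcongr
    refine (norm_integral_le_integral_norm _).trans (setIntegral_le_integral
      (integrable_cauchy hε ((compMeasure_nonneg Y μ i).and (h i)) (hM i).1).norm
      (Eventually.of_forall fun r => norm_nonneg _))

theorem hasSum_transform (hn : 2 ≤ n) {Y : HarmonicBasis n} {μ : SignedMeasure (Space n)}
    (hμ : IsPseudoPositive Y μ) {C D : ℝ} (hM : MomentBound Y μ C D) (hD : 0 < D) {ζ : ℂ}
    (hζ : D < ‖ζ‖) {ε : ℝ} (hε : 0 < ε)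
    (h : ∀ i, ∀ᵐ r : ℝ ∂(compMeasure Y μ i), ε ≤ ‖ζ ^ 2 - (r : ℂ) ^ 2‖) (θ : Sphere n) :
    HasSum (fun i : HIndex n =>
      ζ ^ (1 - (i.1 : ℤ)) * (Y.val i θ : ℂ) * componentTransform Y μ i (ζ ^ 2))
      (transform Y μ ζ θ) :=
  (Summable.of_norm_bounded (summable_bound hn Y hD hζ _)
    fun i => norm_transform_term_le hn hμ hM i (norm_pos_iff.1 (hD.trans hζ)) hε (h i) θ).hasSum

end Convergence

/-! ### The Klein–Dirac quadric -/

section Quadric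

variable {n : ℕ}

theorem KDQ.continuous_mk : Continuous fun p : ℂ × Sphere n => KDQ.mk p.1 p.2 :=
  continuous_quotient_mk'

theorem KDQ.mk_eq_mk {ζ ξ : ℂ} {θ η : Sphere n} (h : KDQ.mk ζ θ = KDQ.mk ξ η) :
    (ξ = ζ ∧ η = θ) ∨ (ξ = -ζ ∧ η = -θ) := by
  rcases Quotient.exact h with h | h
  · exact Or.inl (Prod.ext_iff.1 h)
  · exact Or.inr (Prod.ext_iff.1 h)

/-- A function of `(ζ, θ)` invariant under the antipodal map, as a function of `ζθ`. -/
def KDQ.lift {α : Type*} (f : ℂ → Sphere n → α) (hf : ∀ ζ θ, f (-ζ) (-θ) = f ζ θ) : KDQ n → α :=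
  Quotient.lift (fun p : ℂ × Sphere n => f p.1 p.2) (by
    rintro p q (rfl | rfl)
    · rfl
    · exact (hf p.1 p.2).symm)

theorem KDQ.lift_mk {α : Type*} {f : ℂ → Sphere n → α} (hf : ∀ ζ θ, f (-ζ) (-θ) = f ζ θ)
    (ζ : ℂ) (θ : Sphere n) : KDQ.lift f hf (KDQ.mk ζ θ) = f ζ θ := rfl

theorem KDQ.exists_mk (q : KDQ n) : ∃ (ζ : ℂ) (θ : Sphere n), q = KDQ.mk ζ θ := by
  induction q using Quotient.inductionOn with
  | h p => exact ⟨p.1, p.2, rfl⟩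

/-- An even continuous function of `ζ` descends to the quotient, so compactness improves a strict
pointwise bound to a uniform one. -/
theorem KDQ.exists_lower_bound {f : ℂ → ℝ} (hf : Continuous f) (hf' : ∀ ζ, f (-ζ) = f ζ)
    {K : Set (KDQ n)} (hK : IsCompact K) {a : ℝ} (ha : ∀ ζ θ, KDQ.mk ζ θ ∈ K → a < f ζ) :
    ∃ b, a < b ∧ ∀ (ζ : ℂ) (θ : Sphere n), KDQ.mk ζ θ ∈ K → b ≤ f ζ := by
  have hc : Continuous (KDQ.lift (n := n) (fun ζ _ => f ζ) fun ζ _ => hf' ζ) :=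
    Continuous.quotient_lift (by fun_prop) _
  obtain ⟨b, h1, h2⟩ := hK.exists_forall_le' hc.continuousOn (a := a) (by
    intro q hq
    obtain ⟨ζ, θ, rfl⟩ := q.exists_mk
    exact ha ζ θ hq)
  exact ⟨b, h1, fun ζ θ h => h2 _ h⟩

/-- A point with `|ζ| ≤ R` is the limit of the points `cζθ`, `c ↑ 1`, which lie in the open ball, so
it belongs to the closure. -/
theorem KDQ.lt_norm_of_mem_exterior {R : ℝ} (hR : 0 < R) {ζ : ℂ} {θ : Sphere n}
    (h : KDQ.mk ζ θ ∈ KDQ.exterior n R) : R < ‖ζ‖ := by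
  by_contra! hle
  have hc : Continuous fun c : ℝ => KDQ.mk ((c : ℂ) * ζ) θ :=
    KDQ.continuous_mk.comp (f := fun c : ℝ => ((c : ℂ) * ζ, θ)) (by fun_prop)
  have ht : Tendsto (fun c : ℝ => KDQ.mk ((c : ℂ) * ζ) θ) (𝓝[<] 1) (𝓝 (KDQ.mk ζ θ)) := by
    have := (hc.tendsto 1).mono_left (nhdsWithin_le_nhds (s := Set.Iio 1))
    simpa using this
  refine h (mem_closure_of_tendsto ht ?_)
  filter_upwards [Ioo_mem_nhdsLT (zero_lt_one' ℝ)] with c hc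
  refine ⟨_, θ, ?_, rfl⟩
  rw [norm_mul, Complex.norm_real, Real.norm_of_nonneg hc.1.le]
  calc c * ‖ζ‖ ≤ c * R := mul_le_mul_of_nonneg_left hle hc.1.le
    _ < R := by nlinarith [hc.2]

theorem KDQ.sq_ne_of_mem_slit {ζ : ℂ} {θ : Sphere n} (h : KDQ.mk ζ θ ∈ KDQ.slit n) (t : ℝ)
    (ht : 0 ≤ t) : ζ ^ 2 ≠ (t : ℂ) := by
  obtain ⟨ξ, η, h1, h2⟩ := h
  rcases KDQ.mk_eq_mk h2 with ⟨rfl, -⟩ | ⟨rfl, -⟩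
  · exact h1 t ht
  · simpa using h1 t ht

/-- The parities `(-1)ᵏ` of `Y_{k,ℓ}` and of `ζ⁻ᵏ` cancel and the remaining factor `ζ` is odd; hence
`ζ⁻¹` times the transform descends to the quadric. -/
theorem transform_neg (Y : HarmonicBasis n) (μ : SignedMeasure (Space n)) (ζ : ℂ) (θ : Sphere n) :
    transform Y μ (-ζ) (-θ) = -transform Y μ ζ θ := by
  rw [transform, transform, ← tsum_neg]
  refine tsum_congr fun i => ?_
  have h1 : Y.val i ((-θ : Sphere n) : Space n) = (-1) ^ i.1 * Y.val i θ := by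
    rw [← Y.val_smul]
    simp
  have h2 : (-ζ) ^ (1 - (i.1 : ℤ)) = -(-1) ^ i.1 * ζ ^ (1 - (i.1 : ℤ)) := by
    rw [neg_eq_neg_one_mul ζ, mul_zpow, zpow_sub₀ (by norm_num), zpow_one, zpow_natCast]
    rcases neg_one_pow_eq_or ℂ i.1 with h | h <;> rw [h] <;> norm_num
  rw [h1, h2, neg_sq]
  push_cast
  rcases neg_one_pow_eq_or ℂ i.1 with h | h <;> rw [h] <;> ring

end Quadric

/-! ### The pseudo-positive Nevanlinna class -/

section Nevanlinna

variable {n : ℕ}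

theorem le_norm_sub_of_mem_ball {z w a : ℂ} {ε : ℝ} (hw : w ∈ Metric.ball z (ε / 2))
    (h : ε ≤ ‖z - a‖) : ε / 2 ≤ ‖w - a‖ := by
  have h1 : dist w z < ε / 2 := hw
  have h2 := dist_triangle_left z a w
  rw [← dist_eq_norm] at *
  linarith

theorem differentiableAt_integral_cauchy {ν : Measure ℝ} {k : ℕ}
    (hk : Integrable (fun r : ℝ => r ^ k) ν) {z : ℂ} {ε : ℝ} (hε : 0 < ε)
    (h : ∀ᵐ r : ℝ ∂ν, 0 ≤ r ∧ ε ≤ ‖z - (r : ℂ) ^ 2‖) :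
    DifferentiableAt ℂ (fun w => ∫ r : ℝ, (r : ℂ) ^ k / (w - (r : ℂ) ^ 2) ∂ν) z := by
  have hb : ∀ᵐ r : ℝ ∂ν, ∀ w ∈ Metric.ball z (ε / 2),
      ‖-((r : ℂ) ^ k / (w - (r : ℂ) ^ 2) ^ 2)‖ ≤ r ^ k / (ε / 2) ^ 2 := by
    filter_upwards [h] with r hr w hw
    rw [norm_neg, norm_div, norm_pow, norm_pow, Complex.norm_real, Real.norm_of_nonneg hr.1]
    have h1 := pow_nonneg hr.1 k
    have h2 := le_norm_sub_of_mem_ball hw hr.2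
    gcongr
  have hd : ∀ᵐ r : ℝ ∂ν, ∀ w ∈ Metric.ball z (ε / 2),
      HasDerivAt (fun w : ℂ => (r : ℂ) ^ k / (w - (r : ℂ) ^ 2))
        (-((r : ℂ) ^ k / (w - (r : ℂ) ^ 2) ^ 2)) w := by
    filter_upwards [h] with r hr w hw
    have hne : w - (r : ℂ) ^ 2 ≠ 0 :=
      norm_pos_iff.1 ((half_pos hε).trans_le (le_norm_sub_of_mem_ball hw hr.2))
    have := ((hasDerivAt_const w ((r : ℂ) ^ k)).div ((hasDerivAt_id w).sub_const ((r : ℂ) ^ 2)) hne)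
    refine this.congr_deriv ?_
    simp only [id]
    ring
  have hm : ∀ w : ℂ, AEStronglyMeasurable (fun r : ℝ => (r : ℂ) ^ k / (w - (r : ℂ) ^ 2)) ν :=
    fun w => Measurable.aestronglyMeasurable (by fun_prop)
  have hm' : AEStronglyMeasurable (fun r : ℝ => -((r : ℂ) ^ k / (z - (r : ℂ) ^ 2) ^ 2)) ν :=
    Measurable.aestronglyMeasurable (by fun_prop)
  exact (hasDerivAt_integral_of_dominated_loc_of_deriv_le (μ := ν)
    (F := fun (w : ℂ) (r : ℝ) => (r : ℂ) ^ k / (w - (r : ℂ) ^ 2))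
    (F' := fun (w : ℂ) (r : ℝ) => -((r : ℂ) ^ k / (w - (r : ℂ) ^ 2) ^ 2))
    (Metric.ball_mem_nhds z (half_pos hε)) (Eventually.of_forall hm)
    (integrable_cauchy hε h hk) hm' hb (hk.div_const _) hd).2.differentiableAt

theorem analyticAt_componentTransform {Y : HarmonicBasis n} {μ : SignedMeasure (Space n)}
    (hμ : IsPseudoPositive Y μ) {i : HIndex n}
    (hk : Integrable (fun r : ℝ => r ^ i.1) (compMeasure Y μ i)) {z : ℂ} {ε : ℝ} (hε : 0 < ε)
    (h : ∀ᵐ r : ℝ ∂(compMeasure Y μ i), ε ≤ ‖z - (r : ℂ) ^ 2‖) :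
    AnalyticAt ℂ (componentTransform Y μ i) z := by
  rw [show componentTransform Y μ i = _ from funext fun w => componentTransform_eq hμ i w]
  refine DifferentiableOn.analyticAt (s := Metric.ball z (ε / 2)) (fun w hw => ?_)
    (Metric.ball_mem_nhds z (half_pos hε))
  refine (differentiableAt_integral_cauchy hk (half_pos hε) ?_).differentiableWithinAt
  filter_upwards [compMeasure_nonneg Y μ i, h] with r h0 hr
  exact ⟨h0, le_norm_sub_of_mem_ball hw hr⟩

theorem im_le_norm_sub_sq (z : ℂ) (r : ℝ) : z.im ≤ ‖z - (r : ℂ) ^ 2‖ := by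
  have h : (z - (r : ℂ) ^ 2).im = z.im := by
    rw [← Complex.ofReal_pow, Complex.sub_im, Complex.ofReal_im, sub_zero]
  exact h ▸ (le_abs_self _).trans (Complex.abs_im_le_norm _)

/-- For `r ≥ 0` the imaginary part of `-rᵏ/(z - r²)` is `rᵏ Im z / |z - r²|²`, and the component is
a positive measure. -/
theorem neg_componentTransform_mem_nevanlinnaClass {Y : HarmonicBasis n}
    {μ : SignedMeasure (Space n)} (hμ : IsPseudoPositive Y μ) {i : HIndex n}
    (hk : Integrable (fun r : ℝ => r ^ i.1) (compMeasure Y μ i)) :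
    (fun z => -componentTransform Y μ i z) ∈ nevanlinnaClass := by
  refine ⟨fun z hz => (analyticAt_componentTransform hμ hk hz
    (Eventually.of_forall (im_le_norm_sub_sq z))).neg, fun z hz => ?_⟩
  have hint := integrable_cauchy hz ((compMeasure_nonneg Y μ i).and
    (Eventually.of_forall (im_le_norm_sub_sq z))) hk
  change 0 ≤ (-componentTransform Y μ i z).im
  rw [componentTransform_eq hμ, ← integral_neg]
  refine (integral_nonneg_of_ae ?_).trans_eq
    (ContinuousLinearMap.integral_comp_comm Complex.imCLM hint.neg)
  filter_upwards [compMeasure_nonneg Y μ i] with r hr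
  have h1 : (-((r : ℂ) ^ i.1 / (z - (r : ℂ) ^ 2))).im =
      r ^ i.1 * (z.im / Complex.normSq (z - (r : ℂ) ^ 2)) := by
    rw [div_eq_mul_inv, ← mul_neg, ← Complex.ofReal_pow, Complex.im_ofReal_mul, Complex.neg_im, Complex.inv_im, ← Complex.ofReal_pow,
      Complex.sub_im, Complex.ofReal_im, sub_zero]
    ring
  simp only [Pi.zero_apply, Complex.imCLM_apply, h1]
  have := Complex.normSq_nonneg (z - (r : ℂ) ^ 2)
  positivity

/-- The function `δ` bounds the distance from `z` to the squared radii from below. It is kept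
abstract to treat two cases at once: `|z| - R²` for truncations and the distance to `[0, ∞)` for the
full measure. -/
theorem transformIsNevanlinna (hn : 2 ≤ n) {Y : HarmonicBasis n} {μ : SignedMeasure (Space n)}
    (hμ : IsPseudoPositive Y μ) {C D : ℝ} (hM : MomentBound Y μ C D) (hD : 0 < D)
    {Ω : Set (KDQ n)} {δ : ℂ → ℝ} (hδ : Continuous δ)
    (hle : ∀ z i, ∀ᵐ r : ℝ ∂(compMeasure Y μ i), δ z ≤ ‖z - (r : ℂ) ^ 2‖)
    (hΩ : ∀ ζ θ, KDQ.mk ζ θ ∈ Ω → D < ‖ζ‖ ∧ 0 < δ (ζ ^ 2)) : TransformIsNevanlinna Y μ Ω := by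
  refine ⟨KDQ.lift (fun ζ θ => -(ζ⁻¹ * transform Y μ ζ θ)) (fun ζ θ => ?_),
    ⟨fun i z => -componentTransform Y μ i z, ⟨fun i => ?_, fun ζ θ h => ?_, fun K hK hKΩ => ?_⟩,
      fun i => neg_componentTransform_mem_nevanlinnaClass hμ (hM i).1⟩, fun ζ θ _ => rfl⟩
  · rw [transform_neg, inv_neg]
    ring
  · rintro z ⟨ζ, θ, h, rfl⟩
    exact (analyticAt_componentTransform hμ (hM i).1 (hΩ ζ θ h).2 (hle _ i)).neg
  · have hζ : ζ ≠ 0 := norm_pos_iff.1 (hD.trans (hΩ ζ θ h).1)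
    rw [KDQ.lift_mk]
    refine (((hasSum_transform hn hμ hM hD (hΩ ζ θ h).1 (hΩ ζ θ h).2
      (hle _) θ).mul_left ζ⁻¹).neg).congr_fun fun i => ?_
    rw [zpow_sub₀ hζ, zpow_one, zpow_natCast]
    field_simp
  -- On the compact set `|ζ| ≥ A > D` and `δ(ζ²) ≥ E > 0`, which makes the majorant independent of
  -- the point.
  · obtain ⟨A, hA, hA'⟩ := KDQ.exists_lower_bound continuous_norm norm_neg hK (a := D)
      fun ζ θ h => (hΩ ζ θ (hKΩ h)).1
    obtain ⟨E, hE, hE'⟩ := KDQ.exists_lower_bound (hδ.comp (continuous_pow 2))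
      (fun ζ => by simp) hK (a := 0) fun ζ θ h => (hΩ ζ θ (hKΩ h)).2
    refine (HasSumUniformlyOn.of_norm_le_summable (summable_bound hn Y hD hA (C / E))
      fun i p hp => ?_).summableUniformlyOn
    have hA0 : 0 < A := hD.trans hA
    rw [norm_norm, norm_mul, norm_mul, norm_neg, norm_div, norm_one, norm_pow, Complex.norm_real,
      Real.norm_eq_abs, componentTransform_eq hμ]
    have hI := (norm_integral_le_integral_norm _).trans (integral_norm_cauchy_le hM i hE
      ((hle (p.1 ^ 2) i).mono fun r hr => (hE' p.1 p.2 hp).trans hr))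
    calc _ ≤ C * harmonicDim n i.1 * D ^ i.1 / E * (1 / A ^ i.1) * harmonicDim n i.1 := by
          have := (norm_nonneg _).trans hI
          gcongr
          · exact hA' p.1 p.2 hp
          · exact abs_val_sphere_le hn Y i p.2
      _ = _ := by
          rw [div_pow]
          ring

theorem truncation_lower_bound (hn : 2 ≤ n) (Y : HarmonicBasis n) (μ : SignedMeasure (Space n))
    (R : ℝ) (z : ℂ) (i : HIndex n) :
    ∀ᵐ r : ℝ ∂(compMeasure Y (truncation μ R) i), ‖z‖ - R ^ 2 ≤ ‖z - (r : ℂ) ^ 2‖ := by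
  rw [compMeasure_truncation hn]
  filter_upwards [ae_restrict_of_ae (compMeasure_nonneg Y μ i),
    ae_restrict_mem measurableSet_Iic] with r h0 hr
  have h1 := norm_sub_norm_le z ((r : ℂ) ^ 2)
  rw [norm_pow, Complex.norm_real, Real.norm_of_nonneg h0] at h1
  have h2 : r ^ 2 ≤ R ^ 2 := pow_le_pow_left₀ h0 hr 2
  linarith

theorem transformIsNevanlinna_truncation (hn : 2 ≤ n) {Y : HarmonicBasis n}
    {μ : SignedMeasure (Space n)} (hμ : IsPseudoPositive Y μ) {R : ℝ} (hR : 0 < R) :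
    TransformIsNevanlinna Y (truncation μ R) (KDQ.exterior n R) := by
  refine transformIsNevanlinna hn (hμ.truncation hn R) (momentBound_truncation hn hμ hR.le) hR
    (δ := fun z => ‖z‖ - R ^ 2) (by fun_prop) (fun z i => truncation_lower_bound hn Y μ R z i)
    fun ζ θ h => ?_
  have := KDQ.lt_norm_of_mem_exterior hR h
  refine ⟨this, ?_⟩
  rw [norm_pow, sub_pos]
  gcongr

/-- The distance of a complex number from the half-line `[0, ∞)`. -/
def rayDist (z : ℂ) : ℝ := Metric.infDist z ((fun t : ℝ => (t : ℂ)) '' Set.Ici 0)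

theorem rayDist_le (z : ℂ) (r : ℝ) : rayDist z ≤ ‖z - (r : ℂ) ^ 2‖ := by
  rw [← dist_eq_norm]
  exact Metric.infDist_le_dist_of_mem ⟨r ^ 2, sq_nonneg r, by push_cast; rfl⟩

theorem rayDist_pos {z : ℂ} (hz : ∀ t : ℝ, 0 ≤ t → z ≠ (t : ℂ)) : 0 < rayDist z := by
  have hc : IsClosed ((fun t : ℝ => (t : ℂ)) '' Set.Ici 0) :=
    Complex.isometry_ofReal.isClosedEmbedding.isClosedMap _ isClosed_Ici
  refine (hc.notMem_iff_infDist_pos ⟨0, 0, by simp, by simp⟩).1 ?_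
  rintro ⟨t, ht, rfl⟩
  exact hz t ht rfl

theorem transformIsNevanlinna_slit (hn : 2 ≤ n) {Y : HarmonicBasis n}
    {μ : SignedMeasure (Space n)} (hμ : IsPseudoPositive Y μ) {C D : ℝ}
    (hM : MomentBound Y μ C D) (hD : 0 < D) :
    TransformIsNevanlinna Y μ (KDQ.exterior n D ∩ KDQ.slit n) :=
  transformIsNevanlinna hn hμ hM hD (δ := rayDist) (Metric.continuous_infDist_pt _)
    (fun z _ => Eventually.of_forall (rayDist_le z))
    fun _ _ h => ⟨KDQ.lt_norm_of_mem_exterior hD h.1, rayDist_pos (KDQ.sq_ne_of_mem_slit h.2)⟩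

end Nevanlinna

/-! ### The transform of a truncation as an integral of the kernel -/

section KernelIntegral

variable {n : ℕ}

theorem measurable_kernel (ζ : ℂ) (θ : Sphere n) : Measurable (kernel ζ θ) := by
  unfold kernel distRoot
  fun_prop

theorem ae_variation_truncation (μ : SignedMeasure (Space n)) (R : ℝ) :
    ∀ᵐ x ∂(truncation μ R).variation, ‖x‖ ≤ R := by
  rw [truncation, VectorMeasure.variation_restrict measurableSet_closedBall]
  filter_upwards [ae_restrict_mem measurableSet_closedBall] with x hx
  exact mem_closedBall_zero_iff.1 hx

theorem integrable_kernel (hn : 2 ≤ n) (Y : HarmonicBasis n) (μ : SignedMeasure (Space n)) {R : ℝ}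
    (hR : 0 < R) {ζ : ℂ} (hζ : R < ‖ζ‖) (θ : Sphere n) :
    (truncation μ R).Integrable (kernel ζ θ) := by
  refine Integrable.of_bound (measurable_kernel ζ θ).aestronglyMeasurable
    (∑' i : HIndex n, (‖ζ‖ / (‖ζ‖ ^ 2 - R ^ 2)) *
      ((harmonicDim n i.1 : ℝ) ^ 2 * (R / ‖ζ‖) ^ i.1)) ?_
  filter_upwards [ae_variation_truncation μ R] with x hx
  rw [← (hasSum_kernel hn Y θ x (hx.trans_lt hζ)).tsum_eq]
  exact tsum_of_norm_bounded (summable_bound hn Y hR hζ _).hasSum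
    fun i => norm_kernel_term_le hn Y θ x hx hζ i

theorem transform_truncation_eq (hn : 2 ≤ n) {Y : HarmonicBasis n} {μ : SignedMeasure (Space n)}
    (hμ : IsPseudoPositive Y μ) {R : ℝ} (hR : 0 < R) {ζ : ℂ} (hζ : R < ‖ζ‖) (θ : Sphere n) :
    transform Y (truncation μ R) ζ θ = ∫ᵛ x, kernel ζ θ x ∂<•(truncation μ R) := by
  have hae := ae_variation_truncation μ R
  set F : HIndex n → Space n → ℂ := fun i x => ζ ^ (1 - (i.1 : ℤ)) * (Y.val i θ : ℂ) *
    (Y.angular i x * ((‖x‖ : ℂ) ^ i.1 / (ζ ^ 2 - (‖x‖ : ℂ) ^ 2))) with hF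
  have hm : ∀ i, Measurable (F i) := fun i => by
    have := Y.measurable_angular i
    fun_prop
  have hb : ∀ i, ∀ᵐ x ∂(truncation μ R).variation, ‖F i x‖ ≤ (‖ζ‖ / (‖ζ‖ ^ 2 - R ^ 2)) *
      ((harmonicDim n i.1 : ℝ) ^ 2 * (R / ‖ζ‖) ^ i.1) :=
    fun i => hae.mono fun x hx => norm_kernel_term_le hn Y θ x hx hζ i
  have hsum : ∀ᵐ x ∂(truncation μ R).variation, HasSum (fun i => F i x) (kernel ζ θ x) :=
    hae.mono fun x hx => hasSum_kernel hn Y θ x (hx.trans_lt hζ)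
  -- Sum and integral are exchanged by a majorant constant in `x`, since almost all `x` for the
  -- truncation satisfy `|x| ≤ R < |ζ|`.
  have key : HasSum (fun i => ∫ᵛ x, F i x ∂<•(truncation μ R))
      (∫ᵛ x, kernel ζ θ x ∂<•(truncation μ R)) :=
    VectorMeasure.hasSum_integral_of_dominated_convergence
      (fun i _ => (‖ζ‖ / (‖ζ‖ ^ 2 - R ^ 2)) * ((harmonicDim n i.1 : ℝ) ^ 2 * (R / ‖ζ‖) ^ i.1))
      (fun i => (hm i).aestronglyMeasurable) hb
      (Eventually.of_forall fun x => summable_bound hn Y hR hζ _) (integrable_const _) hsum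
  rw [← key.tsum_eq, transform]
  refine tsum_congr fun i => ?_
  rw [componentTransform_eq (hμ.truncation hn R), ← integral_const_mul]
  have hFi : F i = fun x => Y.angular i x •
      (fun r : ℝ => ζ ^ (1 - (i.1 : ℤ)) * (Y.val i θ : ℂ) *
        ((r : ℂ) ^ i.1 / (ζ ^ 2 - (r : ℂ) ^ 2))) ‖x‖ := by
    ext x
    rw [Complex.real_smul, hF]
    ring
  have hint : (truncation μ R).Integrable (F i) :=
    Integrable.of_bound (hm i).aestronglyMeasurable _ (hb i)
  rw [hFi] at hint ⊢
  exact integral_compMeasure hn (hμ.truncation hn R) i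
    (by fun_prop : Measurable _).stronglyMeasurable hint

end KernelIntegral

/-! ### The asymptotic expansion in sectors -/

section Asymptotics

variable {n : ℕ}

/-- The image of a moment functional under division by `z - r²`. -/
theorem integral_cauchy_recursion {ν : Measure ℝ} {z : ℂ} {ε : ℝ} (hε : 0 < ε) {m : ℕ}
    (h : ∀ᵐ r : ℝ ∂ν, 0 ≤ r ∧ ε ≤ ‖z - (r : ℂ) ^ 2‖) (hm : Integrable (fun r : ℝ => r ^ m) ν) :
    z * ∫ r : ℝ, (r : ℂ) ^ m / (z - (r : ℂ) ^ 2) ∂ν =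
      ((∫ r, r ^ m ∂ν : ℝ) : ℂ) + ∫ r : ℝ, (r : ℂ) ^ (m + 2) / (z - (r : ℂ) ^ 2) ∂ν := by
  have h1 := integrable_cauchy hε h hm
  have h2 : Integrable (fun r : ℝ => (r : ℂ) ^ m) ν := by simpa using hm.ofReal (𝕜 := ℂ)
  have e : ∀ᵐ r : ℝ ∂ν, (r : ℂ) ^ (m + 2) / (z - (r : ℂ) ^ 2) =
      z * ((r : ℂ) ^ m / (z - (r : ℂ) ^ 2)) - (r : ℂ) ^ m := by
    filter_upwards [h] with r hr
    have hne : z - (r : ℂ) ^ 2 ≠ 0 := norm_pos_iff.1 (hε.trans_le hr.2)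
    field_simp
    ring
  rw [integral_congr_ae e, integral_sub (h1.const_mul z) h2, integral_const_mul,
    ← integral_complex_ofReal]
  push_cast
  ring

/-- Iterates `integral_cauchy_recursion`. Only moments with `j < M` have to exist: the last
integrand grows like the last of these moments, thanks to the denominator. -/
theorem scaled_cauchy_sub {ν : Measure ℝ} {z : ℂ} {ε : ℝ} (hε : 0 < ε) {k : ℕ}
    (h : ∀ᵐ r : ℝ ∂ν, 0 ≤ r ∧ ε ≤ ‖z - (r : ℂ) ^ 2‖) (hz : z ≠ 0) (M : ℕ)
    (hM : ∀ j < M, Integrable (fun r : ℝ => r ^ (k + 2 * j)) ν) :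
    z ^ M * ((∫ r : ℝ, (r : ℂ) ^ k / (z - (r : ℂ) ^ 2) ∂ν) -
      ∑ j ∈ Finset.range M, ((∫ r, r ^ (k + 2 * j) ∂ν : ℝ) : ℂ) / z ^ (j + 1)) =
      ∫ r : ℝ, (r : ℂ) ^ (k + 2 * M) / (z - (r : ℂ) ^ 2) ∂ν := by
  induction M with
  | zero => simp
  | succ M ih =>
    have h1 := ih fun j hj => hM j (hj.trans M.lt_succ_self)
    have h2 := integral_cauchy_recursion hε h (hM M M.lt_succ_self)
    rw [← h1] at h2
    rw [show k + 2 * (M + 1) = k + 2 * M + 2 by ring, ← sub_eq_iff_eq_add'.2 h2,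
      Finset.sum_range_succ]
    field_simp
    ring

theorem continuous_transform (hn : 2 ≤ n) {Y : HarmonicBasis n} {μ : SignedMeasure (Space n)}
    (hμ : IsPseudoPositive Y μ) {C D : ℝ} (hM : MomentBound Y μ C D) (hD : 0 < D) {ζ : ℂ}
    (hζ : D < ‖ζ‖) {ε : ℝ} (hε : 0 < ε)
    (h : ∀ i, ∀ᵐ r : ℝ ∂(compMeasure Y μ i), ε ≤ ‖ζ ^ 2 - (r : ℂ) ^ 2‖) :
    Continuous (transform Y μ ζ) := by
  refine continuous_tsum (fun i => ?_) (summable_bound hn Y hD hζ _)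
    fun i θ => norm_transform_term_le hn hμ hM i (norm_pos_iff.1 (hD.trans hζ)) hε (h i) θ
  have := (Y.continuous_val i).comp (continuous_subtype_val (p := (· ∈ Metric.sphere (0 : Space n) 1)))
  simp only [Function.comp_def] at this
  fun_prop

theorem integrable_transform_mul (hn : 2 ≤ n) {Y : HarmonicBasis n} {μ : SignedMeasure (Space n)}
    (hμ : IsPseudoPositive Y μ) {C D : ℝ} (hM : MomentBound Y μ C D) (hD : 0 < D) {ζ : ℂ}
    (hζ : D < ‖ζ‖) {ε : ℝ} (hε : 0 < ε)
    (h : ∀ i, ∀ᵐ r : ℝ ∂(compMeasure Y μ i), ε ≤ ‖ζ ^ 2 - (r : ℂ) ^ 2‖) (j : HIndex n) :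
    Integrable (fun θ : Sphere n => transform Y μ ζ θ * (Y.val j θ : ℂ)) (sphereMeasure n) := by
  refine integrable_sphere hn ((continuous_transform hn hμ hM hD hζ hε h).mul ?_)
  exact Complex.continuous_ofReal.comp ((Y.continuous_val j).comp continuous_subtype_val)

theorem integral_val_mul_val (Y : HarmonicBasis n) (i j : HIndex n) :
    ∫ θ : Sphere n, ((Y.val i θ : ℂ) * (Y.val j θ : ℂ)) ∂(sphereMeasure n) =
      if i = j then 1 else 0 := by
  have := congrArg (fun r : ℝ => (r : ℂ)) (Y.orthonormal i j)
  simp only [← integral_complex_ofReal] at this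
  push_cast at this
  exact this.trans (by split_ifs <;> simp)

/-- The series is integrated term by term over the sphere, with a majorant constant in `θ`, and
orthonormality leaves one term. -/
theorem harmonicCoefficient_eq (hn : 2 ≤ n) {Y : HarmonicBasis n} {μ : SignedMeasure (Space n)}
    (hμ : IsPseudoPositive Y μ) {C D : ℝ} (hM : MomentBound Y μ C D) (hD : 0 < D) {ζ : ℂ}
    (hζ : D < ‖ζ‖) {ε : ℝ} (hε : 0 < ε)
    (h : ∀ i, ∀ᵐ r : ℝ ∂(compMeasure Y μ i), ε ≤ ‖ζ ^ 2 - (r : ℂ) ^ 2‖) (j : HIndex n) :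
    harmonicCoefficient Y μ j ζ =
      ζ ^ (1 - (j.1 : ℤ)) * componentTransform Y μ j (ζ ^ 2) := by
  have hv : ∀ i : HIndex n, Continuous fun θ : Sphere n => (Y.val i θ : ℂ) := fun i =>
    Complex.continuous_ofReal.comp ((Y.continuous_val i).comp continuous_subtype_val)
  have := isProbabilityMeasure_sphereMeasure hn
  have hζ0 : ζ ≠ 0 := norm_pos_iff.1 (hD.trans hζ)
  have key := hasSum_integral_of_dominated_convergence (μ := sphereMeasure n)
    (F := fun (i : HIndex n) (θ : Sphere n) => ζ ^ (1 - (i.1 : ℤ)) * (Y.val i θ : ℂ) *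
      componentTransform Y μ i (ζ ^ 2) * (Y.val j θ : ℂ))
    (f := fun θ => transform Y μ ζ θ * (Y.val j θ : ℂ))
    (fun i _ => harmonicDim n j.1 * (‖ζ‖ * C / ε) *
      ((harmonicDim n i.1 : ℝ) ^ 2 * (D / ‖ζ‖) ^ i.1))
    (fun i => by
      have h1 := hv i
      have h2 := hv j
      exact Continuous.aestronglyMeasurable (by fun_prop))
    (fun i => Eventually.of_forall fun θ => by
      rw [norm_mul, mul_comm, mul_assoc (harmonicDim n j.1 : ℝ), Complex.norm_real]
      exact mul_le_mul (abs_val_sphere_le hn Y j θ)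
        (norm_transform_term_le hn hμ hM i hζ0 hε (h i) θ) (norm_nonneg _) (by positivity))
    (Eventually.of_forall fun θ => summable_bound hn Y hD hζ _) (integrable_const _)
    (Eventually.of_forall fun θ => (hasSum_transform hn hμ hM hD hζ hε h θ).mul_right _)
  rw [harmonicCoefficient, ← key.tsum_eq, tsum_eq_single j]
  · have e : ∀ θ : Sphere n, ζ ^ (1 - (j.1 : ℤ)) * (Y.val j θ : ℂ) *
      componentTransform Y μ j (ζ ^ 2) * (Y.val j θ : ℂ) = ζ ^ (1 - (j.1 : ℤ)) *
      componentTransform Y μ j (ζ ^ 2) * ((Y.val j θ : ℂ) * (Y.val j θ : ℂ)) := fun θ => by ring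
    simp only [e, integral_const_mul, integral_val_mul_val, if_true, mul_one]
  · intro i hij
    have e : ∀ θ : Sphere n, ζ ^ (1 - (i.1 : ℤ)) * (Y.val i θ : ℂ) *
      componentTransform Y μ i (ζ ^ 2) * (Y.val j θ : ℂ) = ζ ^ (1 - (i.1 : ℤ)) *
      componentTransform Y μ i (ζ ^ 2) * ((Y.val i θ : ℂ) * (Y.val j θ : ℂ)) := fun θ => by ring
    simp only [e, integral_const_mul, integral_val_mul_val, if_neg hij, mul_zero]

/-- The error of the asymptotic expansion is again a Stieltjes transform. -/
theorem scaledRemainder_sub (hn : 2 ≤ n) {Y : HarmonicBasis n} {μ : SignedMeasure (Space n)}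
    (hμ : IsPseudoPositive Y μ) {s : HIndex n → ℕ → ℝ} {J : ℕ} (hs : SolvesMomentProblem Y μ s J)
    {C D : ℝ} (hC : 0 < C) (hD : 0 < D) (hg : GrowthBound s C D) {ζ : ℂ} (hζ : D < ‖ζ‖)
    (hslit : ∀ t : ℝ, 0 ≤ t → ζ ^ 2 ≠ (t : ℂ)) (i : HIndex n) {M : ℕ} (hMJ : M ≤ J) :
    scaledRemainder Y μ s M i ζ - (s i M : ℂ) =
      ∫ r : ℝ, (r : ℂ) ^ (i.1 + 2 * (M + 1)) / (ζ ^ 2 - (r : ℂ) ^ 2) ∂(compMeasure Y μ i) := by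
  have hζ0 : ζ ≠ 0 := norm_pos_iff.1 (hD.trans hζ)
  have hray := fun j => Eventually.of_forall (f := ae (compMeasure Y μ j)) (rayDist_le (ζ ^ 2))
  -- With `M + 1` steps the subtracted sum includes the term of `s_M`, which moves the limit itself
  -- to the left-hand side.
  have h := scaled_cauchy_sub (rayDist_pos hslit) ((compMeasure_nonneg Y μ i).and (hray i))
    (pow_ne_zero 2 hζ0) (M + 1) fun j hj => (hs.moment hn hμ i (by omega)).1
  have hsum : ∑ j ∈ Finset.range M,
      ((∫ r, r ^ (i.1 + 2 * j) ∂(compMeasure Y μ i) : ℝ) : ℂ) / (ζ ^ 2) ^ (j + 1) =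
      ∑ j ∈ Finset.range M, (s i j : ℂ) / (ζ ^ 2) ^ (j + 1) := Finset.sum_congr rfl fun j hj => by
    rw [(hs.moment hn hμ i ((Finset.mem_range.1 hj).le.trans hMJ)).2]
  rw [← h, scaledRemainder, harmonicCoefficient_eq hn hμ (hs.momentBound hn hμ hC hD hg) hD hζ
    (rayDist_pos hslit) hray, componentTransform_eq hμ, zpow_sub₀ hζ0, zpow_one, zpow_natCast,
    Finset.sum_range_succ, (hs.moment hn hμ i hMJ).2, hsum]
  have e : ∑ j ∈ Finset.range M, (s i j : ℂ) / ζ ^ (i.1 + 2 * j + 1) =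
      ζ / ζ ^ i.1 * ∑ j ∈ Finset.range M, (s i j : ℂ) / (ζ ^ 2) ^ (j + 1) := by
    rw [Finset.mul_sum]
    refine Finset.sum_congr rfl fun j _ => ?_
    field_simp
    ring
  rw [e]
  field_simp
  ring

/-- By the law of cosines `|z - t|² ≥ |z|² - 2t|z| cos δ + t²`; completing the square in either
variable leaves `sin² δ` times the square of the other. -/
theorem sector_bound {δ : ℝ} (h0 : 0 < δ) (h1 : δ < Real.pi / 2) {z : ℂ} (hz : δ ≤ z.arg) {t : ℝ}
    (ht : 0 ≤ t) : Real.sin δ * max ‖z‖ t ≤ ‖z - (t : ℂ)‖ := by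
  have hcos : Real.cos z.arg ≤ Real.cos δ :=
    Real.cos_le_cos_of_nonneg_of_le_pi h0.le (Complex.arg_le_pi z) hz
  have hre : z.re ≤ ‖z‖ * Real.cos δ := by
    rw [← Complex.norm_mul_cos_arg z]
    exact mul_le_mul_of_nonneg_left hcos (norm_nonneg z)
  have hsin : 0 ≤ Real.sin δ := Real.sin_nonneg_of_nonneg_of_le_pi h0.le (by linarith)
  have hsq : ‖z - (t : ℂ)‖ ^ 2 = ‖z‖ ^ 2 - 2 * t * z.re + t ^ 2 := by
    rw [Complex.sq_norm, Complex.sq_norm, Complex.normSq_apply, Complex.normSq_apply]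
    simp only [Complex.sub_re, Complex.sub_im, Complex.ofReal_re, Complex.ofReal_im]
    ring
  have hlow : ‖z‖ ^ 2 - 2 * t * (‖z‖ * Real.cos δ) + t ^ 2 ≤ ‖z - (t : ℂ)‖ ^ 2 := by
    rw [hsq]
    have := mul_le_mul_of_nonneg_left hre ht
    linarith
  have hsc := Real.sin_sq_add_cos_sq δ
  have hsc' : Real.sin δ ^ 2 = 1 - Real.cos δ ^ 2 := by linarith
  refine abs_le_of_sq_le_sq' ?_ (norm_nonneg _) |>.2
  rcases max_choice ‖z‖ t with h | h <;> rw [h, mul_pow, hsc'] <;> refine le_trans ?_ hlow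
  · nlinarith [sq_nonneg (t - ‖z‖ * Real.cos δ)]
  · nlinarith [sq_nonneg (‖z‖ - t * Real.cos δ)]

theorem sector_sq_ne {δ : ℝ} (h0 : 0 < δ) {ζ : ℂ} (hζ : ζ ∈ sector δ) (t : ℝ) (ht : 0 ≤ t) :
    ζ ^ 2 ≠ (t : ℂ) := fun h => by
  have := hζ.1
  rw [h, Complex.arg_ofReal_of_nonneg ht] at this
  exact this.not_gt h0

/-- The factor `r²/max(T, r²)` is at most `1` and tends to `0` pointwise, so the moment of order `m`
alone dominates; no moment of order `m + 2` is required. -/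
theorem tendsto_truncated_moment {ν : Measure ℝ} (h0 : ∀ᵐ r : ℝ ∂ν, 0 ≤ r) {m : ℕ}
    (hm : Integrable (fun r : ℝ => r ^ m) ν) :
    Tendsto (fun T : ℝ => ∫ r, r ^ m * (r ^ 2 / max T (r ^ 2)) ∂ν) atTop (𝓝 0) := by
  have key := tendsto_integral_filter_of_dominated_convergence (μ := ν) (l := (atTop : Filter ℝ))
    (F := fun (T r : ℝ) => r ^ m * (r ^ 2 / max T (r ^ 2))) (f := fun _ => (0 : ℝ))
    (fun r => r ^ m) (Eventually.of_forall fun T => Measurable.aestronglyMeasurable (by fun_prop))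
    ?_ hm ?_
  · simpa using key
  · filter_upwards with T
    filter_upwards [h0] with r hr
    have h1 : 0 ≤ r ^ 2 / max T (r ^ 2) := div_nonneg (sq_nonneg r) (le_max_of_le_right (sq_nonneg r))
    rw [Real.norm_of_nonneg (by positivity)]
    exact mul_le_of_le_one_right (by positivity)
      (div_le_one_of_le₀ (le_max_right _ _) (le_max_of_le_right (sq_nonneg r)))
  · refine Eventually.of_forall fun r => ?_
    have h1 : Tendsto (fun T : ℝ => r ^ 2 / max T (r ^ 2)) atTop (𝓝 0) := by
      refine squeeze_zero' (Eventually.of_forall fun T => div_nonneg (sq_nonneg r)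
        (le_max_of_le_right (sq_nonneg r))) ?_
        ((tendsto_const_nhds (x := r ^ 2)).div_atTop tendsto_id)
      filter_upwards [eventually_gt_atTop 0] with T hT
      exact div_le_div_of_nonneg_left (sq_nonneg r) hT (le_max_left _ _)
    simpa using h1.const_mul (r ^ m)

theorem norm_integral_cauchy_le_of_sector {ν : Measure ℝ} (h0 : ∀ᵐ r : ℝ ∂ν, 0 ≤ r) {m : ℕ}
    (hm : Integrable (fun r : ℝ => r ^ m) ν) {δ : ℝ} (hδ : 0 < δ) (hδ' : δ < Real.pi / 2) {z : ℂ}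
    (hz : δ ≤ z.arg) :
    ‖∫ r : ℝ, (r : ℂ) ^ (m + 2) / (z - (r : ℂ) ^ 2) ∂ν‖ ≤
      (Real.sin δ)⁻¹ * ∫ r, r ^ m * (r ^ 2 / max ‖z‖ (r ^ 2)) ∂ν := by
  have hsin : 0 < Real.sin δ := Real.sin_pos_of_pos_of_lt_pi hδ (by linarith)
  have hz0 : z ≠ 0 := fun h => by
    rw [h, Complex.arg_zero] at hz
    linarith
  rw [← integral_const_mul]
  refine norm_integral_le_of_norm_le (Integrable.const_mul ?_ _) ?_
  · refine hm.mono (Measurable.aestronglyMeasurable (by fun_prop)) ?_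
    filter_upwards with r
    have h1 : 0 ≤ r ^ 2 / max ‖z‖ (r ^ 2) :=
      div_nonneg (sq_nonneg r) (le_max_of_le_right (sq_nonneg r))
    rw [norm_mul, Real.norm_of_nonneg h1]
    exact mul_le_of_le_one_right (norm_nonneg _)
      (div_le_one_of_le₀ (le_max_right _ _) (le_max_of_le_right (sq_nonneg r)))
  · filter_upwards [h0] with r hr
    have h2 := sector_bound hδ hδ' hz (sq_nonneg r)
    push_cast at h2
    have h3 : 0 < max ‖z‖ (r ^ 2) := lt_max_of_lt_left (norm_pos_iff.2 hz0)
    rw [norm_div, norm_pow, Complex.norm_real, Real.norm_of_nonneg hr]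
    calc r ^ (m + 2) / ‖z - (r : ℂ) ^ 2‖ ≤ r ^ (m + 2) / (Real.sin δ * max ‖z‖ (r ^ 2)) :=
          div_le_div_of_nonneg_left (by positivity) (by positivity) h2
      _ = _ := by
          rw [pow_add]
          field_simp

theorem exists_norm_scaledRemainder_sub_lt (hn : 2 ≤ n) {Y : HarmonicBasis n}
    {μ : SignedMeasure (Space n)} (hμ : IsPseudoPositive Y μ) {s : HIndex n → ℕ → ℝ} {J : ℕ}
    (hs : SolvesMomentProblem Y μ s J) {C D : ℝ} (hC : 0 < C) (hD : 0 < D)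
    (hg : GrowthBound s C D) (i : HIndex n) {M : ℕ} (hM : M ≤ J) {δ : ℝ} (hδ : 0 < δ)
    (hδ' : δ < Real.pi / 2) {ε : ℝ} (hε : 0 < ε) :
    ∃ ρ : ℝ, ∀ ζ ∈ sector δ, ρ < ‖ζ‖ → ‖scaledRemainder Y μ s M i ζ - (s i M : ℂ)‖ < ε := by
  have hsin : 0 < Real.sin δ := Real.sin_pos_of_pos_of_lt_pi hδ (by linarith)
  have hint := (hs.moment hn hμ i hM).1
  have h0 := compMeasure_nonneg Y μ i
  obtain ⟨T, hT⟩ := eventually_atTop.1 ((tendsto_truncated_moment h0 hint).eventually_lt_const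
    (mul_pos hsin hε))
  -- The threshold `T` concerns `|ζ²|`; the bound `|ζ| > 1` ensures `|ζ|² ≥ |ζ| > T`.
  refine ⟨max D (max 1 T), fun ζ hζ hρ => ?_⟩
  obtain ⟨h1, h2, h3⟩ : D < ‖ζ‖ ∧ 1 < ‖ζ‖ ∧ T < ‖ζ‖ := by simpa using hρ
  rw [scaledRemainder_sub hn hμ hs hC hD hg h1 (sector_sq_ne hδ hζ) i hM,
    show i.1 + 2 * (M + 1) = i.1 + 2 * M + 2 by ring]
  refine (norm_integral_cauchy_le_of_sector h0 hint hδ hδ' hζ.1).trans_lt ?_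
  rw [inv_mul_lt_iff₀ hsin]
  refine hT _ ?_
  rw [norm_pow]
  nlinarith

end Asymptotics

/-! ### Spherical harmonics exist in every degree -/

section Dimension

variable {n : ℕ}

theorem zonalDeriv_succ_pos (hn : 2 ≤ n) (k : ℕ) : 0 < zonalDeriv n (k + 1) := by
  have hn' : (2 : ℝ) ≤ n := by exact_mod_cast hn
  rcases k with _ | k
  · exact one_pos
  · have h1 : (0 : ℝ) < k + n - 1 := by
      have := Nat.cast_nonneg (α := ℝ) k
      linarith
    have h2 : (0 : ℝ) < 2 * k + n := by positivity
    change (0 : ℝ) < (k + 2) * (k + n - 1) / (2 * k + n)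
    positivity

/-- Differentiation along `η` lowers the degree with a nonzero factor and ends at the constant `1`.
-/
theorem zonal_ne_zero (hn : 2 ≤ n) {η : Fin n → ℝ} (hη : ∑ i, η i ^ 2 = 1) (k : ℕ) :
    zonal η k ≠ 0 := by
  induction k with
  | zero => exact one_ne_zero
  | succ k ih =>
    intro h
    have h1 := dirDeriv_zonal hn hη k
    rw [h, map_zero] at h1
    rcases mul_eq_zero.1 h1.symm with h2 | h2
    · exact (zonalDeriv_succ_pos hn k).ne' (by simpa using h2)
    · exact ih h2

theorem harmonicDim_pos (hn : 2 ≤ n) (Y : HarmonicBasis n) (k : ℕ) : 0 < harmonicDim n k := by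
  have := Module.Finite.of_basis (Y.basis k)
  obtain ⟨η⟩ := exists_sphere hn
  refine Nat.pos_of_ne_zero fun h => zonal_ne_zero hn (sum_sq_sphere η) k ?_
  have h1 : solidHarmonics n k = ⊥ := Submodule.finrank_eq_zero.1 h
  have h2 : zonal (fun i => (η : Space n) i) k ∈ solidHarmonics n k :=
    mem_solidHarmonics.2 ⟨zonal_isHomogeneous _ k, polyLaplacian_zonal hn _ k⟩
  rwa [h1, Submodule.mem_bot] at h2

end Dimension

/-! ### A measure on concentric spheres -/

section Shells

variable {n : ℕ}

/-- Radii of spheres, growing so fast that the measure `shellMeasure` on their union is finite. -/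
def shellRadius (n k : ℕ) : ℝ := 2 ^ k * (1 + (harmonicDim n k : ℝ) ^ 2)

theorem two_pow_le_shellRadius (n k : ℕ) : 2 ^ k ≤ shellRadius n k :=
  le_mul_of_one_le_right (by positivity) (by nlinarith [sq_nonneg (harmonicDim n k : ℝ)])

theorem one_le_shellRadius (n k : ℕ) : 1 ≤ shellRadius n k :=
  (one_le_pow₀ one_le_two).trans (two_pow_le_shellRadius n k)

theorem shellRadius_pos (n k : ℕ) : 0 < shellRadius n k := one_pos.trans_le (one_le_shellRadius n k)

/-- Gives finiteness and absolute convergence of all moments: for `k > m` the terms are at most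
`d_k²/R_k`, and the radius `R_k` contains the factor `2ᵏ d_k²` to make this at most `2⁻ᵏ`. -/
theorem summable_shell (n m : ℕ) :
    Summable fun k => (shellRadius n k ^ k)⁻¹ * (harmonicDim n k : ℝ) ^ 2 * shellRadius n k ^ m := by
  refine Summable.of_norm_bounded_eventually_nat
    (g := fun k => (1 / 2 : ℝ) ^ k) summable_geometric_two ?_
  filter_upwards [eventually_ge_atTop (m + 1)] with k hk
  have h0 := shellRadius_pos n k
  rw [Real.norm_of_nonneg (by positivity)]
  have h1 : shellRadius n k ^ (m + 1) ≤ shellRadius n k ^ k :=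
    pow_le_pow_right₀ (one_le_shellRadius n k) hk
  have h2 : 2 ^ k * (harmonicDim n k : ℝ) ^ 2 ≤ shellRadius n k := by
    rw [shellRadius, mul_add, mul_one]
    exact le_add_of_nonneg_left (by positivity)
  calc (shellRadius n k ^ k)⁻¹ * (harmonicDim n k : ℝ) ^ 2 * shellRadius n k ^ m
      ≤ (shellRadius n k ^ (m + 1))⁻¹ * (harmonicDim n k : ℝ) ^ 2 * shellRadius n k ^ m := by
        gcongr
    _ = (harmonicDim n k : ℝ) ^ 2 / shellRadius n k := by
        rw [pow_succ]
        field_simp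
    _ ≤ (1 / 2) ^ k := by
        rw [div_le_iff₀ h0, one_div, inv_pow, inv_mul_eq_div, le_div_iff₀ (by positivity), mul_comm]
        exact h2

/-- The density of `shellMeasure` on the sphere with number `k`. -/
def shellDensity (Y : HarmonicBasis n) (p : ℕ × Sphere n) : ℝ :=
  (shellRadius n p.1 ^ p.1)⁻¹ * ∑ l, Y.val ⟨p.1, l⟩ p.2

/-- The signed measure on a union of spheres whose component `(k, ℓ)` is the mass `r⁻ᵏ` at the
radius `r` of the sphere with number `k`. -/
def shellMeasure (Y : HarmonicBasis n) : SignedMeasure (Space n) :=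
  (((Measure.count : Measure ℕ).prod (sphereMeasure n)).withDensityᵥ (shellDensity Y)).map
    fun p => shellRadius n p.1 • (p.2 : Space n)

theorem measurable_shellDensity (Y : HarmonicBasis n) : Measurable (shellDensity Y) := by
  refine measurable_from_prod_countable_right fun k => ?_
  have := fun l => ((Y.continuous_val ⟨k, l⟩).comp
    (continuous_subtype_val (p := (· ∈ Metric.sphere (0 : Space n) 1)))).measurable
  have h := (Finset.measurable_fun_sum Finset.univ fun l _ => this l).const_mul
    (shellRadius n k ^ k)⁻¹
  exact h

theorem abs_shellDensity_le (hn : 2 ≤ n) (Y : HarmonicBasis n) (p : ℕ × Sphere n) :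
    |shellDensity Y p| ≤ (shellRadius n p.1 ^ p.1)⁻¹ * (harmonicDim n p.1 : ℝ) ^ 2 := by
  have h0 := shellRadius_pos n p.1
  rw [shellDensity, abs_mul, abs_of_pos (by positivity)]
  gcongr
  refine (Finset.abs_sum_le_sum_abs _ _).trans ((Finset.sum_le_card_nsmul _ _
    (harmonicDim n p.1 : ℝ) fun l _ => abs_val_sphere_le hn Y ⟨p.1, l⟩ p.2).trans_eq ?_)
  simp [sq]

theorem integrable_shellDensity_mul (hn : 2 ≤ n) (Y : HarmonicBasis n) {f : ℕ → ℝ}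
    (hf : Summable fun k => (shellRadius n k ^ k)⁻¹ * (harmonicDim n k : ℝ) ^ 2 * |f k|)
    {g : Sphere n → ℝ} (hg : Measurable g) {c : ℝ} (hc : ∀ θ, |g θ| ≤ c) :
    Integrable (fun p : ℕ × Sphere n => shellDensity Y p • (g p.2 • f p.1))
      ((Measure.count : Measure ℕ).prod (sphereMeasure n)) := by
  have := isProbabilityMeasure_sphereMeasure hn
  have h1 : Integrable (fun k => (shellRadius n k ^ k)⁻¹ * (harmonicDim n k : ℝ) ^ 2 * |f k|)
      (Measure.count : Measure ℕ) := integrable_count_iff.2 hf.norm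
  refine ((h1.comp_fst (sphereMeasure n)).const_mul c).mono' ?_ ?_
  · have h2 := measurable_shellDensity Y
    have h3 : Measurable f := measurable_from_nat
    exact Measurable.aestronglyMeasurable (by fun_prop)
  · refine Eventually.of_forall fun p => ?_
    rw [norm_smul, norm_smul, Real.norm_eq_abs, Real.norm_eq_abs, Real.norm_eq_abs]
    calc |shellDensity Y p| * (|g p.2| * |f p.1|) ≤
        ((shellRadius n p.1 ^ p.1)⁻¹ * (harmonicDim n p.1 : ℝ) ^ 2) * (c * |f p.1|) := by
          gcongr
          · exact (abs_nonneg _).trans (abs_shellDensity_le hn Y p)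
          · exact abs_shellDensity_le hn Y p
          · exact hc p.2
      _ = _ := by ring

/-- The density on sphere `k` is the sum of all harmonics of degree `k`, so orthonormality with
`Y_j` selects the sphere whose number is the degree of `j`. -/
theorem integral_shellDensity_mul (hn : 2 ≤ n) (Y : HarmonicBasis n) {f : ℕ → ℝ}
    (hf : Summable fun k => (shellRadius n k ^ k)⁻¹ * (harmonicDim n k : ℝ) ^ 2 * |f k|)
    (j : HIndex n) :
    ∫ p, shellDensity Y p • (Y.val j p.2 • f p.1)
      ∂((Measure.count : Measure ℕ).prod (sphereMeasure n)) =
      (shellRadius n j.1 ^ j.1)⁻¹ * f j.1 := by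
  have := isProbabilityMeasure_sphereMeasure hn
  have hY : ∀ i : HIndex n, Continuous fun θ : Sphere n => Y.val i θ := fun i =>
    (Y.continuous_val i).comp continuous_subtype_val
  rw [integral_prod _ (integrable_shellDensity_mul hn Y hf (hY j).measurable
    (abs_val_sphere_le hn Y j))]
  have h : ∀ k, ∫ θ : Sphere n, shellDensity Y (k, θ) • (Y.val j θ • f k) ∂(sphereMeasure n) =
      ({j.1} : Set ℕ).indicator (fun _ => (shellRadius n j.1 ^ j.1)⁻¹ * f j.1) k := fun k => by
    have e : ∀ θ : Sphere n, shellDensity Y (k, θ) • (Y.val j θ • f k) =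
        (shellRadius n k ^ k)⁻¹ * f k * ∑ l, Y.val ⟨k, l⟩ θ * Y.val j θ := fun θ => by
      rw [shellDensity, ← Finset.sum_mul, smul_eq_mul, smul_eq_mul]
      ring
    simp only [e]
    have hi : ∀ l, Integrable (fun θ : Sphere n => Y.val ⟨k, l⟩ θ * Y.val j θ)
        (sphereMeasure n) := fun l => integrable_sphere hn ((hY ⟨k, l⟩).mul (hY j))
    rw [integral_const_mul, integral_finsetSum _ fun l _ => hi l]
    have ho : ∀ l, ∫ θ : Sphere n, Y.val ⟨k, l⟩ θ * Y.val j θ ∂(sphereMeasure n) =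
        if (⟨k, l⟩ : HIndex n) = j then 1 else 0 := fun l => Y.orthonormal ⟨k, l⟩ j
    simp only [ho]
    by_cases hk : k = j.1
    · subst hk
      have : ∀ l, ((⟨j.1, l⟩ : HIndex n) = j) ↔ l = j.2 := fun l => by
        obtain ⟨k, m⟩ := j
        simp
      simp [this]
    · have : ∀ l, ¬ ((⟨k, l⟩ : HIndex n) = j) := fun l h => hk (congrArg Sigma.fst h)
      simp [this, hk]
  simp only [h]
  rw [integral_indicator_const _ (measurableSet_singleton _)]
  simp [Measure.real]

theorem integral_shellMeasure (hn : 2 ≤ n) (Y : HarmonicBasis n) {f : ℝ → ℝ} (hfm : Measurable f)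
    (hf : Summable fun k =>
      (shellRadius n k ^ k)⁻¹ * (harmonicDim n k : ℝ) ^ 2 * |f (shellRadius n k)|)
    (j : HIndex n) :
    (shellMeasure Y).Integrable (fun x => Y.angular j x • f ‖x‖) ∧
      ∫ᵛ x, Y.angular j x • f ‖x‖ ∂<•(shellMeasure Y) =
        (shellRadius n j.1 ^ j.1)⁻¹ * f (shellRadius n j.1) := by
  have hY : Continuous fun θ : Sphere n => Y.val j θ :=
    (Y.continuous_val j).comp continuous_subtype_val
  have hG := measurable_shellDensity Y
  have hGi : Integrable (shellDensity Y)
      ((Measure.count : Measure ℕ).prod (sphereMeasure n)) := by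
    have h1 : Summable fun k =>
        (shellRadius n k ^ k)⁻¹ * (harmonicDim n k : ℝ) ^ 2 * |(1 : ℝ)| := by
      simpa using summable_shell n 0
    simpa using integrable_shellDensity_mul hn Y (f := fun _ => 1) h1
      (g := fun _ => 1) measurable_const (c := 1) (by simp)
  have hφ : Measurable fun p : ℕ × Sphere n => shellRadius n p.1 • (p.2 : Space n) := by
    have : Measurable (shellRadius n) := measurable_from_nat
    fun_prop
  have hfm' : Measurable fun x : Space n => Y.angular j x • f ‖x‖ :=
    (Y.measurable_angular j).smul (hfm.comp measurable_norm)
  have e : (fun x : Space n => Y.angular j x • f ‖x‖) ∘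
      (fun p : ℕ × Sphere n => shellRadius n p.1 • (p.2 : Space n)) =
      fun p => Y.val j p.2 • f (shellRadius n p.1) := by
    ext p
    simp only [Function.comp]
    rw [Y.angular_sphere j p.2 (shellRadius_pos n p.1), norm_smul, norm_eq_of_mem_sphere, mul_one,
      Real.norm_of_nonneg (shellRadius_pos n p.1).le]
  have hi := integrable_shellDensity_mul hn Y (f := fun k => f (shellRadius n k)) hf
    hY.measurable (abs_val_sphere_le hn Y j)
  have hi' := (integrable_withDensityᵥ_iff hGi hG).2 hi
  rw [← e] at hi'
  refine ⟨VectorMeasure.Integrable.map hfm'.aestronglyMeasurable hi', ?_⟩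
  rw [shellMeasure, VectorMeasure.integral_map hφ hfm'.aestronglyMeasurable hi']
  have e' := fun p => congrFun e p
  simp only [Function.comp] at e'
  simp only [e']
  rw [integral_withDensityᵥ hGi hG hi, integral_shellDensity_mul hn Y
    (f := fun k => f (shellRadius n k)) hf j]

end Shells

/-! ### Failure of uniformity in the index -/

section Counterexample

variable {n : ℕ}

theorem component_shellMeasure (hn : 2 ≤ n) (Y : HarmonicBasis n) (j : HIndex n) :
    component Y (shellMeasure Y) j =
      ((Real.toNNReal (shellRadius n j.1 ^ j.1)⁻¹) •
        Measure.dirac (shellRadius n j.1)).toSignedMeasure := by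
  have h0 := shellRadius_pos n j.1
  ext s hs
  -- The component is determined by testing `integral_shellMeasure` with indicator functions of sets
  -- of radii.
  have hfm : Measurable (s.indicator fun _ : ℝ => (1 : ℝ)) := measurable_const.indicator hs
  have hf : Summable fun k => (shellRadius n k ^ k)⁻¹ * (harmonicDim n k : ℝ) ^ 2 *
      |s.indicator (fun _ : ℝ => (1 : ℝ)) (shellRadius n k)| := by
    refine Summable.of_nonneg_of_le (fun k => ?_) (fun k => ?_) (summable_shell n 0)
    · have := shellRadius_pos n k
      positivity
    · have := shellRadius_pos n k
      gcongr
      by_cases h : shellRadius n k ∈ s <;> simp [h]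
  have h1 := integral_shellMeasure hn Y hfm hf j
  have h2 := (integrable_compMeasure hn Y j hfm.stronglyMeasurable h1.1).2
  rw [h1.2, VectorMeasure.integral_indicator hs, VectorMeasure.integral_const] at h2
  rw [Measure.toSignedMeasure_apply_measurable hs]
  have h3 : component Y (shellMeasure Y) j s = (shellRadius n j.1 ^ j.1)⁻¹ *
      s.indicator (fun _ => 1) (shellRadius n j.1) := by
    rw [← h2]
    simp [VectorMeasure.restrict_apply _ hs]
  rw [h3]
  by_cases h : shellRadius n j.1 ∈ s <;> simp [Measure.real, h, hs, h0.le]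

theorem compMeasure_shellMeasure (hn : 2 ≤ n) (Y : HarmonicBasis n) (j : HIndex n) :
    compMeasure Y (shellMeasure Y) j = (Real.toNNReal (shellRadius n j.1 ^ j.1)⁻¹) •
        Measure.dirac (shellRadius n j.1) := by
  rw [compMeasure, component_shellMeasure hn, Measure.variation_toSignedMeasure]

theorem isPseudoPositive_shellMeasure (hn : 2 ≤ n) (Y : HarmonicBasis n) :
    IsPseudoPositive Y (shellMeasure Y) := fun j => by
  rw [component_shellMeasure hn]
  exact Measure.zero_le_toSignedMeasure _

/-- The moments of `shellMeasure`. -/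
def shellMoment (n : ℕ) (i : HIndex n) (j : ℕ) : ℝ :=
  (shellRadius n i.1 ^ i.1)⁻¹ * shellRadius n i.1 ^ (i.1 + 2 * j)

theorem solvesMomentProblem_shellMeasure (hn : 2 ≤ n) (Y : HarmonicBasis n) (J : ℕ) :
    SolvesMomentProblem Y (shellMeasure Y) (shellMoment n) J := fun i j _ => by
  have e : (fun x : Space n => ‖x‖ ^ (2 * j) * Y.val i x) =
      fun x => Y.angular i x • ‖x‖ ^ (i.1 + 2 * j) := by
    ext x
    rw [← Y.pow_mul_angular, smul_eq_mul, pow_add]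
    ring
  have h := integral_shellMeasure hn Y (f := fun r => r ^ (i.1 + 2 * j)) (by fun_prop) (by
    simpa only [abs_of_pos (pow_pos (shellRadius_pos n _) _)] using summable_shell n (i.1 + 2 * j)) i
  rw [e]
  exact ⟨h.1, h.2.symm⟩

theorem growthBound_shellMoment (n : ℕ) : GrowthBound (shellMoment n) 1 1 := fun i => by
  have h := shellRadius_pos n i.1
  rw [shellMoment, mul_zero, add_zero, inv_mul_cancel₀ (by positivity)]
  simp

/-- For a single mass the error is explicit. At `|ζ| = R_k` its modulus is `R_k^(4N+2)/|ζ² - R_k²| ≥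
R_k^(4N)/2 ≥ 1/2`, while `R_k` exceeds every threshold `ρ`. -/
theorem not_uniform_shellMeasure (hn : 2 ≤ n) (Y : HarmonicBasis n) (N : ℕ) {δ : ℝ}
    (hδ' : δ < Real.pi / 2) :
    ¬ ∀ ε : ℝ, 0 < ε → ∃ ρ : ℝ, ∀ i : HIndex n, ∀ ζ ∈ sector δ, ρ < ‖ζ‖ →
      ‖scaledRemainder Y (shellMeasure Y) (shellMoment n) (2 * N) i ζ -
        (shellMoment n i (2 * N) : ℂ)‖ < ε := by
  intro h
  obtain ⟨ρ, hρ⟩ := h (1 / 2) (by norm_num)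
  obtain ⟨k, hk⟩ := pow_unbounded_of_one_lt (max ρ 1) (one_lt_two (α := ℝ))
  have hr := hk.trans_le (two_pow_le_shellRadius n k)
  set r := shellRadius n k with hrdef
  have hr1 : 1 < r := (le_max_right _ _).trans_lt hr
  have hr0 : 0 < r := one_pos.trans hr1
  -- The angle `π/4` puts `ζ²` on the positive imaginary axis, inside the sector for every `δ <
  -- π/2`.
  set ζ : ℂ := r * Complex.exp ((Real.pi / 4 : ℝ) * Complex.I) with hζdef
  have hnorm : ‖ζ‖ = r := by
    rw [hζdef, norm_mul, Complex.norm_exp_ofReal_mul_I, mul_one, Complex.norm_real,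
      Real.norm_of_nonneg hr0.le]
  have hsq : ζ ^ 2 = ((r ^ 2 : ℝ) : ℂ) * Complex.I := by
    rw [hζdef, mul_pow, ← Complex.exp_nat_mul,
      show ((2 : ℕ) : ℂ) * (((Real.pi / 4 : ℝ) : ℂ) * Complex.I) = Real.pi / 2 * Complex.I by
        push_cast; ring, Complex.exp_pi_div_two_mul_I]
    push_cast
    rfl
  have harg : (ζ ^ 2).arg = Real.pi / 2 := by
    rw [hsq, Complex.arg_real_mul _ (by positivity), Complex.arg_I]
  have hsec : ζ ∈ sector δ := ⟨by rw [harg]; exact hδ'.le, by rw [harg]; linarith⟩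
  have hslit : ∀ t : ℝ, 0 ≤ t → ζ ^ 2 ≠ (t : ℂ) := fun t ht h => by
    rw [h, Complex.arg_ofReal_of_nonneg ht] at harg
    linarith [Real.pi_pos]
  let i : HIndex n := ⟨k, ⟨0, harmonicDim_pos hn Y k⟩⟩
  have hlt := hρ i ζ hsec (hnorm ▸ (le_max_left _ _).trans_lt hr)
  rw [scaledRemainder_sub hn (isPseudoPositive_shellMeasure hn Y)
    (solvesMomentProblem_shellMeasure hn Y (2 * N)) one_pos one_pos (growthBound_shellMoment n)
    (hnorm ▸ hr1) hslit i le_rfl, compMeasure_shellMeasure hn, integral_smul_nnreal_measure,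
    integral_dirac] at hlt
  have hn1 : ‖ζ ^ 2 - ((shellRadius n i.1 : ℝ) : ℂ) ^ 2‖ ≤ 2 * r ^ 2 := by
    refine (norm_sub_le _ _).trans ?_
    rw [norm_pow, norm_pow, hnorm, Complex.norm_real, Real.norm_of_nonneg (shellRadius_pos n _).le]
    exact (two_mul _).ge
  have hn0 : 0 < ‖ζ ^ 2 - ((shellRadius n i.1 : ℝ) : ℂ) ^ 2‖ := by
    rw [norm_pos_iff, sub_ne_zero, ← Complex.ofReal_pow]
    exact hslit _ (sq_nonneg _)
  rw [NNReal.smul_def, norm_smul, norm_div, norm_pow, Complex.norm_real,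
    Real.norm_of_nonneg (shellRadius_pos n _).le, Real.norm_of_nonneg (NNReal.coe_nonneg _),
    Real.coe_toNNReal _ (by have := shellRadius_pos n i.1; positivity)] at hlt
  refine hlt.not_ge ?_
  change 1 / 2 ≤ (r ^ k)⁻¹ * (r ^ (k + 2 * (2 * N + 1)) / _)
  calc (1 / 2 : ℝ) ≤ 1 / 2 * r ^ (4 * N) :=
        le_mul_of_one_le_right (by norm_num) (one_le_pow₀ hr1.le)
    _ = (r ^ k)⁻¹ * (r ^ (k + 2 * (2 * N + 1)) / (2 * r ^ 2)) := by
        rw [show k + 2 * (2 * N + 1) = k + 4 * N + 2 by ring, pow_add, pow_add]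
        field_simp
    _ ≤ _ := by gcongr

end Counterexample

end KleinDirac

end

theorem mainTheorem1 (n : ℕ) (hn : 2 ≤ n) (Y : KleinDirac.HarmonicBasis n) (N : ℕ) :
    (∀ (μ : SignedMeasure (KleinDirac.Space n)) (s : KleinDirac.HIndex n → ℕ → ℝ) (C D : ℝ),
      KleinDirac.IsPseudoPositive Y μ →
      KleinDirac.SolvesMomentProblem Y μ s (2 * N) →
      0 < C → 0 < D → KleinDirac.GrowthBound s C D →
      -- the truncations of the measure: here the transform is the integral of the kernel
      (∀ R : ℝ, 0 < R →
        (∀ ζ : ℂ, R < ‖ζ‖ → ∀ θ : KleinDirac.Sphere n,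
          (KleinDirac.truncation μ R).Integrable (KleinDirac.kernel ζ θ) ∧
          KleinDirac.TransformConverges Y (KleinDirac.truncation μ R) ζ θ ∧
          KleinDirac.transform Y (KleinDirac.truncation μ R) ζ θ =
            ∫ᵛ x, KleinDirac.kernel ζ θ x ∂<•(KleinDirac.truncation μ R)) ∧
        KleinDirac.TransformIsNevanlinna Y (KleinDirac.truncation μ R)
          (KleinDirac.KDQ.exterior n R)) ∧
      -- absolute convergence of the transform
      (∀ ζ : ℂ, D < ‖ζ‖ → (∀ t : ℝ, 0 ≤ t → ζ ^ 2 ≠ (t : ℂ)) → ∀ θ : KleinDirac.Sphere n,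
        KleinDirac.TransformConverges Y μ ζ θ ∧
        Tendsto (fun R : ℝ => KleinDirac.transform Y (KleinDirac.truncation μ R) ζ θ) atTop
          (𝓝 (KleinDirac.transform Y μ ζ θ))) ∧
      -- membership in the pseudo-positive Nevanlinna class
      KleinDirac.TransformIsNevanlinna Y μ
        (KleinDirac.KDQ.exterior n D ∩ KleinDirac.KDQ.slit n) ∧
      -- asymptotic expansion, uniform in the sector for each fixed index
      (∀ i : KleinDirac.HIndex n,
        (∀ ζ : ℂ, D < ‖ζ‖ → (∀ t : ℝ, 0 ≤ t → ζ ^ 2 ≠ (t : ℂ)) →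
          Integrable (fun θ : KleinDirac.Sphere n =>
            KleinDirac.transform Y μ ζ θ * (Y.val i θ : ℂ)) (KleinDirac.sphereMeasure n)) ∧
        ∀ M ≤ 2 * N, ∀ δ : ℝ, 0 < δ → δ < Real.pi / 2 → ∀ ε : ℝ, 0 < ε →
          ∃ ρ : ℝ, ∀ ζ ∈ KleinDirac.sector δ, ρ < ‖ζ‖ →
            ‖KleinDirac.scaledRemainder Y μ s M i ζ - (s i M : ℂ)‖ < ε)) ∧
    -- the asymptotic expansion is in general not uniform in the index
    (∃ (μ : SignedMeasure (KleinDirac.Space n)) (s : KleinDirac.HIndex n → ℕ → ℝ) (C D : ℝ),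
      KleinDirac.IsPseudoPositive Y μ ∧
      KleinDirac.SolvesMomentProblem Y μ s (2 * N) ∧
      0 < C ∧ 0 < D ∧ KleinDirac.GrowthBound s C D ∧
      ∀ δ : ℝ, 0 < δ → δ < Real.pi / 2 →
        ¬ ∀ ε : ℝ, 0 < ε → ∃ ρ : ℝ, ∀ i : KleinDirac.HIndex n,
          ∀ ζ ∈ KleinDirac.sector δ, ρ < ‖ζ‖ →
            ‖KleinDirac.scaledRemainder Y μ s (2 * N) i ζ - (s i (2 * N) : ℂ)‖ < ε) := by
  refine ⟨fun μ s C D hμ hs hC hD hg => ?_, ?_⟩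
  · have hM := hs.momentBound hn hμ hC hD hg
    have hray : ∀ (z : ℂ) (i : KleinDirac.HIndex n),
        ∀ᵐ r : ℝ ∂(KleinDirac.compMeasure Y μ i), KleinDirac.rayDist z ≤ ‖z - (r : ℂ) ^ 2‖ :=
      fun z _ => Eventually.of_forall (KleinDirac.rayDist_le z)
    refine ⟨fun R hR => ⟨fun ζ hζ θ => ⟨KleinDirac.integrable_kernel hn Y μ hR hζ θ, ?_,
        KleinDirac.transform_truncation_eq hn hμ hR hζ θ⟩,
      KleinDirac.transformIsNevanlinna_truncation hn hμ hR⟩,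
      fun ζ hζ hslit θ => ⟨KleinDirac.transformConverges hn hM hD hζ
        (KleinDirac.rayDist_pos hslit) (hray _) θ,
        KleinDirac.tendsto_transform_truncation hn hμ hM hD hζ
          (KleinDirac.rayDist_pos hslit) (hray _) θ⟩,
      KleinDirac.transformIsNevanlinna_slit hn hμ hM hD,
      fun i => ⟨fun ζ hζ hslit => KleinDirac.integrable_transform_mul hn hμ hM hD hζ
        (KleinDirac.rayDist_pos hslit) (hray _) i,
        fun M hMN δ hδ hδ' ε hε =>
          KleinDirac.exists_norm_scaledRemainder_sub_lt hn hμ hs hC hD hg i hMN hδ hδ' hε⟩⟩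
    refine KleinDirac.transformConverges hn (KleinDirac.momentBound_truncation hn hμ hR.le) hR hζ
      (ε := ‖ζ ^ 2‖ - R ^ 2) ?_ (KleinDirac.truncation_lower_bound hn Y μ R _) θ
    rw [norm_pow, sub_pos]
    exact pow_lt_pow_left₀ hζ hR.le two_ne_zero
  · exact ⟨KleinDirac.shellMeasure Y, KleinDirac.shellMoment n, 1, 1,
      KleinDirac.isPseudoPositive_shellMeasure hn Y,
      KleinDirac.solvesMomentProblem_shellMeasure hn Y (2 * N), one_pos, one_pos,
      KleinDirac.growthBound_shellMoment n,
      fun δ _ hδ' => KleinDirac.not_uniform_shellMeasure hn Y N hδ'⟩
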